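/- **Theorem.** $\mathrm{StoqMA}\subseteq\mathrm{SBP}$, where the classes are the following classes of promise problems $(L_{yes},L_{no})$, $L_{yes},L_{no}\subseteq\{0,1\}^*$ disjoint. *SBP.* $(L_{yes},L_{no})\in\mathrm{SBP}$ iff there are a function $F\in\#\mathrm{P}$ and a strictly positive rational-valued function $f$ on $\{0,1\}^*$, computable in polynomial time (numerator and denominator in binary), such that $F(x)\ge f(x)$ for all $x\in L_{yes}$ and $F(x)\le \frac12 f(x)$ for all $x\in L_{no}$. Here $F\in\#\mathrm{P}$ means that there are a polynomial $p$ and a polynomial-time predicate $R$ with $F(x)=\#\{w\in\{0,1\}^{p(|x|)} : R(x,w)=1\}$ for all $x$. *StoqMA.* A stoquastic verifier is a tuple $V=(n,n_w,n_0,n_+,U)$ with $n+n_w+n_0+n_+\ge 1$, where $U$ is a circuit of $X$, CNOT and Toffoli gates on $n+n_w+n_0+n_+$ qubits. Its acceptance probability on an input $x\in\{0,1\}^n$ and a normalized witness state $|\psi\rangle\in(\mathbb{C}^2)^{\otimes n_w}$ is $$\Pr(V;x,\psi)=\langle\psi_{in}|U^\dagger(|+\rangle\langle+|_1\otimes I)U|\psi_{in}\rangle,\qquad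 |\psi_{in}\rangle=|x\rangle\otimes|\psi\rangle\otimes|0\rangle^{\otimes n_0}\otimes|+\rangle^{\otimes n_+},$$ where $|+\rangle=(|0\rangle+|1\rangle)/\sqrt2$ and $|+\rangle\langle +|_1$ acts on the first qubit. Then $(L_{yes},L_{no})\in\mathrm{StoqMA}$ iff there are a family $(V_n)_{n\ge0}$ of stoquastic verifiers, $V_n$ having $n$ input bits, at most polynomially many qubits and gates, and a description computable in polynomial time from $1^n$, and rational thresholds $0\le\epsilon_{no}(n)<\epsilon_{yes}(n)\le1$, computable in polynomial time from $1^n$, with $\epsilon_{yes}(n)-\epsilon_{no}(n)\ge 1/q(n)$ for some polynomial $q$ with positive values, such that for every $x$, with $n=|x|$: - if $x\in L_{yes}$, then $\Pr(V_n;x,\psi)\ge\epsilon_{yes}(n)$ for some normalized $|\psi\rangle$; - if $x\in L_{no}$, then $\Pr(V_n;x,\psi)\le\epsilon_{no}(n)$ for all normalized $|\psi\rangle$. -/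

import Mathlib

namespace Stoq

open Computability

/-! ### Polynomial time -/

/-- `f` is computed by a (multi-stack) Turing machine in a number of steps bounded by a polynomial in
the length of the encoded input; `ea` and `eb` encode inputs and outputs as strings. The machine has
finitely many labels, states and stacks and a finite input alphabet; the symbols it can push are
values of functions on its finite state set, so the other alphabets are in effect finite too. -/
def PolyTime {α β Γ₁ Γ₂ : Type} (ea : α → List Γ₁) (eb : β → List Γ₂) (f : α → β) : Prop :=
  Nonempty (Turing.TM2ComputableInPolyTime ea eb f)

/-- The code of a pair of bit strings, over a two-coloured copy of the binary alphabet. -/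
def encodeStrings : List Bool × List Bool → List (Bool ⊕ Bool) :=
  (encodingProd (encodingList Bool) (encodingList Bool)).encode

/-- The code of a pair of natural numbers, both written in binary. -/
def encodeNats : ℕ × ℕ → List (Bool ⊕ Bool) :=
  (encodingProd encodingNatBool encodingNatBool).encode

/-- A non-negative function with rational values is computable in polynomial time: some
polynomial-time machine outputs a numerator and a non-zero denominator, in binary. The fraction
need not be reduced. -/
def PolyTimeFraction {α Γ : Type} (ea : α → List Γ) (f : α → ℝ) : Prop :=
  ∃ g : α → ℕ × ℕ, PolyTime ea encodeNats g ∧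
    ∀ a, 0 < (g a).2 ∧ f a = ((g a).1 : ℝ) / ((g a).2 : ℝ)

/-! ### Promise problems and the class SBP -/

/-- A promise problem: disjoint sets of yes-instances and no-instances among all bit strings. -/
structure PromiseProblem where
  yes : Set (List Bool)
  no : Set (List Bool)
  disjoint : Disjoint yes no

/-- The class #P: functions counting the witnesses, of length a fixed polynomial in the length of
the input, that are accepted by a polynomial-time predicate. -/
def SharpP : Set (List Bool → ℕ) :=
  {F | ∃ (p : Polynomial ℕ) (R : List Bool × List Bool → Bool),
    PolyTime encodeStrings encodeBool R ∧
    ∀ x, F x = (Finset.univ.filter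
      fun w : Fin (p.eval x.length) → Bool => R (x, List.ofFn w) = true).card}

/-- The class SBP. The threshold is strictly positive: with the value `0` allowed, the two
conditions would hold together for `F = 0` and every promise problem would qualify. -/
def SBP : Set PromiseProblem :=
  {L | ∃ F ∈ SharpP, ∃ f : List Bool → ℝ,
    (∀ x, 0 < f x) ∧
    PolyTimeFraction (id : List Bool → List Bool) f ∧
    (∀ x ∈ L.yes, f x ≤ (F x : ℝ)) ∧
    (∀ x ∈ L.no, (F x : ℝ) ≤ (1 / 2) * f x)}

/-! ### Circuits -/

/-- The gates X, CNOT (control, target) and Toffoli (two controls, target) on `N` qubits, acting on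
distinct qubits. -/
inductive Gate (N : ℕ) where
  | X (t : Fin N) : Gate N
  | CNOT (c t : Fin N) (h : c ≠ t) : Gate N
  | Toffoli (c₁ c₂ t : Fin N) (h : c₁ ≠ c₂) (h₁ : c₁ ≠ t) (h₂ : c₂ ≠ t) : Gate N

/-- The action of a gate on the labels of the computational basis vectors. -/
def Gate.apply {N : ℕ} : Gate N → (Fin N → Bool) → (Fin N → Bool)
  | .X t, b => Function.update b t (!b t)
  | .CNOT c t _, b => Function.update b t (xor (b t) (b c))
  | .Toffoli c₁ c₂ t _ _ _, b => Function.update b t (xor (b t) (b c₁ && b c₂))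

/-- The unitary matrix of a gate in the computational basis. -/
def Gate.matrix {N : ℕ} (g : Gate N) : Matrix (Fin N → Bool) (Fin N → Bool) ℂ :=
  Matrix.of fun b' b => if b' = g.apply b then 1 else 0

/-- The unitary matrix of a circuit; the head of the list is the gate applied first. -/
def circuitMatrix {N : ℕ} : List (Gate N) → Matrix (Fin N → Bool) (Fin N → Bool) ℂ
  | [] => 1
  | g :: gs => circuitMatrix gs * g.matrix

/-! ### Stoquastic verifiers -/

/-- A stoquastic verifier with `n` input bits. The qubits are ordered: input, witness, ancillas
`|0⟩`, ancillas `|+⟩`. There is at least one qubit, as the first one is measured. -/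
structure StoqVerifier (n : ℕ) where
  /-- number of witness qubits -/
  nw : ℕ
  /-- number of ancillas `|0⟩` -/
  n0 : ℕ
  /-- number of ancillas `|+⟩` -/
  np : ℕ
  pos : 0 < n + nw + n0 + np
  gates : List (Gate (n + nw + n0 + np))

namespace StoqVerifier

variable {n : ℕ} (V : StoqVerifier n)

/-- The total number of qubits. -/
abbrev qubits : ℕ := n + V.nw + V.n0 + V.np

/-- The part of a basis label that belongs to the input qubits. -/
def inputPart (b : Fin V.qubits → Bool) : Fin n → Bool :=
  fun i => b (Fin.castAdd V.np (Fin.castAdd V.n0 (Fin.castAdd V.nw i)))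

/-- The part of a basis label that belongs to the witness qubits. -/
def witnessPart (b : Fin V.qubits → Bool) : Fin V.nw → Bool :=
  fun i => b (Fin.castAdd V.np (Fin.castAdd V.n0 (Fin.natAdd n i)))

/-- The part of a basis label that belongs to the ancillas `|0⟩`. -/
def zeroPart (b : Fin V.qubits → Bool) : Fin V.n0 → Bool :=
  fun i => b (Fin.castAdd V.np (Fin.natAdd (n + V.nw) i))

/-- The initial state `|x⟩ ⊗ |ψ⟩ ⊗ |0⟩^{⊗ n0} ⊗ |+⟩^{⊗ np}`; every amplitude of the last factor is
`(1/√2)^np`. -/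
noncomputable def initialState (x : Fin n → Bool) (ψ : (Fin V.nw → Bool) → ℂ) :
    (Fin V.qubits → Bool) → ℂ :=
  fun b => (if V.inputPart b = x then 1 else 0) * ψ (V.witnessPart b) *
    (if V.zeroPart b = fun _ => false then 1 else 0) * ((1 / Real.sqrt 2 : ℝ) : ℂ) ^ V.np

/-- The projector `|+⟩⟨+| ⊗ I` for the first qubit; all entries of `|+⟩⟨+|` are `1/2`. -/
noncomputable def outProjector : Matrix (Fin V.qubits → Bool) (Fin V.qubits → Bool) ℂ :=
  Matrix.of fun b' b => if ∀ i, i ≠ (⟨0, V.pos⟩ : Fin V.qubits) → b' i = b i then 1 / 2 else 0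

/-- The acceptance probability `⟨ψ_in| U† Π_out U |ψ_in⟩`. -/
noncomputable def acceptProb (x : Fin n → Bool) (ψ : (Fin V.nw → Bool) → ℂ) : ℝ :=
  (star (V.initialState x ψ) ⬝ᵥ
    (((circuitMatrix V.gates).conjTranspose * V.outProjector * circuitMatrix V.gates).mulVec
      (V.initialState x ψ))).re

end StoqVerifier

/-- A vector of amplitudes on `m` qubits is a (normalized) state. -/
def IsState {m : ℕ} (ψ : (Fin m → Bool) → ℂ) : Prop :=
  ∑ w, ‖ψ w‖ ^ 2 = 1

/-! ### Uniform families and the class StoqMA -/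

/-- A list of natural numbers as a bit string; each number is written in unary and followed by the
end marker `false`. -/
def encodeTallies (l : List ℕ) : List Bool :=
  l.flatMap fun k => List.replicate k true ++ [false]

/-- A gate as a type tag followed by the indices of its qubits. -/
def Gate.code {N : ℕ} : Gate N → List ℕ
  | .X t => [0, t]
  | .CNOT c t _ => [1, c, t]
  | .Toffoli c₁ c₂ t _ _ _ => [2, c₁, c₂, t]

/-- The description of a verifier as a bit string: the numbers of witness qubits and ancillas,
then the gates in the order of application. -/
def StoqVerifier.encode {n : ℕ} (V : StoqVerifier n) : List Bool :=
  encodeTallies ([V.nw, V.n0, V.np] ++ V.gates.flatMap Gate.code)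

/-- A family of verifiers is uniform if a polynomial-time machine maps the string `1ⁿ` to a
description of the verifier for `n` input bits. -/
def Uniform (V : ∀ n, StoqVerifier n) : Prop :=
  PolyTime unaryEncodeNat (id : List Bool → List Bool) fun n => (V n).encode

/-- The class StoqMA. The thresholds `εyes`, `εno` are functions of the input length, computable in
polynomial time from `1ⁿ`, and separated by an inverse polynomial. -/
def StoqMA : Set PromiseProblem :=
  {L | ∃ (V : ∀ n, StoqVerifier n) (εyes εno : ℕ → ℝ),
    Uniform V ∧
    (∃ q : Polynomial ℕ, ∀ n, (V n).qubits ≤ q.eval n ∧ (V n).gates.length ≤ q.eval n) ∧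
    PolyTimeFraction unaryEncodeNat εyes ∧
    PolyTimeFraction unaryEncodeNat εno ∧
    (∀ n, 0 ≤ εno n ∧ εno n < εyes n ∧ εyes n ≤ 1) ∧
    (∃ q : Polynomial ℕ, ∀ n, 0 < q.eval n ∧ 1 / ((q.eval n : ℕ) : ℝ) ≤ εyes n - εno n) ∧
    (∀ x ∈ L.yes, ∃ ψ, IsState ψ ∧
      εyes x.length ≤ (V x.length).acceptProb x.get ψ) ∧
    (∀ x ∈ L.no, ∀ ψ, IsState ψ →
      (V x.length).acceptProb x.get ψ ≤ εno x.length)}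

end Stoq

/-! The circuit U permutes basis labels, so U†(|+⟩⟨+| ⊗ I)U = (1 + P)/2, where P = U†X₁U is an
involutive permutation. Compressing this projector to the prepared states |x⟩|ψ⟩|0…0⟩|+…+⟩ gives a
real matrix A indexed by witness strings (`acceptMatrix`). It is positive semidefinite, has
non-negative entries, and the acceptance probability of ψ is ⟨ψ, Aψ⟩. Replacing ψ by its entrywise
modulus does not lower this value.

Up to the factor 2^(n₊+1), the entry A(w, w') counts the pairs of a coin c and a string s of n₊ bits
for which P^c maps (x, w, 0, s) to a label with input x, witness w' and all zeros restored
(`acceptMatrix_apply`). What becomes of the bits s is irrelevant, because |+…+⟩ has constant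
amplitudes. Hence 1ᵀA^k 1 is, up to a known power of two, the number of ways to choose an initial
witness and k successive rounds that all succeed (`countBits_accepts_eq`), and this is a #P
function.

If some state is accepted with probability at least ε > 0, then 1ᵀA^k 1 ≥ ε^k (`pow_le_sum_pow`); if
every state is accepted with probability at most ε, then 1ᵀA^k 1 ≤ 2^(n_w) ε^k (`sum_pow_le`).
Padding all random choices to blocks of D bits, the count is at least (ε_yes 2^D)^k in the first
case and at most 2^D (ε_no 2^D)^k in the second. An inverse polynomial gap 1/r makes (ε_no/ε_yes)^r
≤ 1/2, so k = r(D + 1) rounds absorb the factor 2^D and leave the required factor 1/2, for the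
threshold f = (ε_yes 2^D)^k.

The other half of the proof shows that the counted predicate and f are computable in polynomial time
by actual multi-stack machines. Programs that pop, push and call given machines are compiled into
single machines (`Runs.exec`, `PolyTime.of_runs`). Such programs are written only for finite-state
transducers, composition, pairing and iteration with polynomially bounded intermediate results.
Lists, unary and binary arithmetic, the decoding of circuits and their simulation are derived from
these. -/

set_option linter.unusedSectionVars false

namespace Stoq

open Computability Turing Function

/-! ### Bounded executions of stack machines -/

section Exec

variable {K : Type} [DecidableEq K] {Γ : K → Type} {Λ σ : Type}

/-- `Exec m t c c'`: the machine `m` leads from `c` to `c'` in at most `t` steps. -/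
inductive Exec (m : Λ → TM2.Stmt Γ Λ σ) : ℕ → TM2.Cfg Γ Λ σ → TM2.Cfg Γ Λ σ → Prop
  | refl (t : ℕ) (c : TM2.Cfg Γ Λ σ) : Exec m t c c
  | step {t : ℕ} {l : Λ} {v : σ} {S : ∀ k, List (Γ k)} {c : TM2.Cfg Γ Λ σ} :
      Exec m t (TM2.stepAux (m l) v S) c → Exec m (t + 1) ⟨some l, v, S⟩ c

variable {m : Λ → TM2.Stmt Γ Λ σ}

theorem Exec.mono {t t' : ℕ} {c c' : TM2.Cfg Γ Λ σ} (h : Exec m t c c') (ht : t ≤ t') :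
    Exec m t' c c' := by
  induction h generalizing t' with
  | refl t c => exact .refl _ _
  | step h ih =>
    obtain ⟨s, rfl⟩ := Nat.exists_eq_add_of_le' (Nat.one_le_of_lt ht)
    exact .step (ih (by omega))

theorem Exec.trans {t t' : ℕ} {c c' c'' : TM2.Cfg Γ Λ σ} (h : Exec m t c c')
    (h' : Exec m t' c' c'') : Exec m (t + t') c c'' := by
  induction h with
  | refl t c => exact h'.mono (by omega)
  | step h ih => exact ((ih h').step).mono (by omega)

theorem Exec.exists_iterate {t : ℕ} {c c' : TM2.Cfg Γ Λ σ} (h : Exec m t c c') :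
    ∃ n ≤ t, (flip bind (TM2.step m))^[n] (some c) = some c' := by
  induction h with
  | refl t c => exact ⟨0, Nat.zero_le _, rfl⟩
  | step h ih =>
    obtain ⟨n, hn, e⟩ := ih
    exact ⟨n + 1, by omega, by rw [iterate_succ_apply]; exact e⟩

theorem iterate_bind_none (n : ℕ) :
    (flip bind (TM2.step m))^[n] (none : Option (TM2.Cfg Γ Λ σ)) = none := by
  induction n with
  | zero => rfl
  | succ n ih => rw [iterate_succ_apply]; exact ih

/-- A halted configuration steps to `none`, and `none` never leads back to a configuration; so an
iteration that ends in `some c'` has not passed a halt. -/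
theorem Exec.of_iterate {n t : ℕ} (hn : n ≤ t) {c c' : TM2.Cfg Γ Λ σ}
    (h : (flip bind (TM2.step m))^[n] (some c) = some c') : Exec m t c c' := by
  induction n generalizing c t with
  | zero =>
    simp only [iterate_zero, id, Option.some.injEq] at h
    exact h ▸ .refl _ _
  | succ n ih =>
    obtain ⟨s, rfl⟩ := Nat.exists_eq_add_of_le' (Nat.one_le_of_lt hn)
    rw [iterate_succ_apply] at h
    obtain ⟨l, v, S⟩ := c
    cases l with
    | none =>
      have h2 : (flip bind (TM2.step m))^[n] (none : Option (TM2.Cfg Γ Λ σ)) = some c' := h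
      rw [iterate_bind_none] at h2
      cases h2
    | some l => exact .step (ih (by omega) h)

/-- The number of symbols a statement can push. -/
def pushCount : TM2.Stmt Γ Λ σ → ℕ
  | .push _ _ q => pushCount q + 1
  | .peek _ _ q => pushCount q
  | .pop _ _ q => pushCount q
  | .load _ q => pushCount q
  | .branch _ q₁ q₂ => pushCount q₁ + pushCount q₂
  | .goto _ => 0
  | .halt => 0

theorem length_stepAux_le (q : TM2.Stmt Γ Λ σ) (v : σ) (S : ∀ k, List (Γ k)) (k : K) :
    ((TM2.stepAux q v S).stk k).length ≤ (S k).length + pushCount q := by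
  induction q generalizing v S with
  | push k' f q ih =>
    refine (ih _ _).trans ?_
    by_cases h : k = k'
    · subst h; simp [pushCount]; omega
    · simp [pushCount, h]
  | peek k' f q ih => exact ih _ _
  | pop k' f q ih =>
    refine (ih _ _).trans ?_
    by_cases h : k = k'
    · subst h; simp [pushCount]
    · simp [pushCount, h]
  | load f q ih => exact ih _ _
  | branch f q₁ q₂ ih₁ ih₂ =>
    simp only [TM2.stepAux, pushCount]
    cases f v
    · exact (ih₂ _ _).trans (by omega)
    · exact (ih₁ _ _).trans (by omega)
  | goto f => simp [pushCount]
  | halt => simp [pushCount]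

/-- Since a step pushes boundedly many symbols, a bound on the time is also a bound on the length of
the output. This is what keeps compositions polynomial. -/
theorem Exec.length_le {t b : ℕ} {c c' : TM2.Cfg Γ Λ σ} (hb : ∀ l, pushCount (m l) ≤ b)
    (h : Exec m t c c') (k : K) : (c'.stk k).length ≤ (c.stk k).length + b * t := by
  induction h with
  | refl t c => omega
  | @step t l v S c h ih =>
    have h1 := length_stepAux_le (m l) v S k
    have h2 := hb l
    rw [Nat.mul_succ]
    simp only
    omega

end Exec

/-! ### Running a machine as a part of a larger one -/

section Lift

variable {K K' : Type} [DecidableEq K] [DecidableEq K'] {Γ : K → Type} {Λ' σ' Λ σ : Type}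

/-- A statement of a machine with stacks `K'`, labels `Λ'` and states `σ'` as a statement of a larger
machine; halting is replaced by a jump to the label `ex`. -/
def liftStmt (ι : K' → K) (get : σ → σ') (set : σ' → σ → σ) (φ : Λ' → Λ) (ex : Λ) :
    TM2.Stmt (fun k => Γ (ι k)) Λ' σ' → TM2.Stmt Γ Λ σ
  | .push k f q => .push (ι k) (fun w => f (get w)) (liftStmt ι get set φ ex q)
  | .peek k f q => .peek (ι k) (fun w o => set (f (get w) o) w) (liftStmt ι get set φ ex q)
  | .pop k f q => .pop (ι k) (fun w o => set (f (get w) o) w) (liftStmt ι get set φ ex q)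
  | .load f q => .load (fun w => set (f (get w)) w) (liftStmt ι get set φ ex q)
  | .branch f q₁ q₂ =>
      .branch (fun w => f (get w)) (liftStmt ι get set φ ex q₁) (liftStmt ι get set φ ex q₂)
  | .goto f => .goto (fun w => φ (f (get w)))
  | .halt => .goto (fun _ => ex)

variable {ι : K' → K} {get : σ → σ'} {set : σ' → σ → σ} {φ : Λ' → Λ} {ex : Λ}

/-- The laws `hgs`, `hss`, `hsg` make the state of the smaller machine a component of the larger
state, and injectivity of `ι` keeps its stacks distinct. So the lifted statement does the same work
inside that component and leaves all other stacks alone. -/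
theorem stepAux_liftStmt (hι : Injective ι) (hgs : ∀ a w, get (set a w) = a)
    (hss : ∀ a b w, set a (set b w) = set a w) (hsg : ∀ w, set (get w) w = w)
    (q : TM2.Stmt (fun k => Γ (ι k)) Λ' σ') (w : σ) (S : ∀ k, List (Γ k))
    (S' : ∀ k, List (Γ (ι k))) (hS : ∀ k, S (ι k) = S' k) :
    ∃ S₂ : ∀ k, List (Γ k), (∀ k, S₂ (ι k) = (TM2.stepAux q (get w) S').stk k) ∧
      (∀ k, (∀ k', ι k' ≠ k) → S₂ k = S k) ∧
      TM2.stepAux (liftStmt ι get set φ ex q) w S =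
        ⟨some ((TM2.stepAux q (get w) S').l.elim ex φ), set (TM2.stepAux q (get w) S').var w, S₂⟩ := by
  have upd : ∀ (S : ∀ k, List (Γ k)) (S' : ∀ k, List (Γ (ι k))) (_ : ∀ k, S (ι k) = S' k) (k₀ : K')
      (x : List (Γ (ι k₀))) (k : K'), update S (ι k₀) x (ι k) = update S' k₀ x k := by
    intro S S' hS k₀ x k
    by_cases h : k = k₀
    · subst h; simp
    · rw [update_of_ne (hι.ne h), update_of_ne h, hS]
  induction q generalizing w S S' with
  | push k₀ f q ih =>
    obtain ⟨S₂, h1, h2, h3⟩ := ih w (update S (ι k₀) (f (get w) :: S (ι k₀)))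
      (update S' k₀ (f (get w) :: S' k₀)) (by rw [hS k₀]; exact upd S S' hS k₀ _)
    refine ⟨S₂, h1, fun k hk => ?_, h3⟩
    rw [h2 k hk, update_of_ne (hk k₀).symm]
  | peek k₀ f q ih =>
    obtain ⟨S₂, h1, h2, h3⟩ := ih (set (f (get w) (S (ι k₀)).head?) w) S S' hS
    rw [hgs, hS k₀] at h1 h3
    refine ⟨S₂, h1, h2, ?_⟩
    simp only [liftStmt, TM2.stepAux]
    rw [hS k₀, h3, hss]
  | pop k₀ f q ih =>
    obtain ⟨S₂, h1, h2, h3⟩ := ih (set (f (get w) (S (ι k₀)).head?) w)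
      (update S (ι k₀) (S (ι k₀)).tail) (update S' k₀ (S' k₀).tail)
      (by rw [hS k₀]; exact upd S S' hS k₀ _)
    rw [hgs, hS k₀] at h1 h3
    refine ⟨S₂, h1, fun k hk => ?_, ?_⟩
    · rw [h2 k hk, update_of_ne (hk k₀).symm]
    · simp only [liftStmt, TM2.stepAux]
      rw [hS k₀, h3, hss]
  | load f q ih =>
    obtain ⟨S₂, h1, h2, h3⟩ := ih (set (f (get w)) w) S S' hS
    rw [hgs] at h1 h3
    refine ⟨S₂, h1, h2, ?_⟩
    simp only [liftStmt, TM2.stepAux]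
    rw [h3, hss]
  | branch f q₁ q₂ ih₁ ih₂ =>
    simp only [liftStmt, TM2.stepAux]
    cases f (get w)
    · exact ih₂ w S S' hS
    · exact ih₁ w S S' hS
  | goto f => exact ⟨S, hS, fun _ _ => rfl, by simp [liftStmt, hsg]⟩
  | halt => exact ⟨S, hS, fun _ _ => rfl, by simp [liftStmt, hsg]⟩

theorem Exec.lift (hι : Injective ι) (hgs : ∀ a w, get (set a w) = a)
    (hss : ∀ a b w, set a (set b w) = set a w) (hsg : ∀ w, set (get w) w = w)
    {m : Λ → TM2.Stmt Γ Λ σ} {m' : Λ' → TM2.Stmt (fun k => Γ (ι k)) Λ' σ'}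
    (hm : ∀ l, m (φ l) = liftStmt ι get set φ ex (m' l))
    {t : ℕ} {c c' : TM2.Cfg (fun k => Γ (ι k)) Λ' σ'} (h : Exec m' t c c')
    (w : σ) (hw : get w = c.var) (S : ∀ k, List (Γ k)) (hS : ∀ k, S (ι k) = c.stk k) :
    ∃ S₂ : ∀ k, List (Γ k), (∀ k, S₂ (ι k) = c'.stk k) ∧ (∀ k, (∀ k', ι k' ≠ k) → S₂ k = S k) ∧
      Exec m t ⟨some (c.l.elim ex φ), w, S⟩ ⟨some (c'.l.elim ex φ), set c'.var w, S₂⟩ := by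
  induction h generalizing w S with
  | refl t c => exact ⟨S, hS, fun _ _ => rfl, by rw [← hw, hsg]; exact .refl _ _⟩
  | @step t l v S₀ c h ih =>
    simp only at hw hS
    subst hw
    obtain ⟨S₁, h1, h2, h3⟩ := stepAux_liftStmt (φ := φ) (ex := ex) hι hgs hss hsg (m' l) w S S₀ hS
    obtain ⟨S₂, h4, h5, h6⟩ := ih (set (TM2.stepAux (m' l) (get w) S₀).var w) (hgs _ _) S₁ h1
    refine ⟨S₂, h4, fun k hk => (h5 k hk).trans (h2 k hk), .step ?_⟩
    rw [Option.elim, hm, h3]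
    rw [hss] at h6
    exact h6

end Lift

end Stoq

namespace Stoq

open Computability Turing Function

/-! ### Programs that call machines

A program works on stacks indexed by `V`. In a control state it pops a symbol and then pushes a word and
changes the control state, both depending on the symbol, or it calls one of the machines `C i`. A call
takes its argument, in reversed order, from the stack `pin i` and leaves its result, in reversed order,
on the stack `pout i`. -/

section Program

variable {I V : Type} [Fintype I] [DecidableEq I] [Fintype V] [DecidableEq V]
  {alph : V → Type} [∀ v, Fintype (alph v)] {P E : Type} [Fintype P] [Fintype E]

/-- The instructions of a program. -/
inductive Instr (alph : V → Type) (I P E : Type) where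
  | pop (v : V) (act : Option (alph v) → E) : Instr alph I P E
  | call (i : I) (next : P) : Instr alph I P E
  | halt : Instr alph I P E

/-- Push the symbols of a word, the head first, on the stacks they belong to. -/
def pushAll : List (Σ v, alph v) → (∀ v, List (alph v)) → ∀ v, List (alph v)
  | [], U => U
  | x :: w, U => pushAll w (update U x.1 (x.2 :: U x.1))

variable {pin pout : I → V} (C : ∀ i, TM2ComputableAux (alph (pin i)) (alph (pout i)))

/-- A machine maps the string `L` to the string `L'` in at most `t` steps. -/
def Outputs {A B : Type} (c : TM2ComputableAux A B) (L : List A) (L' : List B) (t : ℕ) : Prop :=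
  Exec c.tm.m t ⟨some c.tm.main, c.tm.initialState,
      update (fun _ => []) c.tm.k₀ (L.map c.inputAlphabet.symm)⟩
    ⟨none, c.tm.initialState, update (fun _ => []) c.tm.k₁ (L'.map c.outputAlphabet.symm)⟩

/-- `Runs C instr emit t p U U'`: started in the control state `p` with the stacks `U`, the program halts
with the stacks `U'`, within time `t`. -/
inductive Runs (instr : P → Instr alph I P E) (emit : E → List (Σ v, alph v) × P) :
    ℕ → P → (∀ v, List (alph v)) → (∀ v, List (alph v)) → Prop
  | halt {t : ℕ} {p : P} {U : ∀ v, List (alph v)} (h : instr p = .halt) :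
      Runs instr emit (t + 1) p U U
  | pop {t : ℕ} {p : P} {U U' : ∀ v, List (alph v)} {v : V} {act : Option (alph v) → E}
      (h : instr p = .pop v act)
      (hr : Runs instr emit t (emit (act (U v).head?)).2
        (pushAll (emit (act (U v).head?)).1 (update U v (U v).tail)) U') :
      Runs instr emit (t + 2) p U U'
  | call {t s : ℕ} {p q : P} {U U₁ : ∀ v, List (alph v)} {i : I} (L : List (alph (pin i)))
      (L' : List (alph (pout i))) (h : instr p = .call i q) (hL : U (pin i) = L.reverse)
      (hio : pout i ≠ pin i) (hne : U (pout i) = []) (ho : Outputs (C i) L L' s)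
      (hr : Runs instr emit t q (update (update U (pin i) []) (pout i) L'.reverse) U₁) :
      Runs instr emit (t + s + 2 * L.length + 2 * L'.length + 5) p U U₁

/-- The labels of the machine for a program. -/
inductive Lab (P E : Type) : Type where
  | ctl (p : P) : Lab P E
  | emit (e : E) : Lab P E
  | load (i : I) (q : P) : Lab P E
  | loadPush (i : I) (q : P) (a : alph (pin i)) : Lab P E
  | run (i : I) (q : P) (l : (C i).tm.Λ) : Lab P E
  | store (i : I) (q : P) : Lab P E
  | storePush (i : I) (q : P) (a : alph (pout i)) : Lab P E

instance (i : I) : Fintype (C i).tm.Λ := (C i).tm.ΛFin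

instance (i : I) : Fintype (C i).tm.σ := (C i).tm.σFin

instance (i : I) : Fintype (C i).tm.K := (C i).tm.kFin

noncomputable instance : Fintype (Lab C P E) := by
  classical
  let f : (P ⊕ E) ⊕ (Σ i, P × ((Unit ⊕ alph (pin i)) ⊕ (C i).tm.Λ ⊕ (Unit ⊕ alph (pout i)))) →
      Lab C P E := fun x => match x with
    | .inl (.inl p) => .ctl p
    | .inl (.inr e) => .emit e
    | .inr ⟨i, q, .inl (.inl _)⟩ => .load i q
    | .inr ⟨i, q, .inl (.inr a)⟩ => .loadPush i q a
    | .inr ⟨i, q, .inr (.inl l)⟩ => .run i q l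
    | .inr ⟨i, q, .inr (.inr (.inl _))⟩ => .store i q
    | .inr ⟨i, q, .inr (.inr (.inr a))⟩ => .storePush i q a
  refine Fintype.ofSurjective f ?_
  rintro (p | e | ⟨i, q⟩ | ⟨i, q, a⟩ | ⟨i, q, l⟩ | ⟨i, q⟩ | ⟨i, q, a⟩)
  · exact ⟨.inl (.inl p), rfl⟩
  · exact ⟨.inl (.inr e), rfl⟩
  · exact ⟨.inr ⟨i, q, .inl (.inl ())⟩, rfl⟩
  · exact ⟨.inr ⟨i, q, .inl (.inr a)⟩, rfl⟩
  · exact ⟨.inr ⟨i, q, .inr (.inl l)⟩, rfl⟩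
  · exact ⟨.inr ⟨i, q, .inr (.inr (.inl ()))⟩, rfl⟩
  · exact ⟨.inr ⟨i, q, .inr (.inr (.inr a))⟩, rfl⟩

/-- The stacks of the machine for a program: those of the called machines and those of the program. -/
abbrev Stk : Type := (Σ i, (C i).tm.K) ⊕ V

/-- The alphabets of the machine for a program. -/
abbrev StkAlph : Stk C → Type
  | .inl p => (C p.1).tm.Γ p.2
  | .inr v => alph v

/-- The states of the machine for a program: those of the called machines and a label to jump to. -/
abbrev Mem (P E : Type) : Type := (∀ i, (C i).tm.σ) × Lab C P E

/-- Stacks of the called machines and stacks of the program, joined. -/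
def joinStk (T : ∀ p : Σ i, (C i).tm.K, List ((C p.1).tm.Γ p.2)) (U : ∀ v, List (alph v)) :
    ∀ k, List (StkAlph C k)
  | .inl p => T p
  | .inr v => U v

theorem update_joinStk_inl (T : ∀ p : Σ i, (C i).tm.K, List ((C p.1).tm.Γ p.2))
    (U : ∀ v, List (alph v)) (p : Σ i, (C i).tm.K) (x : List ((C p.1).tm.Γ p.2)) :
    update (joinStk C T U) (.inl p) x = joinStk C (update T p x) U := by
  funext k
  rcases k with k | k
  · by_cases h : k = p
    · subst h; simp [joinStk]
    · rw [update_of_ne (by simpa using h)]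
      simp [joinStk, h]
  · rw [update_of_ne (by simp)]
    rfl

theorem update_joinStk_inr (T : ∀ p : Σ i, (C i).tm.K, List ((C p.1).tm.Γ p.2))
    (U : ∀ v, List (alph v)) (v : V) (x : List (alph v)) :
    update (joinStk C T U) (.inr v) x = joinStk C T (update U v x) := by
  funext k
  rcases k with k | k
  · rw [update_of_ne (by simp)]
    rfl
  · by_cases h : k = v
    · subst h; simp [joinStk]
    · rw [update_of_ne (by simpa using h)]
      simp [joinStk, h]

/-- Push the symbols of a word and continue with the statement `q`. -/
def emitStmt (q : TM2.Stmt (StkAlph C) (Lab C P E) (Mem C P E)) :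
    List (Σ v, alph v) → TM2.Stmt (StkAlph C) (Lab C P E) (Mem C P E)
  | [] => q
  | x :: w => .push (.inr x.1) (fun _ => x.2) (emitStmt q w)

theorem stepAux_emitStmt (q : TM2.Stmt (StkAlph C) (Lab C P E) (Mem C P E))
    (w : List (Σ v, alph v)) (s : Mem C P E) (T : ∀ p : Σ i, (C i).tm.K, List ((C p.1).tm.Γ p.2))
    (U : ∀ v, List (alph v)) :
    TM2.stepAux (emitStmt C q w) s (joinStk C T U) = TM2.stepAux q s (joinStk C T (pushAll w U)) := by
  induction w generalizing U with
  | nil => rfl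
  | cons x w ih =>
    simp only [emitStmt, TM2.stepAux, pushAll]
    rw [update_joinStk_inr]
    exact ih _

variable (instr : P → Instr alph I P E) (emit : E → List (Σ v, alph v) × P) (start : P)

/-- The machine for a program. -/
def compile : Lab C P E → TM2.Stmt (StkAlph C) (Lab C P E) (Mem C P E)
  | .ctl p =>
    match instr p with
    | .pop v act => .pop (.inr v) (fun s o => (s.1, .emit (act o))) (.goto fun s => s.2)
    | .call i q => .goto fun _ => .load i q
    | .halt => .load (fun s => (s.1, .ctl start)) .halt
  | .emit e => emitStmt C (.goto fun _ => .ctl (emit e).2) (emit e).1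
  | .load i q =>
    .pop (.inr (pin i)) (fun s o => (s.1, o.elim (.run i q (C i).tm.main) (.loadPush i q)))
      (.goto fun s => s.2)
  | .loadPush i q a =>
    .push (.inl ⟨i, (C i).tm.k₀⟩) (fun _ => (C i).inputAlphabet.symm a) (.goto fun _ => .load i q)
  | .run i q l =>
    liftStmt (Γ := StkAlph C) (fun k => .inl ⟨i, k⟩) (fun s => s.1 i)
      (fun x s => (update s.1 i x, s.2)) (.run i q) (.store i q) ((C i).tm.m l)
  | .store i q =>
    .pop (.inl ⟨i, (C i).tm.k₁⟩)
      (fun s o => (s.1, o.elim (.ctl q) fun b => .storePush i q ((C i).outputAlphabet b)))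
      (.goto fun s => s.2)
  | .storePush i q b => .push (.inr (pout i)) (fun _ => b) (.goto fun _ => .store i q)

/-- The states of the called machines when they are idle. -/
def idle : ∀ i, (C i).tm.σ := fun i => (C i).tm.initialState

variable {C instr emit}

/-- Transferring symbols from one stack to another reverses them, which is why arguments and results
of calls are kept in reversed order. `L₀` is the part already transferred, needed for the induction.
-/
theorem exec_load {i : I} {q : P} (L L₀ : List (alph (pin i))) (b : Lab C P E)
    (U : ∀ v, List (alph v)) (hL : U (pin i) = L) :
    ∃ b', Exec (compile C instr emit start) (2 * L.length + 1)
      ⟨some (.load i q), (idle C, b), joinStk C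
        (update (fun _ => []) ⟨i, (C i).tm.k₀⟩ (L₀.map (C i).inputAlphabet.symm)) U⟩
      ⟨some (.run i q (C i).tm.main), (idle C, b'), joinStk C
        (update (fun _ => []) ⟨i, (C i).tm.k₀⟩ ((L.reverse ++ L₀).map (C i).inputAlphabet.symm))
        (update U (pin i) [])⟩ := by
  induction L generalizing L₀ b U with
  | nil =>
    refine ⟨.run i q (C i).tm.main, .step ?_⟩
    simp only [compile, TM2.stepAux]
    rw [update_joinStk_inr]
    have : (joinStk C (update (fun _ => []) ⟨i, (C i).tm.k₀⟩
      (L₀.map (C i).inputAlphabet.symm)) U) (.inr (pin i)) = [] := hL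
    rw [this]
    exact .refl _ _
  | cons a L ih =>
    obtain ⟨b', h⟩ := ih (a :: L₀) (.loadPush i q a) (update U (pin i) L) (by simp)
    refine ⟨b', ?_⟩
    have e : 2 * (a :: L).length + 1 = (2 * L.length + 1 + 1) + 1 := by simp; ring
    rw [e]
    refine .step ?_
    simp only [compile, TM2.stepAux]
    rw [update_joinStk_inr]
    have : (joinStk C (update (fun _ => []) ⟨i, (C i).tm.k₀⟩
      (L₀.map (C i).inputAlphabet.symm)) U) (.inr (pin i)) = a :: L := hL
    rw [this]
    simp only [List.head?_cons, Option.elim, List.tail_cons]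
    refine .step ?_
    simp only [compile, TM2.stepAux]
    rw [update_joinStk_inl]
    simpa [joinStk] using h

theorem exec_store {i : I} {q : P} (L L₀ : List (alph (pout i))) (b : Lab C P E)
    (U : ∀ v, List (alph v)) (hL : U (pout i) = L₀) :
    ∃ b', Exec (compile C instr emit start) (2 * L.length + 1)
      ⟨some (.store i q), (idle C, b), joinStk C
        (update (fun _ => []) ⟨i, (C i).tm.k₁⟩ (L.map (C i).outputAlphabet.symm)) U⟩
      ⟨some (.ctl q), (idle C, b'), joinStk C (fun _ => [])
        (update U (pout i) (L.reverse ++ L₀))⟩ := by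
  induction L generalizing L₀ b U with
  | nil =>
    refine ⟨.ctl q, .step ?_⟩
    subst hL
    have h0 : (update (fun _ => []) ⟨i, (C i).tm.k₁⟩ [] :
        ∀ p : Σ i, (C i).tm.K, List ((C p.1).tm.Γ p.2)) = fun _ => [] := update_eq_self_iff.2 rfl
    simp only [compile, TM2.stepAux]
    rw [update_joinStk_inl]
    simp only [List.map_nil, h0, joinStk, List.head?_nil, Option.elim, List.tail_nil,
      List.reverse_nil, List.nil_append, update_eq_self]
    exact .refl _ _
  | cons a L ih =>
    obtain ⟨b', h⟩ := ih (a :: L₀) (.storePush i q a) (update U (pout i) (a :: L₀)) (by simp)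
    refine ⟨b', ?_⟩
    have e : 2 * (a :: L).length + 1 = (2 * L.length + 1 + 1) + 1 := by simp; ring
    rw [e]
    refine .step ?_
    simp only [compile, TM2.stepAux]
    rw [update_joinStk_inl]
    simp only [joinStk, List.map_cons, update_self, List.head?_cons, Option.elim, List.tail_cons,
      update_idem, Equiv.apply_symm_apply]
    refine .step ?_
    simp only [compile, TM2.stepAux]
    rw [update_joinStk_inr]
    have : (joinStk C (update (fun _ => []) ⟨i, (C i).tm.k₁⟩
      (L.map (C i).outputAlphabet.symm)) U) (.inr (pout i)) = L₀ := hL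
    rw [this]
    simpa using h

/-- `Outputs` requires the machine to end in its initial state with all stacks but the output stack
empty. Once the result has been taken away it is idle again, so it can be called any number of
times. -/
theorem exec_run {i : I} {q : P} {L : List (alph (pin i))} {L' : List (alph (pout i))} {t : ℕ}
    (ho : Outputs (C i) L L' t) (b : Lab C P E) (U : ∀ v, List (alph v)) :
    Exec (compile C instr emit start) t
      ⟨some (.run i q (C i).tm.main), (idle C, b), joinStk C
        (update (fun _ => []) ⟨i, (C i).tm.k₀⟩ (L.map (C i).inputAlphabet.symm)) U⟩
      ⟨some (.store i q), (idle C, b), joinStk C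
        (update (fun _ => []) ⟨i, (C i).tm.k₁⟩ (L'.map (C i).outputAlphabet.symm)) U⟩ := by
  have key : ∀ (k₀ : (C i).tm.K) (x : List ((C i).tm.Γ k₀)) (k : (C i).tm.K),
      update (fun _ => [] : ∀ p : Σ i, (C i).tm.K, List ((C p.1).tm.Γ p.2)) ⟨i, k₀⟩ x ⟨i, k⟩ =
        update (fun _ => [] : ∀ k, List ((C i).tm.Γ k)) k₀ x k := by
    intro k₀ x k
    by_cases h : k = k₀
    · subst h; simp
    · rw [update_of_ne h, update_of_ne (by simpa using h)]
  have keyne : ∀ (k₀ : (C i).tm.K) (x : List ((C i).tm.Γ k₀)) (j : I) (k : (C j).tm.K), j ≠ i →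
      update (fun _ => [] : ∀ p : Σ i, (C i).tm.K, List ((C p.1).tm.Γ p.2)) ⟨i, k₀⟩ x ⟨j, k⟩ =
        [] := by
    intro k₀ x j k h
    rw [update_of_ne]
    intro h'
    exact h (congrArg Sigma.fst h')
  obtain ⟨S₂, h1, h2, h3⟩ := Exec.lift (Γ := StkAlph C) (ι := fun k => .inl ⟨i, k⟩)
    (get := fun s : Mem C P E => s.1 i) (set := fun x s => (update s.1 i x, s.2))
    (φ := .run i q) (ex := .store i q) (m := compile C instr emit start) (m' := (C i).tm.m)
    (fun k k' h => by simpa using h) (by simp) (by simp) (by simp) (fun l => rfl) ho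
    (idle C, b) rfl (joinStk C
        (update (fun _ => []) ⟨i, (C i).tm.k₀⟩ (L.map (C i).inputAlphabet.symm)) U)
    (fun k => key _ _ k)
  have hS : S₂ = joinStk C
      (update (fun _ => []) ⟨i, (C i).tm.k₁⟩ (L'.map (C i).outputAlphabet.symm)) U := by
    funext k
    rcases k with ⟨j, k⟩ | v
    · by_cases hj : j = i
      · subst hj
        rw [h1]
        exact (key _ _ k).symm
      · rw [h2 _ (fun k' hk => hj (by simpa using (congrArg Sigma.fst (Sum.inl.inj hk)).symm))]
        exact (keyne _ _ j k hj).trans (keyne _ _ j k hj).symm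
    · rw [h2 _ (fun k' hk => by cases hk)]
      rfl
  subst hS
  have e : update (idle C) i (C i).tm.initialState = idle C := update_eq_self i (idle C)
  simp only [e] at h3
  exact h3

/-- The costs in `Runs` cover those of the compiled machine: one step to halt, two to pop and push,
and for a call two steps per symbol of argument and result besides the call itself and a constant.
On halting, the jump label is reset to `start`, so that the compiled machine too ends in its initial
state. -/
theorem Runs.exec {t : ℕ} {p : P} {U U' : ∀ v, List (alph v)} (h : Runs C instr emit t p U U')
    (b : Lab C P E) :
    Exec (compile C instr emit start) t ⟨some (.ctl p), (idle C, b), joinStk C (fun _ => []) U⟩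
      ⟨none, (idle C, .ctl start), joinStk C (fun _ => []) U'⟩ := by
  induction h generalizing b with
  | halt h =>
    refine .step ?_
    simp only [compile, h, TM2.stepAux]
    exact .refl _ _
  | @pop t p U U' v act h hr ih =>
    refine .step ?_
    simp only [compile, h, TM2.stepAux]
    rw [update_joinStk_inr]
    refine .step ?_
    simp only [compile]
    rw [stepAux_emitStmt]
    exact ih _
  | @call t s p q U U' i L L' h hL hio hne ho hr ih =>
    obtain ⟨b₁, h1⟩ := exec_load (C := C) (instr := instr) (emit := emit) start (q := q) L.reverse []
      b U hL
    have h2 := exec_run (instr := instr) (emit := emit) start (q := q) ho b₁ (update U (pin i) [])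
    obtain ⟨b₃, h3⟩ := exec_store (C := C) (instr := instr) (emit := emit) start (q := q) L' []
      b₁ (update U (pin i) []) (by rw [update_of_ne hio, hne])
    rw [List.reverse_reverse, List.append_nil] at h1
    rw [List.append_nil] at h3
    have h0 : (update (fun _ => []) ⟨i, (C i).tm.k₀⟩ (([] : List (alph (pin i))).map
        (C i).inputAlphabet.symm) : ∀ p : Σ i, (C i).tm.K, List ((C p.1).tm.Γ p.2)) = fun _ => [] :=
      update_eq_self_iff.2 rfl
    rw [h0] at h1
    have h4 : Exec (compile C instr emit start) 1
        ⟨some (.ctl p), (idle C, b), joinStk C (fun _ => []) U⟩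
        ⟨some (.load i q), (idle C, b), joinStk C (fun _ => []) U⟩ := by
      refine .step ?_
      simp only [compile, h, TM2.stepAux]
      exact .refl _ _
    refine (h4.trans (h1.trans (h2.trans (h3.trans (ih b₃))))).mono ?_
    simp
    omega

end Program

end Stoq

namespace Stoq

open Computability Turing Function

/-! ### Polynomial time in terms of bounded executions -/

theorem initList_eq (tm : FinTM2) (s : List (tm.Γ tm.k₀)) :
    initList tm s = ⟨some tm.main, tm.initialState, update (fun _ => []) tm.k₀ s⟩ := by
  unfold initList
  congr 1
  funext k
  by_cases h : k = tm.k₀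
  · subst h; simp
  · simp [h]

theorem haltList_eq (tm : FinTM2) (s : List (tm.Γ tm.k₁)) :
    haltList tm s = ⟨none, tm.initialState, update (fun _ => []) tm.k₁ s⟩ := by
  unfold haltList
  congr 1
  funext k
  by_cases h : k = tm.k₁
  · subst h; simp
  · simp [h]

section

variable {α β γ Γ₁ Γ₂ Γ₃ : Type} {ea : α → List Γ₁} {eb : β → List Γ₂} {ec : γ → List Γ₃}

theorem polyTime_iff {f : α → β} : PolyTime ea eb f ↔
    ∃ (c : TM2ComputableAux Γ₁ Γ₂) (p : Polynomial ℕ),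
      ∀ a, Outputs c (ea a) (eb (f a)) (p.eval (ea a).length) := by
  constructor
  · rintro ⟨h⟩
    refine ⟨h.toTM2ComputableAux, h.time, fun a => ?_⟩
    obtain ⟨⟨n, h1⟩, hn⟩ := h.outputsFun a
    rw [initList_eq, Option.map_some, haltList_eq] at h1
    exact Exec.of_iterate hn h1
  · rintro ⟨c, p, h⟩
    choose n hn e using fun a => (h a).exists_iterate
    exact ⟨⟨c, p, fun a => ⟨⟨n a, by
      rw [initList_eq, Option.map_some, haltList_eq]; exact e a⟩, hn a⟩⟩⟩

theorem Outputs.exists_length_le (c : TM2ComputableAux Γ₁ Γ₂) :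
    ∃ b, ∀ L L' t, Outputs c L L' t → L'.length ≤ L.length + b * t := by
  let := c.tm.ΛFin
  -- There are finitely many labels, so the sum of the push counts bounds each of them.
  refine ⟨∑ l, pushCount (c.tm.m l), fun L L' t h => ?_⟩
  have h1 := Exec.length_le (fun l => Finset.single_le_sum (f := fun l => pushCount (c.tm.m l))
    (fun _ _ => Nat.zero_le _) (Finset.mem_univ l)) h c.tm.k₁
  simp only [update_self, List.length_map] at h1
  refine h1.trans (Nat.add_le_add_right ?_ _)
  have : ∀ k, (update (fun _ => [] : ∀ k, List (c.tm.Γ k)) c.tm.k₀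
      (L.map c.inputAlphabet.symm) k).length ≤ L.length := by
    intro k
    by_cases h : k = c.tm.k₀
    · subst h; simp
    · simp [h]
  exact this _

theorem PolyTime.exists_length_le {f : α → β} (h : PolyTime ea eb f) :
    ∃ q : Polynomial ℕ, ∀ a, (eb (f a)).length ≤ q.eval (ea a).length := by
  obtain ⟨c, p, h⟩ := polyTime_iff.1 h
  obtain ⟨b, hb⟩ := Outputs.exists_length_le c
  refine ⟨Polynomial.X + Polynomial.C b * p, fun a => ?_⟩
  simpa using hb _ _ _ (h a)

theorem eval_mono (p : Polynomial ℕ) {m n : ℕ} (h : m ≤ n) : p.eval m ≤ p.eval n := by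
  induction p using Polynomial.induction_on' with
  | add p q hp hq => simpa using Nat.add_le_add hp hq
  | monomial k a => simpa using Nat.mul_le_mul_left a (Nat.pow_le_pow_left h k)

end

/-! ### Polynomial time from programs, and rules for assembling runs -/

section OfRuns

variable {I V : Type} [Fintype I] [DecidableEq I] [Fintype V] [DecidableEq V]
  {alph : V → Type} [∀ v, Fintype (alph v)] {P E : Type} [Fintype P] [Fintype E]
  {pin pout : I → V} {C : ∀ i, TM2ComputableAux (alph (pin i)) (alph (pout i))}
  {instr : P → Instr alph I P E} {emit : E → List (Σ v, alph v) × P}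

theorem PolyTime.of_runs {start : P} {vin vout : V} {α β : Type} {ea : α → List (alph vin)}
    {eb : β → List (alph vout)} {f : α → β} (p : Polynomial ℕ)
    (h : ∀ a, ∃ t ≤ p.eval (ea a).length, Runs C instr emit t start
      (update (fun _ => []) vin (ea a)) (update (fun _ => []) vout (eb (f a)))) :
    PolyTime ea eb f := by
  classical
  refine polyTime_iff.2 ⟨{
    tm := {
      K := Stk C
      k₀ := .inr vin
      k₁ := .inr vout
      Γ := StkAlph C
      Λ := Lab C P E
      main := .ctl start
      σ := Mem C P E
      initialState := (idle C, .ctl start)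
      Γk₀Fin := (inferInstance : Fintype (alph vin))
      m := compile C instr emit start }
    inputAlphabet := Equiv.refl _
    outputAlphabet := Equiv.refl _ }, p, fun a => ?_⟩
  obtain ⟨t, ht, hr⟩ := h a
  have h1 := (hr.exec start (.ctl start)).mono ht
  rw [← update_joinStk_inr, ← update_joinStk_inr] at h1
  have e : joinStk C (fun _ => []) (fun _ => []) = fun _ => [] := by
    funext k
    rcases k with k | k <;> rfl
  rw [e] at h1
  unfold Outputs
  simpa using h1

theorem pushAll_append (w w' : List (Σ v, alph v)) (U : ∀ v, List (alph v)) :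
    pushAll (w ++ w') U = pushAll w' (pushAll w U) := by
  induction w generalizing U with
  | nil => rfl
  | cons x w ih => exact ih _

theorem pushAll_of_ne {w : List (Σ v, alph v)} {v : V} (h : ∀ x ∈ w, x.1 ≠ v)
    (U : ∀ v, List (alph v)) : pushAll w U v = U v := by
  induction w generalizing U with
  | nil => rfl
  | cons x w ih =>
    rw [pushAll, ih (fun y hy => h y (List.mem_cons_of_mem _ hy)),
      update_of_ne (h x List.mem_cons_self).symm]

theorem pushAll_update_of_ne {w : List (Σ v, alph v)} {v : V} (h : ∀ x ∈ w, x.1 ≠ v)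
    (U : ∀ v, List (alph v)) (y : List (alph v)) :
    pushAll w (update U v y) = update (pushAll w U) v y := by
  induction w generalizing U with
  | nil => rfl
  | cons x w ih =>
    have hx := h x List.mem_cons_self
    rw [pushAll, pushAll, ← ih (fun y hy => h y (List.mem_cons_of_mem _ hy)), update_of_ne hx,
      update_comm hx]

theorem pushAll_map {X : Type} (v : V) (g : X → alph v) (L : List X) (U : ∀ v, List (alph v)) :
    pushAll (L.map fun a => ⟨v, g a⟩) U = update U v ((L.map g).reverse ++ U v) := by
  induction L generalizing U with
  | nil => simp [pushAll]
  | cons a L ih =>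
    rw [List.map_cons, pushAll, ih]
    simp

theorem Runs.mono {t t' : ℕ} {p : P} {U U' : ∀ v, List (alph v)} (h : Runs C instr emit t p U U')
    (ht : t ≤ t') : Runs C instr emit t' p U U' := by
  induction h generalizing t' with
  | halt h =>
    obtain ⟨s, rfl⟩ := Nat.exists_eq_add_of_le' (Nat.one_le_of_lt ht)
    exact .halt h
  | pop h hr ih =>
    obtain ⟨s, rfl⟩ := Nat.exists_eq_add_of_le' ((Nat.le_add_left 2 _).trans ht)
    exact .pop h (ih (by omega))
  | @call t s p q U U' i L L' h hL hio hne ho hr ih =>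
    obtain ⟨r, rfl⟩ := Nat.exists_eq_add_of_le ht
    have e : t + s + 2 * L.length + 2 * L'.length + 5 + r =
      (t + r) + s + 2 * L.length + 2 * L'.length + 5 := by ring
    rw [e]
    exact .call L L' h hL hio hne ho (ih (by omega))

theorem Runs.halted {T : ℕ} {p : P} {U U' : ∀ v, List (alph v)} (h : instr p = .halt) (hU : U = U')
    (hT : 1 ≤ T) : Runs C instr emit T p U U' :=
  hU ▸ (Runs.halt (t := 0) h).mono hT

/-- Time is a budget `T` from which each rule subtracts its cost, so that runs are assembled rule by
rule and only linear inequalities remain. By `hW` nothing is pushed back on the scanned stack, so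
the scan ends after one visit to each symbol. -/
theorem Runs.scan {T : ℕ} {p p' : P} {v : V} {act : Option (alph v) → E}
    {W : alph v → List (Σ v, alph v)} {U U' : ∀ v, List (alph v)} (L : List (alph v))
    (h : instr p = .pop v act) (h₀ : emit (act none) = ([], p'))
    (h₁ : ∀ a, emit (act (some a)) = (W a, p)) (hW : ∀ a, ∀ x ∈ W a, x.1 ≠ v) (hL : U v = L)
    (hT : 2 * L.length + 2 ≤ T)
    (hr : Runs C instr emit (T - (2 * L.length + 2)) p' (pushAll (L.flatMap W) (update U v [])) U') :
    Runs C instr emit T p U U' := by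
  obtain ⟨t, rfl⟩ := Nat.exists_eq_add_of_le' hT
  rw [Nat.add_sub_cancel] at hr
  clear hT
  induction L generalizing U with
  | nil =>
    refine .pop h ?_
    rw [hL, List.head?_nil, h₀]
    simpa [pushAll] using hr
  | cons a L ih =>
    have e : t + (2 * (a :: L).length + 2) = (t + (2 * L.length + 2)) + 2 := by simp; ring
    rw [e]
    refine .pop h ?_
    rw [hL, List.head?_cons, h₁]
    simp only [List.tail_cons]
    refine ih ?_ ?_
    · rw [pushAll_of_ne (hW a)]
      simp
    · rw [List.flatMap_cons, pushAll_append] at hr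
      rw [← pushAll_update_of_ne (hW a)]
      simpa using hr

/-- Each move reverses the order; the number of moves in the programs below is chosen to give the
right parity. -/
theorem Runs.move {T : ℕ} {p p' : P} (v v' : V) (hv : v' ≠ v) {act : Option (alph v) → E}
    (g : alph v → alph v') {U U' : ∀ v, List (alph v)} (L : List (alph v))
    (h : instr p = .pop v act) (h₀ : emit (act none) = ([], p'))
    (h₁ : ∀ a, emit (act (some a)) = ([⟨v', g a⟩], p)) (hL : U v = L)
    (hT : 2 * L.length + 2 ≤ T)
    (hr : Runs C instr emit (T - (2 * L.length + 2)) p'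
      (update (update U v []) v' ((L.map g).reverse ++ U v')) U') :
    Runs C instr emit T p U U' := by
  refine Runs.scan L h h₀ h₁ (fun a => by simpa using hv) hL hT ?_
  rw [← List.map_eq_flatMap, pushAll_map, update_of_ne hv]
  exact hr

theorem Runs.invoke {T s : ℕ} {p q : P} {U U' : ∀ v, List (alph v)} (i : I)
    (L : List (alph (pin i))) (L' : List (alph (pout i))) (h : instr p = .call i q)
    (hio : pout i ≠ pin i) (ho : Outputs (C i) L L' s) (hL : U (pin i) = L.reverse)
    (hne : U (pout i) = []) (hT : s + 2 * L.length + 2 * L'.length + 5 ≤ T)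
    (hr : Runs C instr emit (T - (s + 2 * L.length + 2 * L'.length + 5)) q
      (update (update U (pin i) []) (pout i) L'.reverse) U') :
    Runs C instr emit T p U U' := by
  obtain ⟨t, rfl⟩ := Nat.exists_eq_add_of_le' hT
  rw [Nat.add_sub_cancel] at hr
  exact (Runs.call L L' h hL hio hne ho hr).mono (by omega)

end OfRuns

end Stoq

namespace Stoq

open Computability Turing Function

/-! ### Finite-state transducers -/

section Transducer

variable {Γ₁ Γ₂ Q : Type}

/-- The output of a finite-state transducer. -/
def transduce (δ : Q → Γ₁ → Q) (w : Q → Γ₁ → List Γ₂) (fin : Q → List Γ₂) : Q → List Γ₁ → List Γ₂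
  | q, [] => fin q
  | q, a :: l => w q a ++ transduce δ w fin (δ q a) l

/-- The stacks of the program of a transducer. -/
inductive TransStk
  | inp | tmp | res
  deriving DecidableEq

instance : Fintype TransStk :=
  ⟨{.inp, .tmp, .res}, fun x => by cases x <;> simp⟩

/-- The alphabets of the program of a transducer. -/
abbrev TransStk.alph (Γ₁ Γ₂ : Type) : TransStk → Type
  | .inp => Γ₁
  | .tmp => Γ₂
  | .res => Γ₂

instance [Fintype Γ₁] [Fintype Γ₂] : ∀ v, Fintype (TransStk.alph Γ₁ Γ₂ v)
  | .inp => (inferInstance : Fintype Γ₁)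
  | .tmp => (inferInstance : Fintype Γ₂)
  | .res => (inferInstance : Fintype Γ₂)

/-- The instructions of the program of a transducer; the control states are those of the transducer,
`none` for the final reversal and `some none` for the end. -/
def transInstr (Γ₁ Γ₂ Q : Type) : Option (Option Q) →
    Instr (TransStk.alph Γ₁ Γ₂) Empty (Option (Option Q)) ((Q × Option Γ₁) ⊕ Option Γ₂)
  | some (some q) => .pop .inp fun o => .inl (q, o)
  | none => .pop .tmp fun o => .inr o
  | some none => .halt

/-- The actions of the program of a transducer. -/
def transEmit (δ : Q → Γ₁ → Q) (w : Q → Γ₁ → List Γ₂) (fin : Q → List Γ₂) :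
    (Q × Option Γ₁) ⊕ Option Γ₂ → List (Σ v, TransStk.alph Γ₁ Γ₂ v) × Option (Option Q)
  | .inl (q, none) => ((fin q).map fun b => ⟨.tmp, b⟩, none)
  | .inl (q, some a) => ((w q a).map fun b => ⟨.tmp, b⟩, some (some (δ q a)))
  | .inr none => ([], some none)
  | .inr (some b) => ([⟨.res, b⟩], none)

/-- The output collects on `tmp` in reversed order and a last pass to `res` puts it right. Finitely
many states and symbols bound the length of a single word by some `b`, so output and time are linear
in the input. -/
theorem PolyTime.transduce [Fintype Γ₁] [Fintype Γ₂] [Finite Q] {α β : Type} {ea : α → List Γ₁}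
    {eb : β → List Γ₂} {f : α → β} (δ : Q → Γ₁ → Q) (w : Q → Γ₁ → List Γ₂) (fin : Q → List Γ₂)
    (q₀ : Q) (h : ∀ a, eb (f a) = transduce δ w fin q₀ (ea a)) : PolyTime ea eb f := by
  let := Fintype.ofFinite Q
  let C : ∀ i : Empty, TM2ComputableAux (TransStk.alph Γ₁ Γ₂ (i.elim : TransStk))
    (TransStk.alph Γ₁ Γ₂ (i.elim : TransStk)) := fun i => i.elim
  let instr := transInstr Γ₁ Γ₂ Q
  let emit := transEmit δ w fin
  obtain ⟨b, hb⟩ : ∃ b, (∀ q a, (w q a).length ≤ b) ∧ ∀ q, (fin q).length ≤ b := by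
    refine ⟨∑ q, (∑ a, (w q a).length + (fin q).length), fun q a => ?_, fun q => ?_⟩
    · refine le_trans ?_ (Finset.single_le_sum
        (f := fun q => ∑ a, (w q a).length + (fin q).length) (fun _ _ => Nat.zero_le _)
        (Finset.mem_univ q))
      exact (Finset.single_le_sum (f := fun a => (w q a).length) (fun _ _ => Nat.zero_le _)
        (Finset.mem_univ a)).trans (Nat.le_add_right _ _)
    · refine le_trans (Nat.le_add_left _ _) (Finset.single_le_sum
        (f := fun q => ∑ a, (w q a).length + (fin q).length) (fun _ _ => Nat.zero_le _)
        (Finset.mem_univ q))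
  have hlen : ∀ (L : List Γ₁) (q : Q), (Stoq.transduce δ w fin q L).length ≤ b * (L.length + 1) := by
    intro L
    induction L with
    | nil => intro q; simpa [Stoq.transduce] using hb.2 q
    | cons a L ih =>
      intro q
      have h1 := ih (δ q a)
      have h2 := hb.1 q a
      simp only [Stoq.transduce, List.length_append, List.length_cons]
      nlinarith
  have last : ∀ U : ∀ v, List (TransStk.alph Γ₁ Γ₂ v), U .inp = [] → U .res = [] →
      Runs C instr emit (1 + 2 * (U .tmp).length + 2) none U
        (update (fun _ => []) .res (U .tmp).reverse) := by
    intro U h1 h2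
    refine Runs.move TransStk.tmp TransStk.res (by simp) (fun a => a) (U .tmp) rfl rfl
      (fun a => rfl) rfl (by omega) ?_
    refine Runs.halted rfl ?_ (by omega)
    funext v
    cases v <;> simp [h1, h2]
  have scan : ∀ (L : List Γ₁) (q : Q) (U : ∀ v, List (TransStk.alph Γ₁ Γ₂ v)), U .inp = L →
      U .res = [] → Runs C instr emit
        (1 + 2 * ((U .tmp).length + (Stoq.transduce δ w fin q L).length) + 2 + 2 * L.length + 2)
        (some (some q)) U
        (update (fun _ => []) .res ((U .tmp).reverse ++ Stoq.transduce δ w fin q L)) := by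
    intro L
    induction L with
    | nil =>
      intro q U h1 h2
      refine .pop rfl ?_
      rw [h1]
      simp only [List.head?_nil, emit, transEmit, List.tail_nil]
      rw [pushAll_map]
      have := last (update (update U .inp []) .tmp
        (((fin q).map fun b => b).reverse ++ update U .inp [] .tmp)) (by simp) (by simp [h2])
      simp only [List.map_id', update_self, ne_eq, reduceCtorEq, not_false_eq_true, update_of_ne,
        List.length_append, List.length_reverse, List.reverse_append, List.reverse_reverse] at this
      simp only [List.map_id', ne_eq, reduceCtorEq, not_false_eq_true, update_of_ne, Stoq.transduce]
      rw [Nat.add_comm (fin q).length] at this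
      exact this
    | cons a L ih =>
      intro q U h1 h2
      have e : 1 + 2 * ((U .tmp).length + (Stoq.transduce δ w fin q (a :: L)).length) + 2 +
          2 * (a :: L).length + 2 = (1 + 2 * (((w q a).reverse ++ U .tmp).length +
            (Stoq.transduce δ w fin (δ q a) L).length) + 2 + 2 * L.length + 2) + 2 := by
        simp [Stoq.transduce]; ring
      rw [e]
      refine .pop rfl ?_
      rw [h1]
      simp only [List.head?_cons, emit, transEmit, List.tail_cons]
      rw [pushAll_map]
      have := ih (δ q a) (update (update U .inp L) .tmp
        (((w q a).map fun b => b).reverse ++ update U .inp L .tmp)) (by simp) (by simp [h2])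
      simp only [List.map_id', update_self, ne_eq, reduceCtorEq, not_false_eq_true, update_of_ne,
        List.reverse_append, List.reverse_reverse, List.append_assoc] at this
      simpa [Stoq.transduce] using this
  refine PolyTime.of_runs (C := C) (instr := instr) (emit := emit) (start := some (some q₀))
    (vin := .inp) (vout := .res)
    (1 + 2 * (Polynomial.C b * (Polynomial.X + 1)) + 2 + 2 * Polynomial.X + 2) fun a => ?_
  refine ⟨_, ?_, by
    have := scan (ea a) q₀ (update (fun _ => []) .inp (ea a)) (by simp) (by simp)
    simp only [ne_eq, reduceCtorEq, not_false_eq_true, update_of_ne, List.reverse_nil,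
      List.nil_append, List.length_nil, Nat.zero_add, ← h a] at this
    exact this⟩
  have := hlen (ea a) q₀
  rw [h a]
  simp only [Polynomial.eval_add, Polynomial.eval_mul, Polynomial.eval_C, Polynomial.eval_X,
    Polynomial.eval_one, Polynomial.eval_ofNat]
  omega

end Transducer

/-! ### Closure properties of polynomial time -/

/-- An action of a program: push at most two symbols and go to a control state. -/
abbrev Act {V : Type} (alph : V → Type) (P : Type) : Type :=
  P × Option (Σ v, alph v) × Option (Σ v, alph v)

/-- The word and the control state of an action. -/
def Act.emit {V : Type} {alph : V → Type} {P : Type} (e : Act alph P) : List (Σ v, alph v) × P :=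
  (e.2.1.toList ++ e.2.2.toList, e.1)

/-! ### Composition -/

section Comp

/-- The stacks of the program for a composition. -/
inductive CompStk
  | inp | in₁ | out₁ | mid | in₂ | out₂ | res
  deriving DecidableEq

instance : Fintype CompStk :=
  ⟨{.inp, .in₁, .out₁, .mid, .in₂, .out₂, .res}, fun x => by cases x <;> simp⟩

/-- The control states of the program for a composition. -/
inductive CompCtl
  | load | call₁ | store | move | call₂ | finish | halted
  deriving DecidableEq

instance : Fintype CompCtl :=
  ⟨{.load, .call₁, .store, .move, .call₂, .finish, .halted}, fun x => by cases x <;> simp⟩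

variable {α β γ Γ₁ Γ₂ Γ₃ : Type} {ea : α → List Γ₁} {eb : β → List Γ₂} {ec : γ → List Γ₃}

/-- The alphabets of the program for a composition. -/
abbrev CompStk.alph (Γ₁ Γ₂ Γ₃ : Type) : CompStk → Type
  | .inp => Γ₁
  | .in₁ => Γ₁
  | .out₁ => Γ₂
  | .mid => Γ₂
  | .in₂ => Γ₂
  | .out₂ => Γ₃
  | .res => Γ₃

instance [Fintype Γ₁] [Fintype Γ₂] [Fintype Γ₃] : ∀ v, Fintype (CompStk.alph Γ₁ Γ₂ Γ₃ v)
  | .inp => (inferInstance : Fintype Γ₁)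
  | .in₁ => (inferInstance : Fintype Γ₁)
  | .out₁ => (inferInstance : Fintype Γ₂)
  | .mid => (inferInstance : Fintype Γ₂)
  | .in₂ => (inferInstance : Fintype Γ₂)
  | .out₂ => (inferInstance : Fintype Γ₃)
  | .res => (inferInstance : Fintype Γ₃)

/-- The instructions of the program for a composition. -/
def compInstr (Γ₁ Γ₂ Γ₃ : Type) : CompCtl →
    Instr (CompStk.alph Γ₁ Γ₂ Γ₃) Bool CompCtl (Act (CompStk.alph Γ₁ Γ₂ Γ₃) CompCtl)
  | .load => .pop .inp fun o => o.elim (.call₁, none, none) fun a => (.load, some ⟨.in₁, a⟩, none)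
  | .call₁ => .call false .store
  | .store => .pop .out₁ fun o => o.elim (.move, none, none) fun a => (.store, some ⟨.mid, a⟩, none)
  | .move => .pop .mid fun o => o.elim (.call₂, none, none) fun a => (.move, some ⟨.in₂, a⟩, none)
  | .call₂ => .call true .finish
  | .finish =>
    .pop .out₂ fun o => o.elim (.halted, none, none) fun a => (.finish, some ⟨.res, a⟩, none)
  | .halted => .halt

/-- The first result lies reversed on `out₁` and has to lie reversed on `in₂`; hence two moves,
through `mid`. The second machine's time is polynomial in the length of that result, which
`PolyTime.exists_length_le` bounds. -/
theorem PolyTime.comp [Fintype Γ₁] [Fintype Γ₂] [Fintype Γ₃] {g : β → γ} {f : α → β}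
    (hg : PolyTime eb ec g) (hf : PolyTime ea eb f) : PolyTime ea ec fun a => g (f a) := by
  obtain ⟨pf, hpf⟩ := hf.exists_length_le
  obtain ⟨pg, hpg⟩ := hg.exists_length_le
  obtain ⟨c₁, q₁, h₁⟩ := polyTime_iff.1 hf
  obtain ⟨c₂, q₂, h₂⟩ := polyTime_iff.1 hg
  let pin : Bool → CompStk := fun i => cond i .in₂ .in₁
  let pout : Bool → CompStk := fun i => cond i .out₂ .out₁
  let C : ∀ i, TM2ComputableAux (CompStk.alph Γ₁ Γ₂ Γ₃ (pin i)) (CompStk.alph Γ₁ Γ₂ Γ₃ (pout i)) :=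
    fun i => match i with
      | false => c₁
      | true => c₂
  refine PolyTime.of_runs (C := C) (instr := compInstr Γ₁ Γ₂ Γ₃) (emit := Act.emit)
    (start := .load) (vin := .inp) (vout := .res)
    (q₁ + q₂.comp pf + 4 * Polynomial.X + 8 * pf + 4 * pg.comp pf + 30) fun a => ?_
  have lf := hpf a
  have lg := (hpg (f a)).trans (eval_mono pg lf)
  have lt := eval_mono q₂ lf
  refine ⟨q₁.eval (ea a).length + q₂.eval (eb (f a)).length + 4 * (ea a).length +
    8 * (eb (f a)).length + 4 * (ec (g (f a))).length + 19, ?_, ?_⟩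
  · simp only [Polynomial.eval_add, Polynomial.eval_mul, Polynomial.eval_X, Polynomial.eval_comp,
      Polynomial.eval_ofNat]
    omega
  refine Runs.move CompStk.inp CompStk.in₁ (by simp) (fun a => a) (ea a) rfl rfl (fun a => rfl)
    (by simp) (by omega) ?_
  refine Runs.invoke false (ea a) (eb (f a)) rfl (by simp [pin, pout]) (h₁ a) (by simp [pin])
    (by simp [pout]) (by omega) ?_
  refine Runs.move CompStk.out₁ CompStk.mid (by simp) (fun a => a) (eb (f a)).reverse rfl rfl
    (fun a => rfl) (by simp [pin, pout]) (by simp; omega) ?_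
  refine Runs.move CompStk.mid CompStk.in₂ (by simp) (fun a => a) (eb (f a)) rfl rfl
    (fun a => rfl) (by simp [pin, pout]) (by simp; omega) ?_
  refine Runs.invoke true (eb (f a)) (ec (g (f a))) rfl (by simp [pin, pout]) (h₂ (f a))
    (by simp [pin, pout]) (by simp [pin, pout]) (by simp; omega) ?_
  refine Runs.move CompStk.out₂ CompStk.res (by simp) (fun a => a) (ec (g (f a))).reverse rfl rfl
    (fun a => rfl) (by simp [pin, pout]) (by simp; omega) ?_
  refine Runs.halted rfl ?_ (by simp; omega)
  funext v
  cases v <;> simp [pin, pout]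

end Comp

end Stoq

namespace Stoq

open Computability Turing Function

/-- The code of a pair, over the sum of the two alphabets. -/
def prodEnc {α β Γ₁ Γ₂ : Type} (ea : α → List Γ₁) (eb : β → List Γ₂) (x : α × β) :
    List (Γ₁ ⊕ Γ₂) :=
  (ea x.1).map .inl ++ (eb x.2).map .inr

/-! ### Pairing -/

section Pair

/-- The stacks of the program for a pair of functions. -/
inductive PairStk
  | inp | in₁ | in₂ | out₁ | out₂ | res
  deriving DecidableEq

instance : Fintype PairStk :=
  ⟨{.inp, .in₁, .in₂, .out₁, .out₂, .res}, fun x => by cases x <;> simp⟩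

/-- The control states of the program for a pair of functions. -/
inductive PairCtl
  | load | call₁ | call₂ | store₂ | store₁ | halted
  deriving DecidableEq

instance : Fintype PairCtl :=
  ⟨{.load, .call₁, .call₂, .store₂, .store₁, .halted}, fun x => by cases x <;> simp⟩

variable {α β γ Γ₁ Γ₂ Γ₃ : Type} {ea : α → List Γ₁} {eb : β → List Γ₂} {ec : γ → List Γ₃}

/-- The alphabets of the program for a pair of functions. -/
abbrev PairStk.alph (Γ₁ Γ₂ Γ₃ : Type) : PairStk → Type
  | .inp => Γ₁
  | .in₁ => Γ₁
  | .in₂ => Γ₁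
  | .out₁ => Γ₂
  | .out₂ => Γ₃
  | .res => Γ₂ ⊕ Γ₃

instance [Fintype Γ₁] [Fintype Γ₂] [Fintype Γ₃] : ∀ v, Fintype (PairStk.alph Γ₁ Γ₂ Γ₃ v)
  | .inp => (inferInstance : Fintype Γ₁)
  | .in₁ => (inferInstance : Fintype Γ₁)
  | .in₂ => (inferInstance : Fintype Γ₁)
  | .out₁ => (inferInstance : Fintype Γ₂)
  | .out₂ => (inferInstance : Fintype Γ₃)
  | .res => (inferInstance : Fintype (Γ₂ ⊕ Γ₃))

/-- The instructions of the program for a pair of functions. -/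
def pairInstr (Γ₁ Γ₂ Γ₃ : Type) : PairCtl →
    Instr (PairStk.alph Γ₁ Γ₂ Γ₃) Bool PairCtl (Act (PairStk.alph Γ₁ Γ₂ Γ₃) PairCtl)
  | .load =>
    .pop .inp fun o => o.elim (.call₁, none, none) fun a => (.load, some ⟨.in₁, a⟩, some ⟨.in₂, a⟩)
  | .call₁ => .call false .call₂
  | .call₂ => .call true .store₂
  | .store₂ =>
    .pop .out₂ fun o => o.elim (.store₁, none, none) fun a => (.store₂, some ⟨.res, .inr a⟩, none)
  | .store₁ =>
    .pop .out₁ fun o => o.elim (.halted, none, none) fun a => (.store₁, some ⟨.res, .inl a⟩, none)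
  | .halted => .halt

theorem pushAll_flatMap_pair {V X : Type} [DecidableEq V] {alph : V → Type} {v v' : V} (h : v ≠ v')
    (g : X → alph v) (g' : X → alph v') (L : List X) (U : ∀ v, List (alph v)) :
    pushAll (L.flatMap fun a => [⟨v, g a⟩, ⟨v', g' a⟩]) U =
      update (update U v ((L.map g).reverse ++ U v)) v' ((L.map g').reverse ++ U v') := by
  induction L generalizing U with
  | nil => simp [pushAll]
  | cons a L ih =>
    simp only [List.flatMap_cons, List.cons_append, List.nil_append, pushAll, ih]
    rw [update_of_ne h.symm, update_of_ne h, update_self, update_self]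
    simp only [List.map_cons, List.reverse_cons, List.append_assoc, List.cons_append,
      List.nil_append]
    rw [update_comm h, update_idem, update_comm h.symm, update_idem]

theorem PolyTime.pair [Fintype Γ₁] [Fintype Γ₂] [Fintype Γ₃] {f : α → β} {g : α → γ}
    (hf : PolyTime ea eb f) (hg : PolyTime ea ec g) :
    PolyTime ea (prodEnc eb ec) fun a => (f a, g a) := by
  obtain ⟨pf, hpf⟩ := hf.exists_length_le
  obtain ⟨pg, hpg⟩ := hg.exists_length_le
  obtain ⟨c₁, q₁, h₁⟩ := polyTime_iff.1 hf
  obtain ⟨c₂, q₂, h₂⟩ := polyTime_iff.1 hg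
  let pin : Bool → PairStk := fun i => cond i .in₂ .in₁
  let pout : Bool → PairStk := fun i => cond i .out₂ .out₁
  let C : ∀ i, TM2ComputableAux (PairStk.alph Γ₁ Γ₂ Γ₃ (pin i)) (PairStk.alph Γ₁ Γ₂ Γ₃ (pout i)) :=
    fun i => match i with
      | false => c₁
      | true => c₂
  refine PolyTime.of_runs (C := C) (instr := pairInstr Γ₁ Γ₂ Γ₃) (emit := Act.emit)
    (start := .load) (vin := .inp) (vout := .res)
    (q₁ + q₂ + 6 * Polynomial.X + 4 * pf + 4 * pg + 17) fun a => ?_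
  have lf := hpf a
  have lg := hpg a
  refine ⟨q₁.eval (ea a).length + q₂.eval (ea a).length + 6 * (ea a).length +
    4 * (eb (f a)).length + 4 * (ec (g a)).length + 17, ?_, ?_⟩
  · simp only [Polynomial.eval_add, Polynomial.eval_mul, Polynomial.eval_X, Polynomial.eval_ofNat]
    omega
  refine Runs.scan (v := PairStk.inp) (W := fun a => [⟨.in₁, a⟩, ⟨.in₂, a⟩]) (ea a) rfl rfl
    (fun a => rfl) (by simp) (by simp) (by omega) ?_
  rw [pushAll_flatMap_pair (by simp)]
  refine Runs.invoke false (ea a) (eb (f a)) rfl (by simp [pin, pout]) (h₁ a) (by simp [pin])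
    (by simp [pout]) (by omega) ?_
  refine Runs.invoke true (ea a) (ec (g a)) rfl (by simp [pin, pout]) (h₂ a) (by simp [pin, pout])
    (by simp [pout, pin]) (by omega) ?_
  -- The second component is pushed first, so that the first one ends up on top, as `prodEnc`
  -- demands.
  refine Runs.move PairStk.out₂ PairStk.res (by simp) (fun a => .inr a) (ec (g a)).reverse rfl rfl
    (fun a => rfl) (by simp [pin, pout]) (by simp; omega) ?_
  refine Runs.move PairStk.out₁ PairStk.res (by simp) (fun a => .inl a) (eb (f a)).reverse rfl rfl
    (fun a => rfl) (by simp [pin, pout]) (by simp; omega) ?_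
  refine Runs.halted rfl ?_ (by simp; omega)
  funext v
  cases v <;> simp [pin, pout, prodEnc]

end Pair

/-! ### Iteration -/

section Iterate

/-- The stacks of the program for an iteration. -/
inductive IterStk
  | inp | cnt | in₁ | out₁ | mid | res
  deriving DecidableEq

instance : Fintype IterStk :=
  ⟨{.inp, .cnt, .in₁, .out₁, .mid, .res}, fun x => by cases x <;> simp⟩

/-- The control states of the program for an iteration. -/
inductive IterCtl
  | load | loop | call | store | move | finish | halted
  deriving DecidableEq

instance : Fintype IterCtl :=
  ⟨{.load, .loop, .call, .store, .move, .finish, .halted}, fun x => by cases x <;> simp⟩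

variable {α γ Γ Γ₀ : Type} {ea : α → List Γ} {eg : γ → List Γ₀}

/-- The alphabets of the program for an iteration. -/
abbrev IterStk.alph (Γ : Type) : IterStk → Type
  | .inp => Bool ⊕ Γ
  | .cnt => Bool
  | .in₁ => Γ
  | .out₁ => Γ
  | .mid => Γ
  | .res => Γ

instance [Fintype Γ] : ∀ v, Fintype (IterStk.alph Γ v)
  | .inp => (inferInstance : Fintype (Bool ⊕ Γ))
  | .cnt => (inferInstance : Fintype Bool)
  | .in₁ => (inferInstance : Fintype Γ)
  | .out₁ => (inferInstance : Fintype Γ)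
  | .mid => (inferInstance : Fintype Γ)
  | .res => (inferInstance : Fintype Γ)

/-- The instructions of the program for an iteration. -/
def iterInstr (Γ : Type) : IterCtl →
    Instr (IterStk.alph Γ) Unit IterCtl (Act (IterStk.alph Γ) IterCtl)
  | .load => .pop .inp fun o => o.elim (.loop, none, none) fun x =>
      (.load, some (x.elim (fun b => ⟨.cnt, b⟩) fun a => ⟨.in₁, a⟩), none)
  | .loop => .pop .cnt fun o => o.elim (.finish, none, none) fun _ => (.call, none, none)
  | .call => .call () .store
  | .store => .pop .out₁ fun o => o.elim (.move, none, none) fun a => (.store, some ⟨.mid, a⟩, none)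
  | .move => .pop .mid fun o => o.elim (.loop, none, none) fun a => (.move, some ⟨.in₁, a⟩, none)
  | .finish =>
    .pop .in₁ fun o => o.elim (.halted, none, none) fun a => (.finish, some ⟨.res, a⟩, none)
  | .halted => .halt

theorem length_unaryEncodeNat (n : ℕ) : (unaryEncodeNat n).length = n := by
  induction n with
  | zero => rfl
  | succ n ih => simp [unaryEncodeNat, ih]

theorem unaryEncodeNat_eq_replicate (n : ℕ) : unaryEncodeNat n = List.replicate n true := by
  induction n with
  | zero => rfl
  | succ n ih => simp [unaryEncodeNat, ih, List.replicate_succ]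

/-- Iteration of a polynomial-time function on a family of arguments with polynomially bounded
intermediate results, all relative to the code of the number of iterations and the argument. -/
theorem PolyTime.iterate_of_code [Fintype Γ] {f : α → α} (hf : PolyTime ea ea f) (n : γ → ℕ)
    (s : γ → α) (B : Polynomial ℕ) (hB : ∀ c i, i ≤ n c → (ea (f^[i] (s c))).length ≤
      B.eval (prodEnc unaryEncodeNat ea (n c, s c)).length) :
    PolyTime (fun c => prodEnc unaryEncodeNat ea (n c, s c)) ea fun c => f^[n c] (s c) := by
  obtain ⟨c₁, q₁, h₁⟩ := polyTime_iff.1 hf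
  let C : ∀ i : Unit, TM2ComputableAux (IterStk.alph Γ ((fun _ => .in₁ : Unit → IterStk) i))
    (IterStk.alph Γ ((fun _ => .out₁ : Unit → IterStk) i)) := fun _ => c₁
  -- With `b` bounding the codes of all intermediate results, one turn costs a call and two moves on
  -- strings of length at most `b`; the additive constants are rounded up.
  have loop : ∀ (b m : ℕ) (a : α), (∀ i ≤ m, (ea (f^[i] a)).length ≤ b) →
      Runs C (iterInstr Γ) Act.emit (m * (q₁.eval b + 8 * b + 20) + 2 * b + 6) .loop
        (update (update (fun _ => []) .cnt (List.replicate m true)) .in₁ (ea a).reverse)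
        (update (fun _ => []) .res (ea (f^[m] a))) := by
    intro b m
    induction m with
    | zero =>
      intro a hb
      have h0 : (ea a).length ≤ b := hb 0 le_rfl
      have e : 0 * (q₁.eval b + 8 * b + 20) + 2 * b + 6 = (2 * b + 4) + 2 := by ring
      rw [e]
      refine .pop rfl ?_
      simp only [List.replicate_zero, ne_eq, reduceCtorEq, not_false_eq_true, update_of_ne,
        update_self, List.head?_nil, Option.elim, Act.emit, Option.toList, List.append_nil, pushAll,
        List.tail_nil]
      refine Runs.move IterStk.in₁ IterStk.res (by simp) (fun a => a) (ea a).reverse rfl rfl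
        (fun a => rfl) (by simp) (by simp; omega) ?_
      refine Runs.halted rfl ?_ (by simp; omega)
      funext v
      cases v <;> simp
    | succ m ih =>
      intro a hb
      have h0 : (ea a).length ≤ b := hb 0 (Nat.zero_le _)
      have h1 : (ea (f a)).length ≤ b := hb 1 (by omega)
      have h2 := eval_mono q₁ h0
      have e : (m + 1) * (q₁.eval b + 8 * b + 20) + 2 * b + 6 =
        (m * (q₁.eval b + 8 * b + 20) + 2 * b + 6 + q₁.eval b + 8 * b + 18) + 2 := by ring
      rw [e]
      refine .pop rfl ?_
      simp only [List.replicate_succ, ne_eq, reduceCtorEq, not_false_eq_true, update_of_ne,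
        update_self, List.head?_cons, Option.elim, Act.emit, Option.toList, List.append_nil, pushAll,
        List.tail_cons]
      refine Runs.invoke () (ea a) (ea (f a)) rfl (by simp) (h₁ a) (by simp)
        (by simp) (by omega) ?_
      refine Runs.move IterStk.out₁ IterStk.mid (by simp) (fun a => a) (ea (f a)).reverse rfl rfl
        (fun a => rfl) (by simp) (by simp; omega) ?_
      refine Runs.move IterStk.mid IterStk.in₁ (by simp) (fun a => a) (ea (f a)) rfl rfl
        (fun a => rfl) (by simp) (by simp; omega) ?_
      have h3 := ih (f a) fun i hi => by
        have := hb (i + 1) (by omega)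
        rwa [iterate_succ_apply] at this
      rw [iterate_succ_apply]
      refine Runs.mono (t := m * (q₁.eval b + 8 * b + 20) + 2 * b + 6) ?_ (by simp; omega)
      change Runs C _ _ _ IterCtl.loop _ _
      convert h3 using 1
      funext v
      cases v <;> simp
  refine PolyTime.of_runs (C := C) (instr := iterInstr Γ) (emit := Act.emit)
    (start := .load) (vin := .inp) (vout := .res)
    (2 * Polynomial.X + 2 + Polynomial.X * (q₁.comp B + 8 * B + 20) + 2 * B + 6) fun c => ?_
  refine ⟨_, le_rfl, ?_⟩
  have h2 := loop _ (n c) (s c) (hB c)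
  have hn : n c ≤ (prodEnc unaryEncodeNat ea (n c, s c)).length := by
    simp [prodEnc, length_unaryEncodeNat]
  generalize hl : (prodEnc unaryEncodeNat ea (n c, s c)).length = l at *
  simp only [Polynomial.eval_add, Polynomial.eval_mul, Polynomial.eval_X, Polynomial.eval_comp,
    Polynomial.eval_ofNat]
  refine Runs.scan (v := IterStk.inp)
    (W := fun x => [x.elim (fun b => ⟨.cnt, b⟩) fun a => ⟨.in₁, a⟩])
    (prodEnc unaryEncodeNat ea (n c, s c)) rfl rfl (fun a => rfl) ?_ (by simp) (by omega) ?_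
  · rintro (a | a) <;> simp
  refine Runs.mono (t := n c * (q₁.eval (B.eval l) + 8 * B.eval l + 20) + 2 * B.eval l + 6) ?_ ?_
  · change Runs C _ _ _ IterCtl.loop _ _
    convert h2 using 1
    rw [prodEnc, List.flatMap_append, pushAll_append, List.flatMap_map, List.flatMap_map]
    simp only [Sum.elim_inl, Sum.elim_inr, ← List.map_eq_flatMap]
    rw [pushAll_map (g := fun b => b), pushAll_map (g := fun a => a)]
    funext v
    cases v <;> simp [unaryEncodeNat_eq_replicate]
  · have := Nat.mul_le_mul_right (q₁.eval (B.eval l) + 8 * B.eval l + 20) hn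
    omega

end Iterate

end Stoq

namespace Stoq

open Computability Turing Function

variable {α β γ δ Γ Γ₁ Γ₂ Γ₃ : Type} [Fintype Γ] [Fintype Γ₁] [Fintype Γ₂] [Fintype Γ₃]
  {eg : γ → List Γ} {ea : α → List Γ₁} {eb : β → List Γ₂} {ed : δ → List Γ₃}

/-! ### Basic polynomial-time functions -/

/-- A machine sees only codes, so functions with equal output codes are computed by the same
machine. -/
theorem PolyTime.recode {α' : Type} {ea' : α' → List Γ₁} {f : γ → α} {g : γ → α'}
    (h : PolyTime eg ea f) (hfg : ∀ c, ea (f c) = ea' (g c)) : PolyTime eg ea' g := by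
  obtain ⟨c, p, h⟩ := polyTime_iff.1 h
  exact polyTime_iff.2 ⟨c, p, fun a => hfg a ▸ h a⟩

theorem PolyTime.flatMap {f : α → β} (w : Γ₁ → List Γ₂) (h : ∀ a, eb (f a) = (ea a).flatMap w) :
    PolyTime ea eb f := by
  refine PolyTime.transduce (Q := Unit) (fun _ _ => ()) (fun _ => w) (fun _ => []) () fun a => ?_
  rw [h a]
  generalize ea a = l
  induction l with
  | nil => rfl
  | cons x l ih => simp [Stoq.transduce, ih]

theorem PolyTime.const (b : β) : PolyTime eg eb fun _ => b := by
  refine PolyTime.transduce (Q := Unit) (fun _ _ => ()) (fun _ _ => []) (fun _ => eb b) ()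
    fun a => ?_
  generalize eg a = l
  induction l with
  | nil => rfl
  | cons x l ih => simpa [Stoq.transduce] using ih

theorem PolyTime.of_code_eq {e : α → List Γ₂} {f : α → β} (h : ∀ a, eb (f a) = e a) :
    PolyTime e eb f :=
  PolyTime.flatMap (fun a => [a]) fun a => by simp [h]

theorem PolyTime.id : PolyTime eg eg fun c => c :=
  PolyTime.of_code_eq fun _ => rfl

theorem PolyTime.fst : PolyTime (prodEnc ea eb) ea fun p => p.1 := by
  refine PolyTime.flatMap (Sum.elim (fun a => [a]) fun _ => []) fun p => ?_
  simp [prodEnc, List.flatMap_append, List.flatMap_map]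

theorem PolyTime.snd : PolyTime (prodEnc ea eb) eb fun p => p.2 := by
  refine PolyTime.flatMap (Sum.elim (fun _ => []) fun a => [a]) fun p => ?_
  simp [prodEnc, List.flatMap_append, List.flatMap_map]

theorem PolyTime.left {f : γ → α × β} (h : PolyTime eg (prodEnc ea eb) f) :
    PolyTime eg ea fun c => (f c).1 :=
  PolyTime.fst.comp h

theorem PolyTime.right {f : γ → α × β} (h : PolyTime eg (prodEnc ea eb) f) :
    PolyTime eg eb fun c => (f c).2 :=
  PolyTime.snd.comp h

theorem PolyTime.bool₂ (F : Bool → Bool → Bool) {f g : γ → Bool} (hf : PolyTime eg encodeBool f)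
    (hg : PolyTime eg encodeBool g) : PolyTime eg encodeBool fun c => F (f c) (g c) := by
  refine PolyTime.comp (g := fun p : Bool × Bool => F p.1 p.2) ?_ (hf.pair hg)
  refine PolyTime.transduce (Q := Bool) (fun q s => s.elim (fun b => b) fun _ => q)
    (fun q s => s.elim (fun _ => []) fun b => [F q b]) (fun _ => []) false fun p => ?_
  rfl

theorem PolyTime.not {f : γ → Bool} (hf : PolyTime eg encodeBool f) :
    PolyTime eg encodeBool fun c => !f c :=
  PolyTime.bool₂ (fun b _ => !b) hf hf

/-- Both branches are computed; a transducer then remembers the bit, which comes first in the code,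
and lets only the symbols of the chosen branch pass. -/
theorem PolyTime.ite {b : γ → Bool} {f g : γ → α} (hb : PolyTime eg encodeBool b)
    (hf : PolyTime eg ea f) (hg : PolyTime eg ea g) :
    PolyTime eg ea fun c => if b c then f c else g c := by
  refine PolyTime.comp (g := fun p : Bool × (α × α) => if p.1 then p.2.1 else p.2.2) ?_
    (hb.pair (hf.pair hg))
  refine PolyTime.transduce (Q := Bool) (fun q s => s.elim (fun b => b) fun _ => q)
    (fun q s => s.elim (fun _ => []) fun s => s.elim (fun a => if q then [a] else [])
      fun a => if q then [] else [a]) (fun _ => []) false fun p => ?_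
  have aux : ∀ (q : Bool) (l l' : List Γ₁), Stoq.transduce
      (fun (q : Bool) (s : Bool ⊕ (Γ₁ ⊕ Γ₁)) => s.elim (fun b => b) fun _ => q)
      (fun q s => s.elim (fun _ => []) fun s => s.elim (fun a => if q then [a] else [])
        fun a => if q then [] else [a]) (fun _ => []) q
      ((l.map Sum.inl ++ l'.map Sum.inr).map Sum.inr) = if q then l else l' := by
    intro q l l'
    induction l with
    | nil =>
      induction l' with
      | nil => simp [Stoq.transduce]
      | cons a l' ih =>
        simp only [List.map_nil, List.nil_append, List.map_cons, Stoq.transduce, Sum.elim_inr] at ih ⊢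
        rw [ih]
        cases q <;> rfl
    | cons a l ih =>
      simp only [List.map_cons, List.cons_append, Stoq.transduce, Sum.elim_inr, Sum.elim_inl] at ih ⊢
      rw [ih]
      cases q <;> rfl
  obtain ⟨b, x, y⟩ := p
  have h1 : ea (if b then x else y) = if b then ea x else ea y := by split <;> rfl
  change ea (if b then x else y) = [] ++ _
  rw [h1, ← aux b (ea x) (ea y)]
  rfl

/-! ### Polynomially bounded functions -/

/-- A numerical function is bounded by a polynomial in the length of the code of its argument. -/
def PolyBdd (eg : γ → List Γ) (h : γ → ℕ) : Prop :=
  ∃ B : Polynomial ℕ, ∀ c, h c ≤ B.eval (eg c).length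

theorem PolyTime.bdd {f : γ → α} (h : PolyTime eg ea f) : PolyBdd eg fun c => (ea (f c)).length :=
  h.exists_length_le

theorem PolyBdd.const (n : ℕ) : PolyBdd eg fun _ => n :=
  ⟨Polynomial.C n, fun _ => by simp⟩

theorem PolyBdd.add {f g : γ → ℕ} (hf : PolyBdd eg f) (hg : PolyBdd eg g) :
    PolyBdd eg fun c => f c + g c := by
  obtain ⟨p, hp⟩ := hf
  obtain ⟨q, hq⟩ := hg
  exact ⟨p + q, fun c => by simpa using Nat.add_le_add (hp c) (hq c)⟩

theorem PolyBdd.mul {f g : γ → ℕ} (hf : PolyBdd eg f) (hg : PolyBdd eg g) :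
    PolyBdd eg fun c => f c * g c := by
  obtain ⟨p, hp⟩ := hf
  obtain ⟨q, hq⟩ := hg
  exact ⟨p * q, fun c => by simpa using Nat.mul_le_mul (hp c) (hq c)⟩

theorem PolyBdd.mono {f g : γ → ℕ} (hf : PolyBdd eg f) (h : ∀ c, g c ≤ f c) : PolyBdd eg g := by
  obtain ⟨p, hp⟩ := hf
  exact ⟨p, fun c => (h c).trans (hp c)⟩

theorem PolyTime.bdd_unary {n : γ → ℕ} (h : PolyTime eg unaryEncodeNat n) : PolyBdd eg n :=
  h.bdd.mono fun c => (length_unaryEncodeNat (n c)).ge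

/-! ### Iteration -/

theorem length_prodEnc (p : α × β) :
    (prodEnc ea eb p).length = (ea p.1).length + (eb p.2).length := by
  simp [prodEnc]

/-- The context is carried in the state: the map (c, a) ↦ (c, f c a) has no parameter and can be
iterated as it stands. The bound `b` is essential, since lengths may otherwise grow exponentially
under iteration. -/
theorem PolyTime.iterate {f : γ → α → α} {n : γ → ℕ} {s : γ → α} {b : γ → ℕ}
    (hf : PolyTime (prodEnc eg ea) ea fun p => f p.1 p.2) (hn : PolyTime eg unaryEncodeNat n)
    (hs : PolyTime eg ea s) (hb : PolyBdd eg b)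
    (h : ∀ c i, i ≤ n c → (ea ((f c)^[i] (s c))).length ≤ b c) :
    PolyTime eg ea fun c => (f c)^[n c] (s c) := by
  obtain ⟨B, hB⟩ := hb
  have hit : ∀ c i, (fun p : γ × α => (p.1, f p.1 p.2))^[i] (c, s c) = (c, (f c)^[i] (s c)) := by
    intro c i
    induction i with
    | zero => rfl
    | succ i ih => rw [iterate_succ_apply', ih, iterate_succ_apply']
  have h1 := PolyTime.iterate_of_code (ea := prodEnc eg ea) (f := fun p => (p.1, f p.1 p.2))
    (PolyTime.fst.pair hf) n (fun c => (c, s c)) (Polynomial.X + B) fun c i hi => by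
      rw [hit, length_prodEnc, length_prodEnc, length_prodEnc, Polynomial.eval_add,
        Polynomial.eval_X]
      have := (h c i hi).trans ((hB c).trans (eval_mono B
        (n := (unaryEncodeNat (n c)).length + ((eg c).length + (ea (s c)).length)) (by omega)))
      simp only
      omega
  have h2 := h1.comp (f := fun c => c) (ea := eg) ((hn.pair (PolyTime.id.pair hs)).recode fun _ => rfl)
  simp only [hit] at h2
  exact h2.right

/-! ### Numbers in unary -/

theorem PolyTime.code_length : PolyTime eg unaryEncodeNat fun c => (eg c).length := by
  refine PolyTime.flatMap (fun _ => [true]) fun c => ?_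
  rw [unaryEncodeNat_eq_replicate]
  generalize eg c = l
  induction l with
  | nil => rfl
  | cons a l ih => simp [List.replicate_succ, ih]

theorem PolyTime.unary_add {m n : γ → ℕ} (hm : PolyTime eg unaryEncodeNat m)
    (hn : PolyTime eg unaryEncodeNat n) : PolyTime eg unaryEncodeNat fun c => m c + n c := by
  refine PolyTime.comp (g := fun p : ℕ × ℕ => p.1 + p.2) ?_ (hm.pair hn)
  refine PolyTime.flatMap (fun s => [s.elim (fun b => b) fun b => b]) fun p => ?_
  rw [← List.map_eq_flatMap]
  simp [prodEnc, unaryEncodeNat_eq_replicate]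

theorem PolyTime.unary_pred {m : γ → ℕ} (hm : PolyTime eg unaryEncodeNat m) :
    PolyTime eg unaryEncodeNat fun c => m c - 1 := by
  refine PolyTime.comp (g := fun n => n - 1) ?_ hm
  refine PolyTime.transduce (Q := Bool) (fun _ _ => true) (fun q a => if q then [a] else [])
    (fun _ => []) false fun n => ?_
  have aux : ∀ l : List Bool, Stoq.transduce (fun (_ : Bool) (_ : Bool) => true)
      (fun q a => if q then [a] else []) (fun _ => []) true l = l := by
    intro l
    induction l with
    | nil => rfl
    | cons a l ih => simp [Stoq.transduce, ih]
  cases n with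
  | zero => rfl
  | succ n => simp [unaryEncodeNat, Stoq.transduce, aux]

theorem PolyTime.unary_sub {m n : γ → ℕ} (hm : PolyTime eg unaryEncodeNat m)
    (hn : PolyTime eg unaryEncodeNat n) : PolyTime eg unaryEncodeNat fun c => m c - n c := by
  have hit : ∀ (i a : ℕ), (fun a => a - 1)^[i] a = a - i := by
    intro i a
    induction i with
    | zero => rfl
    | succ i ih => rw [iterate_succ_apply', ih]; omega
  have := PolyTime.iterate (f := fun (_ : γ) a => a - 1) (PolyTime.snd.unary_pred) hn hm hm.bdd_unary
    fun c i _ => by rw [hit, length_unaryEncodeNat]; omega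
  simpa only [hit] using this

theorem PolyTime.unary_mul {m n : γ → ℕ} (hm : PolyTime eg unaryEncodeNat m)
    (hn : PolyTime eg unaryEncodeNat n) : PolyTime eg unaryEncodeNat fun c => m c * n c := by
  have hit : ∀ (c : γ) (i : ℕ), (fun a => a + m c)^[i] 0 = m c * i := by
    intro c i
    induction i with
    | zero => rfl
    | succ i ih => rw [iterate_succ_apply', ih]; ring
  have := PolyTime.iterate (f := fun (c : γ) a => a + m c)
    (PolyTime.snd.unary_add (hm.comp PolyTime.fst)) hn (PolyTime.const 0)
    (hm.bdd_unary.mul hn.bdd_unary)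
    fun c i hi => by rw [hit, length_unaryEncodeNat]; exact Nat.mul_le_mul_left _ hi
  simpa only [hit] using this

theorem PolyTime.unary_eval (p : Polynomial ℕ) {n : γ → ℕ} (hn : PolyTime eg unaryEncodeNat n) :
    PolyTime eg unaryEncodeNat fun c => p.eval (n c) := by
  induction p using Polynomial.induction_on with
  | C a => simpa using PolyTime.const a
  | add p q hp hq => simpa using hp.unary_add hq
  | monomial k a ih =>
    have := ih.unary_mul hn
    simpa [pow_succ, mul_assoc] using this

theorem PolyTime.unary_isZero {m : γ → ℕ} (hm : PolyTime eg unaryEncodeNat m) :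
    PolyTime eg encodeBool fun c => m c == 0 := by
  refine PolyTime.comp (g := fun n : ℕ => n == 0) ?_ hm
  refine PolyTime.transduce (Q := Bool) (fun _ _ => false) (fun _ _ => []) (fun q => [q]) true
    fun n => ?_
  have aux : ∀ l : List Bool, Stoq.transduce (fun (_ : Bool) (_ : Bool) => false)
      (fun _ _ => []) (fun q => [q]) false l = [false] := by
    intro l
    induction l with
    | nil => rfl
    | cons a l ih => simp [Stoq.transduce, ih]
  cases n with
  | zero => rfl
  | succ n => simp [unaryEncodeNat, Stoq.transduce, aux, encodeBool]

end Stoq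

namespace Stoq

open Computability Turing Function

variable {α β γ δ Γ Γ₁ Γ₂ Γ₃ : Type} [Fintype Γ] [Fintype Γ₁] [Fintype Γ₂] [Fintype Γ₃]
  {eg : γ → List Γ} {ea : α → List Γ₁} {eb : β → List Γ₂} {ed : δ → List Γ₃}

/-! ### Lists -/

/-- The code of a list: the code of each element is followed by an end marker. -/
def listEnc (ea : α → List Γ₁) (l : List α) : List (Option Γ₁) :=
  l.flatMap fun a => (ea a).map some ++ [none]

@[simp]
theorem listEnc_nil : listEnc ea [] = [] := rfl

@[simp]
theorem listEnc_cons (a : α) (l : List α) :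
    listEnc ea (a :: l) = (ea a).map some ++ none :: listEnc ea l := by
  simp [listEnc]

theorem listEnc_append (l l' : List α) : listEnc ea (l ++ l') = listEnc ea l ++ listEnc ea l' := by
  simp [listEnc]

theorem length_le_listEnc (l : List α) : l.length ≤ (listEnc ea l).length := by
  induction l with
  | nil => simp
  | cons a l ih => simp; omega

theorem length_listEnc_encodeBool (l : List Bool) : (listEnc encodeBool l).length = 2 * l.length := by
  induction l with
  | nil => simp
  | cons a l ih =>
    rw [listEnc_cons, List.length_append, List.length_cons, ih, List.length_map]
    simp only [encodeBool, List.pure_def, List.length_cons, List.length_nil]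
    omega

theorem PolyTime.toList {l : γ → List Bool} (h : PolyTime eg (fun l : List Bool => l) l) :
    PolyTime eg (listEnc encodeBool) l :=
  PolyTime.comp (g := fun l => l) (PolyTime.flatMap (fun b => [some b, none]) fun _ => rfl) h

theorem PolyTime.ofList {l : γ → List Bool} (h : PolyTime eg (listEnc encodeBool) l) :
    PolyTime eg (fun l : List Bool => l) l := by
  refine PolyTime.comp (g := fun l => l) (PolyTime.flatMap Option.toList fun l => ?_) h
  induction l with
  | nil => rfl
  | cons a l ih => simpa [encodeBool] using ih

/-- The end marker of the new element is written before the first symbol of the list, or at the very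
end if the list is empty; the state records whether this has been done. -/
theorem PolyTime.cons {a : γ → α} {l : γ → List α} (ha : PolyTime eg ea a)
    (hl : PolyTime eg (listEnc ea) l) : PolyTime eg (listEnc ea) fun c => a c :: l c := by
  refine PolyTime.comp (g := fun p : α × List α => p.1 :: p.2) ?_ (ha.pair hl)
  let δ : Bool → Γ₁ ⊕ Option Γ₁ → Bool := fun _ s => s.elim (fun _ => false) fun _ => true
  let w : Bool → Γ₁ ⊕ Option Γ₁ → List (Option Γ₁) := fun q s => s.elim (fun a => [some a])
    fun o => if q then [o] else [none, o]
  let fin : Bool → List (Option Γ₁) := fun q => if q then [] else [none]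
  refine PolyTime.transduce δ w fin false fun p => ?_
  have h1 : ∀ l : List (Option Γ₁), Stoq.transduce δ w fin true (l.map .inr) = l := by
    intro l
    induction l with
    | nil => rfl
    | cons o l ih => exact congrArg (o :: ·) ih
  have h2 : ∀ l : List (Option Γ₁), Stoq.transduce δ w fin false (l.map .inr) = none :: l := by
    rintro (_ | ⟨o, l⟩)
    · rfl
    · exact congrArg (fun l => none :: o :: l) (h1 l)
  have h3 : ∀ (l : List Γ₁) (l' : List (Option Γ₁)), Stoq.transduce δ w fin false
      (l.map .inl ++ l'.map .inr) = l.map some ++ none :: l' := by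
    intro l l'
    induction l with
    | nil => exact h2 l'
    | cons a l ih => exact congrArg (some a :: ·) ih
  rw [prodEnc, h3, listEnc_cons]

theorem PolyTime.append {l l' : γ → List α} (hl : PolyTime eg (listEnc ea) l)
    (hl' : PolyTime eg (listEnc ea) l') : PolyTime eg (listEnc ea) fun c => l c ++ l' c := by
  refine PolyTime.comp (g := fun p : List α × List α => p.1 ++ p.2) ?_ (hl.pair hl')
  refine PolyTime.flatMap (fun s => [s.elim (fun a => a) fun a => a]) fun p => ?_
  rw [← List.map_eq_flatMap, listEnc_append]
  simp [prodEnc]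

theorem PolyTime.tail {l : γ → List α} (hl : PolyTime eg (listEnc ea) l) :
    PolyTime eg (listEnc ea) fun c => (l c).tail := by
  refine PolyTime.comp (g := List.tail) ?_ hl
  let δ : Bool → Option Γ₁ → Bool := fun q s => q || s.isNone
  let w : Bool → Option Γ₁ → List (Option Γ₁) := fun q s => if q then [s] else []
  refine PolyTime.transduce δ w (fun _ => []) false fun l => ?_
  have h1 : ∀ l : List (Option Γ₁), Stoq.transduce δ w (fun _ => []) true l = l := by
    intro l
    induction l with
    | nil => rfl
    | cons o l ih => exact congrArg (o :: ·) ih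
  have h2 : ∀ (l : List Γ₁) (l' : List (Option Γ₁)), Stoq.transduce δ w (fun _ => []) false
      (l.map some ++ none :: l') = l' := by
    intro l l'
    induction l with
    | nil => exact h1 l'
    | cons a l ih => exact ih
  cases l with
  | nil => rfl
  | cons a l => rw [listEnc_cons, h2]; rfl

/-- The states mean: nothing read (`none`), inside the first element (`some false`), behind it
(`some true`). Only the empty list gives a code without symbols, since even an element with empty
code has its end marker. -/
theorem PolyTime.headD (d : α) {l : γ → List α} (hl : PolyTime eg (listEnc ea) l) :
    PolyTime eg ea fun c => (l c).headD d := by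
  refine PolyTime.comp (g := fun l => List.headD l d) ?_ hl
  let δ : Option Bool → Option Γ₁ → Option Bool := fun q s => some (q == some true || s.isNone)
  let w : Option Bool → Option Γ₁ → List Γ₁ := fun q s => if q = some true then [] else s.toList
  let fin : Option Bool → List Γ₁ := fun q => if q = none then ea d else []
  refine PolyTime.transduce δ w fin none fun l => ?_
  have h1 : ∀ l : List (Option Γ₁), Stoq.transduce δ w fin (some true) l = [] := by
    intro l
    induction l with
    | nil => rfl
    | cons o l ih => exact ih
  have h2 : ∀ (l : List Γ₁) (l' : List (Option Γ₁)), Stoq.transduce δ w fin (some false)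
      (l.map some ++ none :: l') = l := by
    intro l l'
    induction l with
    | nil => exact h1 l'
    | cons a l ih => exact congrArg (a :: ·) ih
  cases l with
  | nil => rfl
  | cons a l =>
    rw [listEnc_cons]
    rcases h : ea a with _ | ⟨x, m⟩
    · exact h.trans (h1 _).symm
    · exact h.trans (congrArg (x :: ·) (h2 m _).symm)

theorem PolyTime.isEmpty {l : γ → List α} (hl : PolyTime eg (listEnc ea) l) :
    PolyTime eg encodeBool fun c => (l c).isEmpty := by
  refine PolyTime.comp (g := List.isEmpty) ?_ hl
  refine PolyTime.transduce (Q := Bool) (fun _ _ => false) (fun _ _ => []) (fun q => [q]) true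
    fun l => ?_
  have aux : ∀ l : List (Option Γ₁), Stoq.transduce (fun (_ : Bool) (_ : Option Γ₁) => false)
      (fun _ _ => []) (fun q => [q]) false l = [false] := by
    intro l
    induction l with
    | nil => rfl
    | cons a l ih => simp [Stoq.transduce, ih]
  cases l with
  | nil => rfl
  | cons a l =>
    rw [listEnc_cons]
    cases ea a with
    | nil => exact (aux _).symm
    | cons => exact (aux _).symm

theorem PolyTime.length {l : γ → List α} (hl : PolyTime eg (listEnc ea) l) :
    PolyTime eg unaryEncodeNat fun c => (l c).length := by
  refine PolyTime.comp (g := List.length) ?_ hl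
  refine PolyTime.flatMap (fun o => o.elim [true] fun _ => []) fun l => ?_
  induction l with
  | nil => rfl
  | cons a l ih =>
    have : ∀ m : List Γ₁, (m.flatMap fun _ => ([] : List Bool)) = [] := fun m => by simp
    simp only [List.length_cons, unaryEncodeNat, listEnc_cons, List.flatMap_append,
      List.flatMap_map, Option.elim, this, List.flatMap_cons, List.nil_append]
    exact congrArg (true :: ·) ih

theorem PolyTime.replicate (a : α) {n : γ → ℕ} (hn : PolyTime eg unaryEncodeNat n) :
    PolyTime eg (listEnc ea) fun c => List.replicate (n c) a := by
  refine PolyTime.comp (g := fun n => List.replicate n a) ?_ hn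
  refine PolyTime.flatMap (fun _ => (ea a).map some ++ [none]) fun n => ?_
  induction n with
  | zero => rfl
  | succ n ih => simp [unaryEncodeNat, List.replicate_succ, ih]

/-- This is the iteration of a step on pairs of remaining list and accumulator. The folds over
prefixes are its intermediate results, hence the form of the bound. -/
theorem PolyTime.foldl {f : γ → β → α → β} {l : γ → List α} {s : γ → β} {b : γ → ℕ}
    (hf : PolyTime (prodEnc eg (prodEnc eb ea)) eb fun p => f p.1 p.2.1 p.2.2)
    (hl : PolyTime eg (listEnc ea) l) (hs : PolyTime eg eb s) (hb : PolyBdd eg b)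
    (h : ∀ c l₁ l₂, l c = l₁ ++ l₂ → (eb (l₁.foldl (f c) (s c))).length ≤ b c) :
    PolyTime eg eb fun c => (l c).foldl (f c) (s c) := by
  -- `headD` needs some default. It is never folded in, because the step leaves pairs with an empty
  -- list unchanged.
  rcases isEmpty_or_nonempty α with hα | ⟨⟨d⟩⟩
  · have : ∀ l : List α, l = [] := fun l => List.eq_nil_of_length_eq_zero (by
      cases l with
      | nil => rfl
      | cons a l => exact hα.elim a)
    simpa [this (l _)] using hs
  let F : γ → List α × β → List α × β := fun c p =>
    if p.1.isEmpty then p else (p.1.tail, f c p.2 (p.1.headD d))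
  have hF : PolyTime (prodEnc eg (prodEnc (listEnc ea) eb)) (prodEnc (listEnc ea) eb)
      fun p => F p.1 p.2 := by
    have h1 := PolyTime.snd (ea := eg) (eb := prodEnc (listEnc ea) eb)
    exact PolyTime.ite h1.left.isEmpty h1 (h1.left.tail.pair
      (hf.comp (PolyTime.fst.pair (h1.right.pair (h1.left.headD d)))))
  have hit : ∀ c i, (F c)^[i] (l c, s c) = ((l c).drop i, ((l c).take i).foldl (f c) (s c)) := by
    intro c i
    induction i with
    | zero => rfl
    | succ i ih =>
      rw [iterate_succ_apply', ih]
      by_cases hi : i < (l c).length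
      · rw [List.drop_eq_getElem_cons hi, List.take_succ_eq_append_getElem hi]
        simp only [F, List.isEmpty_cons, Bool.false_eq_true, if_false, List.tail_cons,
          List.headD_cons, List.foldl_append, List.foldl_cons, List.foldl_nil]
      · have h1 : (l c).drop i = [] := List.drop_of_length_le (by omega)
        rw [h1, List.drop_of_length_le (by omega : (l c).length ≤ i + 1),
          List.take_of_length_le (by omega : (l c).length ≤ i),
          List.take_of_length_le (by omega : (l c).length ≤ i + 1)]
        rfl
  have h1 := PolyTime.iterate hF hl.length (hl.pair hs) (hl.bdd.add hb) fun c i _ => by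
    rw [hit, length_prodEnc]
    refine Nat.add_le_add ?_ (h c _ _ (List.take_append_drop i (l c)).symm)
    conv_rhs => rw [← List.take_append_drop i (l c), listEnc_append]
    simp
  simp only [hit, List.take_length] at h1
  exact h1.right

theorem length_listEnc_reverse (l : List α) :
    (listEnc ea l.reverse).length = (listEnc ea l).length := by
  induction l with
  | nil => rfl
  | cons a l ih => simp [listEnc_append, ih]; omega

theorem PolyTime.reverse {l : γ → List α} (hl : PolyTime eg (listEnc ea) l) :
    PolyTime eg (listEnc ea) fun c => (l c).reverse := by
  have hr : ∀ l : List α, l.foldl (fun b a => a :: b) [] = l.reverse := fun l => by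
    simp
  have := PolyTime.foldl (f := fun (_ : γ) (b : List α) a => a :: b)
    (PolyTime.snd.right.cons PolyTime.snd.left) hl (PolyTime.const []) hl.bdd fun c l₁ l₂ h => by
      rw [hr, length_listEnc_reverse, h, listEnc_append]
      simp
  simpa only [hr] using this

theorem PolyTime.drop {l : γ → List α} {n : γ → ℕ} (hn : PolyTime eg unaryEncodeNat n)
    (hl : PolyTime eg (listEnc ea) l) : PolyTime eg (listEnc ea) fun c => (l c).drop (n c) := by
  have hit : ∀ (i : ℕ) (l : List α), List.tail^[i] l = l.drop i := by
    intro i l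
    induction i with
    | zero => rfl
    | succ i ih => rw [iterate_succ_apply', ih, List.tail_drop]
  have := PolyTime.iterate (f := fun (_ : γ) l => List.tail l) (PolyTime.snd.tail) hn hl hl.bdd
    fun c i _ => by
      rw [hit]
      conv_rhs => rw [← List.take_append_drop i (l c), listEnc_append]
      simp
  simpa only [hit] using this

theorem PolyTime.take {l : γ → List α} {n : γ → ℕ} (hn : PolyTime eg unaryEncodeNat n)
    (hl : PolyTime eg (listEnc ea) l) : PolyTime eg (listEnc ea) fun c => (l c).take (n c) := by
  have h : ∀ (n : ℕ) (l : List α), l.take n = (l.reverse.drop (l.length - n)).reverse := by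
    intro n l
    rw [List.drop_reverse, List.reverse_reverse]
    by_cases h : n ≤ l.length
    · rw [Nat.sub_sub_self h]
    · rw [List.take_of_length_le (by omega), List.take_of_length_le (by omega)]
  simp only [h]
  exact (PolyTime.drop (hl.length.unary_sub hn) hl.reverse).reverse

theorem PolyTime.getD (d : α) {l : γ → List α} {n : γ → ℕ} (hn : PolyTime eg unaryEncodeNat n)
    (hl : PolyTime eg (listEnc ea) l) : PolyTime eg ea fun c => (l c).getD (n c) d := by
  have h : ∀ (n : ℕ) (l : List α), l.getD n d = (l.drop n).headD d := by
    intro n l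
    rw [List.headD_eq_head?_getD, List.head?_drop, List.getD_eq_getElem?_getD]
  simp only [h]
  exact (PolyTime.drop hn hl).headD d

theorem PolyTime.set {l : γ → List α} {n : γ → ℕ} {a : γ → α} (hn : PolyTime eg unaryEncodeNat n)
    (ha : PolyTime eg ea a) (hl : PolyTime eg (listEnc ea) l) :
    PolyTime eg (listEnc ea) fun c => (l c).set (n c) (a c) := by
  have h : ∀ (n : ℕ) (l : List α) (a : α), l.set n a =
      if (l.drop n).isEmpty then l else l.take n ++ a :: l.drop (n + 1) := by
    intro n l a
    rw [List.set_eq_take_append_cons_drop]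
    by_cases h : n < l.length
    · simp [h]
    · simp [h, not_lt.1 h]
  simp only [h]
  exact PolyTime.ite (PolyTime.drop hn hl).isEmpty hl
    ((PolyTime.take hn hl).append (ha.cons (PolyTime.drop (hn.unary_add (PolyTime.const 1)) hl)))

end Stoq

namespace Stoq

open Computability Turing Function

variable {γ Γ : Type} [Fintype Γ] {eg : γ → List Γ}

/-! ### Numbers in binary -/

/-- The value of a string of binary digits, the least significant one first. -/
def bitsVal : List Bool → ℕ
  | [] => 0
  | b :: l => Nat.bit b (bitsVal l)

theorem bitsVal_append (l l' : List Bool) :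
    bitsVal (l ++ l') = bitsVal l + 2 ^ l.length * bitsVal l' := by
  induction l with
  | nil => simp [bitsVal]
  | cons b l ih =>
    simp only [List.cons_append, bitsVal, ih, Nat.bit_val, List.length_cons, pow_succ]
    ring

theorem bitsVal_lt (l : List Bool) : bitsVal l < 2 ^ l.length := by
  induction l with
  | nil => simp [bitsVal]
  | cons b l ih =>
    simp only [bitsVal, Nat.bit_val, List.length_cons, pow_succ]
    have := Bool.toNat_lt b
    omega

/-- The least significant digit comes first and there are no zeros at the top; the exceptional case
is a zero digit below the number zero. -/
theorem encodeNat_bit (b : Bool) (n : ℕ) : encodeNat (Nat.bit b n) =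
    if (encodeNat n).isEmpty && !b then [] else b :: encodeNat n := by
  unfold encodeNat
  rw [← Num.ofNat'_eq, Num.ofNat'_bit, Num.ofNat'_eq]
  cases (n : Num) with
  | zero => cases b <;> rfl
  | pos p =>
    have h := encodePosNum_nonempty p
    cases b <;> simp [encodeNum, Num.bit0, Num.bit1, encodePosNum, h]

theorem bitsVal_encodeNat (n : ℕ) : bitsVal (encodeNat n) = n := by
  induction n using Nat.binaryRec with
  | zero => rfl
  | bit b n ih =>
    rw [encodeNat_bit]
    split
    · rename_i h
      simp only [Bool.and_eq_true, List.isEmpty_iff, Bool.not_eq_eq_eq_not, Bool.not_true] at h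
      rw [h.1] at ih
      rw [← ih, h.2]
      rfl
    · rw [bitsVal, ih]

theorem length_encodeNat (n : ℕ) : (encodeNat n).length = n.size := by
  induction n using Nat.binaryRec with
  | zero => rfl
  | bit b n ih =>
    rw [encodeNat_bit]
    split
    · rename_i h
      simp only [Bool.and_eq_true, List.isEmpty_iff, Bool.not_eq_eq_eq_not, Bool.not_true] at h
      have : n = 0 := by rw [← bitsVal_encodeNat n, h.1]; rfl
      rw [this, h.2]
      rfl
    · rename_i h
      rw [Nat.size_bit, List.length_cons, ih]
      intro h0
      rw [Nat.bit_eq_zero_iff] at h0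
      rw [h0.1, h0.2] at h
      exact h rfl

theorem PolyTime.bits {x : γ → ℕ} (h : PolyTime eg encodeNat x) :
    PolyTime eg (listEnc encodeBool) fun c => encodeNat (x c) :=
  (h.recode (ea' := fun l : List Bool => l) fun _ => rfl).toList

theorem encodeNat_bitsVal (l : List Bool) : encodeNat (bitsVal l) =
    l.reverse.foldl (fun s b => if s.isEmpty && !b then [] else b :: s) [] := by
  induction l with
  | nil => rfl
  | cons b l ih => rw [bitsVal, encodeNat_bit, ih, List.reverse_cons, List.foldl_append]; rfl

/-- This restores the canonical code: reading from the most significant digit, zeros are dropped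
until the first nonzero digit appears. -/
theorem PolyTime.bitsVal {l : γ → List Bool} (h : PolyTime eg (listEnc encodeBool) l) :
    PolyTime eg encodeNat fun c => bitsVal (l c) := by
  have hstep : PolyTime (prodEnc eg (prodEnc (listEnc encodeBool) encodeBool)) (listEnc encodeBool)
      fun p => if p.2.1.isEmpty && !p.2.2 then [] else p.2.2 :: p.2.1 := by
    have h2 := PolyTime.snd (ea := eg) (eb := prodEnc (listEnc encodeBool) encodeBool)
    exact PolyTime.ite (PolyTime.bool₂ (fun a b => a && !b) h2.left.isEmpty h2.right)
      (PolyTime.const []) (h2.right.cons h2.left)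
  have hlen : ∀ l : List Bool, (l.foldl (fun s b => if s.isEmpty && !b then [] else b :: s)
      []).length ≤ l.length := by
    intro l
    induction l using List.reverseRecOn with
    | nil => simp
    | append_singleton l b ih =>
      rw [List.foldl_append, List.foldl_cons, List.foldl_nil]
      split
      · simp
      · simpa using ih
  have := PolyTime.foldl (f := fun (_ : γ) (s : List Bool) b =>
    if s.isEmpty && !b then [] else b :: s) hstep h.reverse (PolyTime.const []) h.bdd
    fun c l₁ l₂ hl => by
      have h1 : l₁.length ≤ (l c).length := by
        rw [← List.length_reverse (as := l c), hl]; simp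
      have := hlen l₁
      rw [length_listEnc_encodeBool, length_listEnc_encodeBool]
      omega
  exact this.ofList.recode fun c => (encodeNat_bitsVal (l c)).symm

/-- One step of the addition of binary digits: the digits that remain, the carry and the digits of the
sum in reversed order. -/
def addStep (s : List Bool × List Bool × Bool × List Bool) :
    List Bool × List Bool × Bool × List Bool :=
  (s.1.tail, s.2.1.tail, Bool.atLeastTwo (s.1.headD false) (s.2.1.headD false) s.2.2.1,
    xor (xor (s.1.headD false) (s.2.1.headD false)) s.2.2.1 :: s.2.2.2)

theorem bitsVal_tail (l : List Bool) : bitsVal l = (l.headD false).toNat + 2 * bitsVal l.tail := by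
  cases l with
  | nil => rfl
  | cons b l => simp [bitsVal, Nat.bit_val]; omega

/-- The invariant of addition with carry: the digits written, plus the remaining summands and the
carry at the current weight. -/
theorem bitsVal_addStep (s : List Bool × List Bool × Bool × List Bool) :
    bitsVal (addStep s).2.2.2.reverse + 2 ^ (addStep s).2.2.2.length *
      (bitsVal (addStep s).1 + bitsVal (addStep s).2.1 + (addStep s).2.2.1.toNat) =
    bitsVal s.2.2.2.reverse + 2 ^ s.2.2.2.length *
      (bitsVal s.1 + bitsVal s.2.1 + s.2.2.1.toNat) := by
  obtain ⟨x, y, c, o⟩ := s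
  simp only [addStep, List.reverse_cons, bitsVal_append, List.length_reverse, List.length_cons]
  rw [bitsVal_tail x, bitsVal_tail y]
  generalize x.headD false = a
  generalize y.headD false = b
  rw [pow_succ]
  cases a <;> cases b <;> cases c <;> simp [bitsVal, Bool.atLeastTwo] <;> ring

theorem addStep_iterate (x y : List Bool) (i : ℕ) :
    (addStep^[i] (x, y, false, [])).1 = x.drop i ∧
    (addStep^[i] (x, y, false, [])).2.1 = y.drop i ∧
    (addStep^[i] (x, y, false, [])).2.2.2.length = i ∧
    bitsVal (addStep^[i] (x, y, false, [])).2.2.2.reverse + 2 ^ i *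
      (bitsVal (x.drop i) + bitsVal (y.drop i) + (addStep^[i] (x, y, false, [])).2.2.1.toNat) =
    bitsVal x + bitsVal y := by
  induction i with
  | zero => simp [bitsVal]
  | succ i ih =>
    obtain ⟨h1, h2, h3, h4⟩ := ih
    rw [iterate_succ_apply']
    generalize addStep^[i] (x, y, false, []) = s at *
    have h5 := bitsVal_addStep s
    have e1 : (addStep s).1 = x.drop (i + 1) := by
      simp only [addStep, h1, List.tail_drop]
    have e2 : (addStep s).2.1 = y.drop (i + 1) := by
      simp only [addStep, h2, List.tail_drop]
    have e3 : (addStep s).2.2.2.length = i + 1 := by simp [addStep, h3]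
    rw [e1, e2, e3, h1, h2, h3, h4] at h5
    exact ⟨e1, e2, e3, h5⟩

theorem PolyTime.add {x y : γ → ℕ} (hx : PolyTime eg encodeNat x) (hy : PolyTime eg encodeNat y) :
    PolyTime eg encodeNat fun c => x c + y c := by
  have key : ∀ m n : ℕ, Stoq.bitsVal (addStep^[(encodeNat m).length + (encodeNat n).length + 1]
      (encodeNat m, encodeNat n, false, [])).2.2.2.reverse = m + n := by
    intro m n
    obtain ⟨-, -, -, h⟩ := addStep_iterate (encodeNat m) (encodeNat n)
      ((encodeNat m).length + (encodeNat n).length + 1)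
    rw [List.drop_of_length_le (by omega), List.drop_of_length_le (by omega), bitsVal_encodeNat,
      bitsVal_encodeNat] at h
    have h1 := bitsVal_lt (encodeNat m)
    have h2 := bitsVal_lt (encodeNat n)
    rw [bitsVal_encodeNat] at h1 h2
    -- After this many steps both inputs are used up and the sum fits into the digits written, so
    -- the final carry must vanish.
    have h3 : m + n < 2 ^ ((encodeNat m).length + (encodeNat n).length + 1) := by
      have e1 : 2 ^ (encodeNat m).length ≤ 2 ^ ((encodeNat m).length + (encodeNat n).length) :=
        Nat.pow_le_pow_right (by norm_num) (by omega)
      have e2 : 2 ^ (encodeNat n).length ≤ 2 ^ ((encodeNat m).length + (encodeNat n).length) :=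
        Nat.pow_le_pow_right (by norm_num) (by omega)
      rw [pow_succ]
      omega
    generalize addStep^[(encodeNat m).length + (encodeNat n).length + 1]
      (encodeNat m, encodeNat n, false, []) = s at *
    cases hc : s.2.2.1 with
    | false => simpa [hc, Stoq.bitsVal] using h
    | true =>
      simp only [hc, Stoq.bitsVal, Bool.toNat_true] at h
      omega
  have hstep : PolyTime (prodEnc eg (prodEnc (listEnc encodeBool) (prodEnc (listEnc encodeBool)
      (prodEnc encodeBool (listEnc encodeBool))))) (prodEnc (listEnc encodeBool)
      (prodEnc (listEnc encodeBool) (prodEnc encodeBool (listEnc encodeBool))))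
      fun p => addStep p.2 := by
    have h2 := PolyTime.snd (ea := eg) (eb := prodEnc (listEnc encodeBool)
      (prodEnc (listEnc encodeBool) (prodEnc encodeBool (listEnc encodeBool))))
    have ha := h2.left.headD false
    have hb := h2.right.left.headD false
    have hc := h2.right.right.left
    refine h2.left.tail.pair (h2.right.left.tail.pair (PolyTime.pair ?_ (PolyTime.cons ?_
      h2.right.right.right)))
    · exact PolyTime.bool₂ (· || ·) (PolyTime.bool₂ (· || ·) (PolyTime.bool₂ (· && ·) ha hb)
        (PolyTime.bool₂ (· && ·) ha hc)) (PolyTime.bool₂ (· && ·) hb hc)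
    · exact PolyTime.bool₂ xor (PolyTime.bool₂ xor ha hb) hc
  have hn := (hx.bits.length.unary_add hy.bits.length).unary_add (PolyTime.const 1)
  have h1 := PolyTime.iterate (f := fun (_ : γ) s => addStep s) hstep hn
    (hx.bits.pair (hy.bits.pair ((PolyTime.const false).pair (PolyTime.const []))))
    (((hx.bits.bdd.add hy.bits.bdd).add (PolyBdd.const 1)).add
      (hn.bdd_unary.add hn.bdd_unary)) fun c i hi => by
        obtain ⟨e1, e2, e3, -⟩ := addStep_iterate (encodeNat (x c)) (encodeNat (y c)) i
        simp only [length_prodEnc, e1, e2, length_listEnc_encodeBool, e3, List.length_drop]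
        simp only [encodeBool, List.pure_def, List.length_cons, List.length_nil]
        omega
  have h2 := h1.right.right.right.reverse.bitsVal
  simpa only [key] using h2

/-- Horner's scheme from the most significant digit. Each intermediate value is y times a number
formed by leading digits of x, so its size is at most the sum of the two sizes. -/
theorem PolyTime.mul {x y : γ → ℕ} (hx : PolyTime eg encodeNat x) (hy : PolyTime eg encodeNat y) :
    PolyTime eg encodeNat fun c => x c * y c := by
  have hval : ∀ (n : ℕ) (l : List Bool), l.foldl (fun a b => a + a + if b then n else 0) 0 =
      Stoq.bitsVal l.reverse * n := by
    intro n l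
    induction l using List.reverseRecOn with
    | nil => simp [Stoq.bitsVal]
    | append_singleton l b ih =>
      rw [List.foldl_append, List.foldl_cons, List.foldl_nil, ih, List.reverse_append,
        List.reverse_singleton, List.singleton_append, Stoq.bitsVal, Nat.bit_val]
      cases b <;> simp <;> ring
  have hstep : PolyTime (prodEnc eg (prodEnc encodeNat encodeBool)) encodeNat
      fun p => p.2.1 + p.2.1 + if p.2.2 then y p.1 else 0 := by
    have h2 := PolyTime.snd (ea := eg) (eb := prodEnc encodeNat encodeBool)
    exact (h2.left.add h2.left).add (PolyTime.ite h2.right (hy.comp PolyTime.fst)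
      (PolyTime.const 0))
  have h1 := PolyTime.foldl (f := fun c a b => a + a + if b then y c else 0) hstep hx.bits.reverse
    (PolyTime.const 0) (hx.bdd.add hy.bdd) fun c l₁ l₂ hl => by
      have e : encodeNat (x c) = l₂.reverse ++ l₁.reverse := by
        rw [← List.reverse_append, ← hl, List.reverse_reverse]
      have h1 : Stoq.bitsVal l₁.reverse ≤ x c := by
        conv_rhs => rw [← bitsVal_encodeNat (x c), e, bitsVal_append]
        exact (Nat.le_mul_of_pos_left _ (by positivity)).trans (Nat.le_add_left _ _)
      rw [hval, length_encodeNat, length_encodeNat, length_encodeNat, Nat.size_le, pow_add]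
      exact Nat.mul_lt_mul'' (h1.trans_lt (Nat.lt_size_self _)) (Nat.lt_size_self _)
  simp only [hval, List.reverse_reverse, bitsVal_encodeNat] at h1
  exact h1

/-- The exponent is given in unary, which keeps the length of the power polynomial. -/
theorem PolyTime.pow {x k : γ → ℕ} (hx : PolyTime eg encodeNat x)
    (hk : PolyTime eg unaryEncodeNat k) : PolyTime eg encodeNat fun c => x c ^ k c := by
  have hit : ∀ (i n : ℕ), (fun a => a * n)^[i] 1 = n ^ i := by
    intro i n
    induction i with
    | zero => rfl
    | succ i ih => rw [iterate_succ_apply', ih, pow_succ]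
  have h1 := PolyTime.iterate (f := fun c a => a * x c) (PolyTime.snd.mul (hx.comp PolyTime.fst)) hk
    (PolyTime.const 1) ((hk.bdd_unary.mul hx.bdd).add (PolyBdd.const 1)) fun c i hi => by
      rw [hit, length_encodeNat, length_encodeNat, Nat.size_le]
      have h2 : x c ^ i ≤ (2 ^ (x c).size) ^ i := Nat.pow_le_pow_left (Nat.lt_size_self _).le i
      have h3 : (2 ^ (x c).size) ^ i ≤ 2 ^ (k c * (x c).size) := by
        rw [← pow_mul]
        exact Nat.pow_le_pow_right (by norm_num) (by rw [mul_comm]; exact Nat.mul_le_mul_right _ hi)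
      rw [pow_succ]
      have : 0 < 2 ^ (k c * (x c).size) := by positivity
      omega
  simpa only [hit] using h1

end Stoq

namespace Stoq

open Computability Turing Function

variable {γ Γ : Type} [Fintype Γ] {eg : γ → List Γ}

/-! ### Simulation of circuits on strings -/

/-- The code of a list of binary digits. -/
abbrev bitsEnc : List Bool → List (Option Bool) := listEnc encodeBool

/-- The code of a list of indices. -/
abbrev indexEnc : List ℕ → List (Option Bool) := listEnc unaryEncodeNat

theorem length_foldl_of_length_eq {α β : Type} {f : List β → α → List β}
    (h : ∀ r a, (f r a).length = r.length) (l : List α) (r : List β) :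
    (l.foldl f r).length = r.length := by
  induction l generalizing r with
  | nil => rfl
  | cons a l ih => rw [List.foldl_cons, ih, h]

/-- Apply a gate, given by its target followed by its controls, to a string of bits. -/
def applyCtl (r : List Bool) (g : List ℕ) : List Bool :=
  r.set (g.headD 0) (xor (r.getD (g.headD 0) false)
    (g.tail.foldl (fun b c => b && r.getD c false) true))

theorem length_applyCtl (r : List Bool) (g : List ℕ) : (applyCtl r g).length = r.length := by
  simp [applyCtl]

theorem PolyTime.applyCtl {r : γ → List Bool} {g : γ → List ℕ} (hr : PolyTime eg bitsEnc r)
    (hg : PolyTime eg indexEnc g) : PolyTime eg bitsEnc fun c => applyCtl (r c) (g c) := by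
  have h1 := hg.headD 0
  have h2 := PolyTime.foldl (f := fun c b i => b && (r c).getD i false)
    (PolyTime.bool₂ (· && ·) PolyTime.snd.left (PolyTime.getD false PolyTime.snd.right
      (hr.comp PolyTime.fst))) hg.tail (PolyTime.const (eb := encodeBool) true) (PolyBdd.const 1)
      fun _ _ _ _ => le_rfl
  exact PolyTime.set h1 (PolyTime.bool₂ xor (PolyTime.getD false h1 hr) h2) hr

/-- Apply a list of gates to a string of bits. -/
def runGates (gs : List (List ℕ)) (r : List Bool) : List Bool := gs.foldl applyCtl r

theorem length_runGates (gs : List (List ℕ)) (r : List Bool) : (runGates gs r).length = r.length :=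
  length_foldl_of_length_eq length_applyCtl gs r

theorem PolyTime.runGates {gs : γ → List (List ℕ)} {r : γ → List Bool}
    (hg : PolyTime eg (listEnc indexEnc) gs) (hr : PolyTime eg bitsEnc r) :
    PolyTime eg bitsEnc fun c => runGates (gs c) (r c) := by
  refine PolyTime.foldl (f := fun _ => Stoq.applyCtl)
    (PolyTime.snd.left.applyCtl PolyTime.snd.right) hg hr hr.bdd fun c l₁ l₂ _ => ?_
  rw [length_listEnc_encodeBool, length_listEnc_encodeBool,
    length_foldl_of_length_eq length_applyCtl]

/-- One step of the decoding of a list of gates. The state holds the number of indices that are to come,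
the indices of the current gate, and the gates found, the last one first. -/
def parseStep (s : ℕ × List ℕ × List (List ℕ)) (a : ℕ) : ℕ × List ℕ × List (List ℕ) :=
  if s.1 == 0 then (a + 1, [], s.2.2)
  else (s.1 - 1, a :: s.2.1, if s.1 - 1 == 0 then (a :: s.2.1) :: s.2.2 else s.2.2)

/-- The gates described by a list of numbers, the last one first. -/
def parse (l : List ℕ) : List (List ℕ) := (l.foldl parseStep (0, [], [])).2.2

/-- At most one gate is completed per number read, and its code is no longer than that of all
numbers read plus an end marker. The bound is crude, but polynomial, as the fold in `PolyTime.parse`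
needs. -/
theorem length_parse_le (l : List ℕ) :
    (prodEnc unaryEncodeNat (prodEnc indexEnc (listEnc indexEnc))
      (l.foldl parseStep (0, [], []))).length ≤ (l.length + 1) * (3 * (indexEnc l).length + 3) := by
  have hl : l.length ≤ (indexEnc l).length := length_le_listEnc l
  have key : ∀ l : List ℕ, (l.foldl parseStep (0, [], [])).1 ≤ (indexEnc l).length + 1 ∧
      (indexEnc (l.foldl parseStep (0, [], [])).2.1).length ≤ (indexEnc l).length ∧
      (listEnc indexEnc (l.foldl parseStep (0, [], [])).2.2).length ≤
        l.length * ((indexEnc l).length + 1) := by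
    intro l
    induction l using List.reverseRecOn with
    | nil => simp
    | append_singleton l a ih =>
      rw [List.foldl_append, List.foldl_cons, List.foldl_nil]
      generalize l.foldl parseStep (0, [], []) = s at *
      obtain ⟨h1, h2, h3⟩ := ih
      have e : (indexEnc (l ++ [a])).length = (indexEnc l).length + a + 1 := by
        simp [indexEnc, listEnc_append, length_unaryEncodeNat, add_assoc]
      have e' : (indexEnc (a :: s.2.1)).length = a + 1 + (indexEnc s.2.1).length := by
        simp [indexEnc, length_unaryEncodeNat]; omega
      have h4 : l.length * ((indexEnc l).length + 1) ≤
          l.length * ((indexEnc l).length + a + 1 + 1) := Nat.mul_le_mul_left _ (by omega)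
      have h5 : (l.length + 1) * ((indexEnc l).length + a + 1 + 1) =
        l.length * ((indexEnc l).length + a + 1 + 1) + ((indexEnc l).length + a + 1 + 1) := by ring
      rw [e, List.length_append, List.length_singleton, h5]
      unfold parseStep
      split
      · refine ⟨by simp; omega, by simp, by simp only; omega⟩
      · refine ⟨by simp; omega, by rw [e']; omega, ?_⟩
        simp only
        split
        · rw [listEnc_cons, List.length_append, List.length_map, List.length_cons, e']
          omega
        · omega
  obtain ⟨h1, h2, h3⟩ := key l
  rw [length_prodEnc, length_prodEnc, length_unaryEncodeNat]
  have : (l.length + 1) * (3 * (indexEnc l).length + 3) =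
    l.length * ((indexEnc l).length + 1) + (2 * (l.length * (indexEnc l).length) + 2 * l.length) +
      (3 * (indexEnc l).length + 3) := by ring
  omega

theorem PolyTime.parse {l : γ → List ℕ} (hl : PolyTime eg indexEnc l) :
    PolyTime eg (listEnc indexEnc) fun c => parse (l c) := by
  have hstep : PolyTime (prodEnc eg (prodEnc (prodEnc unaryEncodeNat
      (prodEnc indexEnc (listEnc indexEnc))) unaryEncodeNat)) (prodEnc unaryEncodeNat
      (prodEnc indexEnc (listEnc indexEnc))) fun p => parseStep p.2.1 p.2.2 := by
    have h2 := PolyTime.snd (ea := eg) (eb := prodEnc (prodEnc unaryEncodeNat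
      (prodEnc indexEnc (listEnc indexEnc))) unaryEncodeNat)
    have hcur := h2.right.cons h2.left.right.left
    exact PolyTime.ite h2.left.left.unary_isZero
      ((h2.right.unary_add (PolyTime.const 1)).pair ((PolyTime.const []).pair h2.left.right.right))
      (h2.left.left.unary_pred.pair (hcur.pair (PolyTime.ite h2.left.left.unary_pred.unary_isZero
        (hcur.cons h2.left.right.right) h2.left.right.right)))
  have h1 := PolyTime.foldl (f := fun (_ : γ) => parseStep) hstep hl (PolyTime.const (0, [], []))
    ((hl.bdd.add (PolyBdd.const 1)).mul (((PolyBdd.const 3).mul hl.bdd).add (PolyBdd.const 3)))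
    fun c l₁ l₂ h => by
      refine (length_parse_le l₁).trans ?_
      have e : (indexEnc (l c)).length = (indexEnc l₁).length + (indexEnc l₂).length := by
        rw [h, indexEnc, listEnc_append, List.length_append]
      have h3 : l₁.length ≤ (indexEnc l₁).length := length_le_listEnc l₁
      exact Nat.mul_le_mul (by omega) (by omega)
  exact h1.right.right

/-- The second list is consumed in step with the first; equality requires matching symbols
throughout and nothing left over. -/
theorem PolyTime.beq {l l' : γ → List Bool} (hl : PolyTime eg bitsEnc l)
    (hl' : PolyTime eg bitsEnc l') : PolyTime eg encodeBool fun c => l c == l' c := by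
  let f : Bool × List Bool → Bool → Bool × List Bool := fun s a =>
    (s.1 && (!s.2.isEmpty && (s.2.headD false == a)), s.2.tail)
  have hf : ∀ (l l' : List Bool) (b : Bool), (l.foldl f (b, l')).2 = l'.drop l.length ∧
      ((l.foldl f (b, l')).1 && (l'.drop l.length).isEmpty) = (b && l == l') := by
    intro l
    induction l with
    | nil =>
      intro l' b
      cases l' <;> simp
    | cons a l ih =>
      intro l' b
      rw [List.foldl_cons]
      rcases l' with _ | ⟨a', l'⟩
      · have h1 := ih [] false
        have e : f (b, []) a = (false, []) := by simp [f]
        rw [e]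
        simp at h1 ⊢
        exact h1
      · have h1 := ih l' (b && (a' == a))
        have e : f (b, a' :: l') a = (b && (a' == a), l') := by simp [f]
        rw [e]
        refine ⟨by simpa using h1.1, ?_⟩
        rw [List.length_cons, List.drop_succ_cons, h1.2, List.cons_beq_cons]
        cases b <;> cases a <;> cases a' <;> simp
  have h2 := PolyTime.snd (ea := eg) (eb := prodEnc (prodEnc encodeBool bitsEnc) encodeBool)
  have hstep : PolyTime (prodEnc eg (prodEnc (prodEnc encodeBool bitsEnc) encodeBool))
      (prodEnc encodeBool bitsEnc) fun p => f p.2.1 p.2.2 :=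
    (PolyTime.bool₂ (· && ·) h2.left.left (PolyTime.bool₂ (· && ·) h2.left.right.isEmpty.not
      (PolyTime.bool₂ (· == ·) (h2.left.right.headD false) h2.right))).pair h2.left.right.tail
  have h3 := PolyTime.foldl (f := fun (_ : γ) => f) hstep hl ((PolyTime.const true).pair hl')
    ((PolyBdd.const 1).add hl'.bdd) fun c l₁ l₂ _ => by
      rw [length_prodEnc, (hf _ _ _).1, length_listEnc_encodeBool, length_listEnc_encodeBool,
        List.length_drop]
      simp only [encodeBool, List.pure_def, List.length_cons, List.length_nil]
      omega
  have h4 := PolyTime.bool₂ (· && ·) h3.left (PolyTime.drop hl.length hl').isEmpty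
  simp only [(hf _ _ _).2, Bool.true_and] at h4
  exact h4

/-! ### The counted predicate -/

/-- The register after one round: load the input `x`, the witness bits `w`, zeros and the bits of the
block `v` but the first one, apply the circuit, flip the first bit if the first bit of `v` is set, and
undo the circuit. The list `gs` holds the gates in reversed order. -/
def roundReg (gs : List (List ℕ)) (n0 : ℕ) (x w v : List Bool) : List Bool :=
  runGates gs ((runGates gs.reverse (x ++ (w ++ (List.replicate n0 false ++ v.tail)))).set 0
    (xor ((runGates gs.reverse (x ++ (w ++ (List.replicate n0 false ++ v.tail)))).getD 0 false)
      (v.headD false)))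

/-- The witness bits after one round. -/
def roundWit (gs : List (List ℕ)) (nw n0 : ℕ) (x w v : List Bool) : List Bool :=
  ((roundReg gs n0 x w v).drop x.length).take nw

/-- The round restores the input bits and the zeros. -/
def roundOk (gs : List (List ℕ)) (nw n0 : ℕ) (x w v : List Bool) : Bool :=
  (roundReg gs n0 x w v).take (x.length + (nw + n0)) ==
    x ++ (roundWit gs nw n0 x w v ++ List.replicate n0 false)

/-- One round: the state holds a flag, the witness bits and the blocks that are left, each of `D` bits. -/
def round (gs : List (List ℕ)) (nw n0 D : ℕ) (x : List Bool) (s : Bool × List Bool × List Bool) :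
    Bool × List Bool × List Bool :=
  (s.1 && roundOk gs nw n0 x s.2.1 (s.2.2.take D), roundWit gs nw n0 x s.2.1 (s.2.2.take D),
    s.2.2.drop D)

/-- The predicate that is counted: `k` rounds succeed. -/
def accepts (gs : List (List ℕ)) (nw n0 D k : ℕ) (x y : List Bool) : Bool :=
  ((round gs nw n0 D x)^[k] (true, (y.take D).take nw, y.drop D)).1

theorem PolyTime.roundReg {gs : γ → List (List ℕ)} {n0 : γ → ℕ} {x w v : γ → List Bool}
    (hg : PolyTime eg (listEnc indexEnc) gs) (h0 : PolyTime eg unaryEncodeNat n0)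
    (hx : PolyTime eg bitsEnc x) (hw : PolyTime eg bitsEnc w) (hv : PolyTime eg bitsEnc v) :
    PolyTime eg bitsEnc fun c => roundReg (gs c) (n0 c) (x c) (w c) (v c) := by
  have h1 := hg.reverse.runGates (hx.append (hw.append ((PolyTime.replicate false h0).append hv.tail)))
  exact hg.runGates (PolyTime.set (PolyTime.const 0)
    (PolyTime.bool₂ xor (PolyTime.getD false (PolyTime.const 0) h1) (hv.headD false)) h1)

theorem PolyTime.roundWit {gs : γ → List (List ℕ)} {nw n0 : γ → ℕ} {x w v : γ → List Bool}
    (hg : PolyTime eg (listEnc indexEnc) gs) (hn : PolyTime eg unaryEncodeNat nw)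
    (h0 : PolyTime eg unaryEncodeNat n0) (hx : PolyTime eg bitsEnc x) (hw : PolyTime eg bitsEnc w)
    (hv : PolyTime eg bitsEnc v) :
    PolyTime eg bitsEnc fun c => roundWit (gs c) (nw c) (n0 c) (x c) (w c) (v c) :=
  PolyTime.take hn (PolyTime.drop hx.length (PolyTime.roundReg hg h0 hx hw hv))

theorem PolyTime.roundOk {gs : γ → List (List ℕ)} {nw n0 : γ → ℕ} {x w v : γ → List Bool}
    (hg : PolyTime eg (listEnc indexEnc) gs) (hn : PolyTime eg unaryEncodeNat nw)
    (h0 : PolyTime eg unaryEncodeNat n0) (hx : PolyTime eg bitsEnc x) (hw : PolyTime eg bitsEnc w)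
    (hv : PolyTime eg bitsEnc v) :
    PolyTime eg encodeBool fun c => roundOk (gs c) (nw c) (n0 c) (x c) (w c) (v c) :=
  (PolyTime.take (hx.length.unary_add (hn.unary_add h0)) (PolyTime.roundReg hg h0 hx hw hv)).beq
    (hx.append ((PolyTime.roundWit hg hn h0 hx hw hv).append (PolyTime.replicate false h0)))

theorem PolyTime.accepts {gs : γ → List (List ℕ)} {nw n0 D k : γ → ℕ} {x y : γ → List Bool}
    (hg : PolyTime eg (listEnc indexEnc) gs) (hn : PolyTime eg unaryEncodeNat nw)
    (h0 : PolyTime eg unaryEncodeNat n0) (hD : PolyTime eg unaryEncodeNat D)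
    (hk : PolyTime eg unaryEncodeNat k) (hx : PolyTime eg bitsEnc x) (hy : PolyTime eg bitsEnc y) :
    PolyTime eg encodeBool fun c => accepts (gs c) (nw c) (n0 c) (D c) (k c) (x c) (y c) := by
  have hstep : PolyTime (prodEnc eg (prodEnc encodeBool (prodEnc bitsEnc bitsEnc)))
      (prodEnc encodeBool (prodEnc bitsEnc bitsEnc))
      fun p => round (gs p.1) (nw p.1) (n0 p.1) (D p.1) (x p.1) p.2 := by
    have h1 := PolyTime.fst (ea := eg) (eb := prodEnc encodeBool (prodEnc bitsEnc bitsEnc))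
    have h2 := PolyTime.snd (ea := eg) (eb := prodEnc encodeBool (prodEnc bitsEnc bitsEnc))
    have hv := PolyTime.take (hD.comp h1) h2.right.right
    exact (PolyTime.bool₂ (· && ·) h2.left (PolyTime.roundOk (hg.comp h1) (hn.comp h1) (h0.comp h1)
      (hx.comp h1) h2.right.left hv)).pair ((PolyTime.roundWit (hg.comp h1) (hn.comp h1)
      (h0.comp h1) (hx.comp h1) h2.right.left hv).pair (PolyTime.drop (hD.comp h1) h2.right.right))
  have h1 := PolyTime.iterate (f := fun c => round (gs c) (nw c) (n0 c) (D c) (x c)) hstep hk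
    ((PolyTime.const true).pair ((PolyTime.take hn (PolyTime.take hD hy)).pair (PolyTime.drop hD hy)))
    (((PolyBdd.const 1).add (hn.bdd_unary.add hn.bdd_unary)).add hy.bdd) fun c i _ => by
      -- The states stay short: a round cuts the witness to `nw` bits and only removes symbols from
      -- the remaining blocks.
      have key : ∀ i, ((round (gs c) (nw c) (n0 c) (D c) (x c))^[i]
          (true, ((y c).take (D c)).take (nw c), (y c).drop (D c))).2.1.length ≤ nw c ∧
          ((round (gs c) (nw c) (n0 c) (D c) (x c))^[i]
          (true, ((y c).take (D c)).take (nw c), (y c).drop (D c))).2.2.length ≤ (y c).length := by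
        intro i
        induction i with
        | zero => simp
        | succ i ih =>
          rw [iterate_succ_apply']
          refine ⟨by simp [round, Stoq.roundWit], ?_⟩
          simp only [round, List.length_drop]
          omega
      obtain ⟨h1, h2⟩ := key i
      rw [length_prodEnc, length_prodEnc, length_listEnc_encodeBool, length_listEnc_encodeBool,
        length_listEnc_encodeBool]
      simp only [encodeBool, List.pure_def, List.length_cons, List.length_nil]
      omega
  exact h1.left

end Stoq

namespace Stoq

open Matrix

/-! ### Powers of non-negative positive semidefinite matrices -/

section Powers

variable {ι : Type} [Fintype ι] [DecidableEq ι] {A : Matrix ι ι ℝ}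

theorem sq_dotProduct_le (u v : ι → ℝ) : (u ⬝ᵥ v) ^ 2 ≤ (u ⬝ᵥ u) * (v ⬝ᵥ v) := by
  have := Finset.sum_mul_sq_le_sq_mul_sq Finset.univ u v
  simpa [dotProduct, sq] using this

-- Cauchy–Schwarz for the form of A: with A = BᵀB it is the ordinary inequality for Bu and Bv.
open scoped MatrixOrder in
theorem _root_.Matrix.PosSemidef.sq_le_mul (hA : A.PosSemidef) (u v : ι → ℝ) :
    (u ⬝ᵥ A *ᵥ v) ^ 2 ≤ (u ⬝ᵥ A *ᵥ u) * (v ⬝ᵥ A *ᵥ v) := by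
  obtain ⟨B, rfl⟩ := CStarAlgebra.nonneg_iff_eq_star_mul_self.mp hA.nonneg
  have h : ∀ u v : ι → ℝ, u ⬝ᵥ (star B * B) *ᵥ v = (B *ᵥ u) ⬝ᵥ (B *ᵥ v) := by
    intro u v
    rw [← mulVec_mulVec, dotProduct_mulVec, star_eq_conjTranspose, conjTranspose_eq_transpose_of_trivial, vecMul_transpose]
  rw [h, h, h]
  exact sq_dotProduct_le _ _

theorem dotProduct_mulVec_nonneg (hA : A.PosSemidef) (u : ι → ℝ) : 0 ≤ u ⬝ᵥ A *ᵥ u := by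
  simpa using hA.dotProduct_mulVec_nonneg u

theorem pow_apply_nonneg (hA : ∀ i j, 0 ≤ A i j) (k : ℕ) (i j : ι) : 0 ≤ (A ^ k) i j := by
  induction k generalizing i j with
  | zero => rw [pow_zero, one_apply]; split <;> norm_num
  | succ k ih => rw [pow_succ, mul_apply]; exact Finset.sum_nonneg fun l _ => mul_nonneg (ih _ _) (hA _ _)

theorem dotProduct_mulVec_mono (hA : ∀ i j, 0 ≤ A i j) {u v : ι → ℝ} (hu : 0 ≤ u) (h : u ≤ v) :
    u ⬝ᵥ A *ᵥ u ≤ v ⬝ᵥ A *ᵥ v := by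
  refine Finset.sum_le_sum fun i _ => mul_le_mul (h i) ?_ ?_ ((hu i).trans (h i))
  · exact Finset.sum_le_sum fun j _ => mul_le_mul_of_nonneg_left (h j) (hA i j)
  · exact Finset.sum_nonneg fun j _ => mul_nonneg (hA i j) (hu j)

/-- The moments m_k = ⟨φ, A^k φ⟩ are log-convex, by Cauchy–Schwarz for the form A^k at φ and Aφ. So
the ratios m_(k+1)/m_k never decrease, and the first one is at least ε. Since 0 ≤ φ ≤ 1 and A^k has
non-negative entries, replacing φ by the all-ones vector only enlarges the form. -/
theorem pow_le_sum_pow (hA : A.PosSemidef) (hA₀ : ∀ i j, 0 ≤ A i j) {φ : ι → ℝ} (hφ : 0 ≤ φ)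
    (hφ₁ : φ ⬝ᵥ φ = 1) {ε : ℝ} (hε : 0 < ε) (h : ε ≤ φ ⬝ᵥ A *ᵥ φ) (k : ℕ) :
    ε ^ k ≤ (1 : ι → ℝ) ⬝ᵥ (A ^ k) *ᵥ 1 := by
  have hle : φ ≤ 1 := by
    intro i
    have h1 : φ i * φ i ≤ φ ⬝ᵥ φ :=
      Finset.single_le_sum (f := fun i => φ i * φ i) (fun j _ => mul_self_nonneg _) (Finset.mem_univ i)
    have h2 : (0 : ℝ) ≤ φ i := hφ i
    rw [hφ₁] at h1
    simp only [Pi.one_apply]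
    nlinarith
  refine le_trans ?_ (dotProduct_mulVec_mono (pow_apply_nonneg hA₀ k) hφ hle)
  have hconv : ∀ k, (φ ⬝ᵥ (A ^ (k + 1)) *ᵥ φ) ^ 2 ≤
      (φ ⬝ᵥ (A ^ k) *ᵥ φ) * (φ ⬝ᵥ (A ^ (k + 2)) *ᵥ φ) := by
    intro k
    have h1 := (hA.pow k).sq_le_mul φ (A *ᵥ φ)
    have e1 : (A ^ k) *ᵥ (A *ᵥ φ) = (A ^ (k + 1)) *ᵥ φ := by rw [mulVec_mulVec, pow_succ]
    have e2 : (A *ᵥ φ) ⬝ᵥ (A ^ (k + 1)) *ᵥ φ = φ ⬝ᵥ (A ^ (k + 2)) *ᵥ φ := by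
      have hs : Aᵀ = A := by
        rw [← conjTranspose_eq_transpose_of_trivial]; exact hA.isHermitian
      rw [pow_succ' A (k + 1), ← mulVec_mulVec, dotProduct_mulVec φ A, ← mulVec_transpose, hs]
    rwa [e1, e2] at h1
  have key : ∀ k, ε ^ k ≤ φ ⬝ᵥ (A ^ k) *ᵥ φ ∧
      ε * (φ ⬝ᵥ (A ^ k) *ᵥ φ) ≤ φ ⬝ᵥ (A ^ (k + 1)) *ᵥ φ := by
    intro k
    induction k with
    | zero => simp [hφ₁, h]
    | succ k ih =>
      obtain ⟨h1, h2⟩ := ih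
      have h3 : ε ^ (k + 1) ≤ φ ⬝ᵥ (A ^ (k + 1)) *ᵥ φ := by
        rw [pow_succ']
        exact (mul_le_mul_of_nonneg_left h1 hε.le).trans h2
      refine ⟨h3, ?_⟩
      have h4 : 0 < φ ⬝ᵥ (A ^ k) *ᵥ φ := (pow_pos hε k).trans_le h1
      have h5 : 0 < φ ⬝ᵥ (A ^ (k + 1)) *ᵥ φ := (pow_pos hε _).trans_le h3
      have h6 := hconv k
      refine le_of_mul_le_mul_left ?_ h4
      calc _ = (ε * (φ ⬝ᵥ (A ^ k) *ᵥ φ)) * (φ ⬝ᵥ (A ^ (k + 1)) *ᵥ φ) := by ring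
        _ ≤ (φ ⬝ᵥ (A ^ (k + 1)) *ᵥ φ) * (φ ⬝ᵥ (A ^ (k + 1)) *ᵥ φ) :=
          mul_le_mul_of_nonneg_right h2 h5.le
        _ ≤ _ := by rw [← sq]; exact h6
  exact (key k).1

/-- Cauchy–Schwarz for the form of A at u and Au gives |Au|⁴ ≤ ε²|u|²|Au|², so |Au| ≤ ε|u|.
Iterating from the all-ones vector, whose squared norm is the cardinality, and applying ordinary
Cauchy–Schwarz gives the bound without any spectral decomposition. -/
theorem sum_pow_le (hA : A.PosSemidef) {ε : ℝ} (hε : 0 ≤ ε)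
    (h : ∀ u : ι → ℝ, u ⬝ᵥ A *ᵥ u ≤ ε * (u ⬝ᵥ u)) (k : ℕ) :
    (1 : ι → ℝ) ⬝ᵥ (A ^ k) *ᵥ 1 ≤ ε ^ k * Fintype.card ι := by
  have hn : ∀ u : ι → ℝ, 0 ≤ u ⬝ᵥ u := fun u => Finset.sum_nonneg fun i _ => mul_self_nonneg _
  have hs : Aᵀ = A := by
    rw [← conjTranspose_eq_transpose_of_trivial]; exact hA.isHermitian
  have hstep : ∀ u : ι → ℝ, (A *ᵥ u) ⬝ᵥ (A *ᵥ u) ≤ ε ^ 2 * (u ⬝ᵥ u) := by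
    intro u
    have h1 := hA.sq_le_mul u (A *ᵥ u)
    have e : u ⬝ᵥ A *ᵥ (A *ᵥ u) = (A *ᵥ u) ⬝ᵥ (A *ᵥ u) := by
      rw [dotProduct_mulVec u A, ← mulVec_transpose, hs]
    rw [e] at h1
    have h2 := mul_le_mul (h u) (h (A *ᵥ u)) (dotProduct_mulVec_nonneg hA _)
      (mul_nonneg hε (hn u))
    rcases (hn (A *ᵥ u)).eq_or_lt with h0 | h0
    · rw [← h0]
      exact mul_nonneg (sq_nonneg _) (hn u)
    · refine le_of_mul_le_mul_right ?_ h0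
      nlinarith
  have hpow : ∀ k, ((A ^ k) *ᵥ 1) ⬝ᵥ ((A ^ k) *ᵥ 1) ≤ (ε ^ k) ^ 2 * ((1 : ι → ℝ) ⬝ᵥ 1) := by
    intro k
    induction k with
    | zero => simp
    | succ k ih =>
      rw [pow_succ' A, ← mulVec_mulVec]
      refine (hstep _).trans ?_
      calc _ ≤ ε ^ 2 * ((ε ^ k) ^ 2 * ((1 : ι → ℝ) ⬝ᵥ 1)) :=
            mul_le_mul_of_nonneg_left ih (sq_nonneg _)
        _ = _ := by ring
  have hcard : (1 : ι → ℝ) ⬝ᵥ 1 = Fintype.card ι := by simp [dotProduct]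
  refine abs_le_of_sq_le_sq' ?_ (by positivity) |>.2
  calc _ ≤ _ := sq_dotProduct_le _ _
    _ ≤ (1 : ι → ℝ) ⬝ᵥ 1 * ((ε ^ k) ^ 2 * ((1 : ι → ℝ) ⬝ᵥ 1)) :=
      mul_le_mul_of_nonneg_left (hpow k) (hn 1)
    _ = _ := by rw [hcard]; ring

end Powers

end Stoq

namespace Stoq

open Matrix

/-! ### Circuits as permutations of basis labels -/

section Circuits

variable {N : ℕ}

theorem Gate.apply_apply (g : Gate N) (b : Fin N → Bool) : g.apply (g.apply b) = b := by
  cases g with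
  | X t => simp [Gate.apply]
  | CNOT c t h => simp [Gate.apply, Function.update_of_ne h]
  | Toffoli c₁ c₂ t h h₁ h₂ =>
    simp [Gate.apply, Function.update_of_ne h₁, Function.update_of_ne h₂]

/-- The action of a circuit on basis labels. -/
def runLabels (gs : List (Gate N)) (b : Fin N → Bool) : Fin N → Bool :=
  gs.foldl (fun b g => g.apply b) b

theorem runLabels_cons (g : Gate N) (gs : List (Gate N)) (b : Fin N → Bool) :
    runLabels (g :: gs) b = runLabels gs (g.apply b) := rfl

theorem runLabels_append (gs gs' : List (Gate N)) (b : Fin N → Bool) :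
    runLabels (gs ++ gs') b = runLabels gs' (runLabels gs b) := List.foldl_append

theorem runLabels_reverse (gs : List (Gate N)) (b : Fin N → Bool) :
    runLabels gs.reverse (runLabels gs b) = b := by
  induction gs generalizing b with
  | nil => rfl
  | cons g gs ih =>
    rw [runLabels_cons, List.reverse_cons, runLabels_append, ih]
    exact g.apply_apply b

theorem eq_runLabels_reverse {gs : List (Gate N)} {b b' : Fin N → Bool} :
    b' = runLabels gs b ↔ b = runLabels gs.reverse b' := by
  constructor
  · rintro rfl
    exact (runLabels_reverse gs b).symm
  · rintro rfl
    have := runLabels_reverse gs.reverse b'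
    rw [List.reverse_reverse] at this
    exact this.symm

theorem circuitMatrix_apply (gs : List (Gate N)) (b' b : Fin N → Bool) :
    circuitMatrix gs b' b = if b' = runLabels gs b then 1 else 0 := by
  induction gs generalizing b with
  | nil =>
    simp only [circuitMatrix, runLabels, one_apply, List.foldl_nil]
    congr
  | cons g gs ih =>
    rw [circuitMatrix, mul_apply]
    simp only [ih, Gate.matrix, runLabels_cons, of_apply, mul_ite, mul_one, mul_zero,
      Finset.sum_ite_eq', Finset.mem_univ, if_true]
    congr

theorem circuitMatrix_append (gs gs' : List (Gate N)) :
    circuitMatrix (gs ++ gs') = circuitMatrix gs' * circuitMatrix gs := by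
  induction gs with
  | nil => simp [circuitMatrix]
  | cons g gs ih => rw [List.cons_append, circuitMatrix, ih, circuitMatrix, Matrix.mul_assoc]

theorem circuitMatrix_conjTranspose (gs : List (Gate N)) :
    (circuitMatrix gs)ᴴ = circuitMatrix gs.reverse := by
  ext b' b
  rw [conjTranspose_apply, circuitMatrix_apply, circuitMatrix_apply]
  simp only [eq_runLabels_reverse (b := b') (b' := b)]
  split <;> simp

theorem circuitMatrix_reverse_mul (gs : List (Gate N)) :
    circuitMatrix gs.reverse * circuitMatrix gs = 1 := by
  rw [← circuitMatrix_append]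
  ext b' b
  rw [circuitMatrix_apply, runLabels_append, runLabels_reverse, one_apply]

end Circuits

/-! ### The acceptance probability as a quadratic form -/

namespace StoqVerifier

variable {n : ℕ} (V : StoqVerifier n)

/-- Apply the circuit, flip the first qubit, and undo the circuit. -/
def conjFlip : List (Gate V.qubits) :=
  V.gates ++ .X ⟨0, V.pos⟩ :: V.gates.reverse

theorem reverse_conjFlip : V.conjFlip.reverse = V.conjFlip := by
  simp [conjFlip]

/-- This is |+⟩⟨+| = (1 + X)/2: two labels agree off the first qubit exactly if they are equal or
differ by flipping it. -/
theorem outProjector_eq :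
    V.outProjector = (1 / 2 : ℂ) • (1 + circuitMatrix [.X ⟨0, V.pos⟩]) := by
  ext b' b
  rw [Matrix.smul_apply, Matrix.add_apply, circuitMatrix_apply, one_apply, outProjector, of_apply]
  have h1 : runLabels [.X ⟨0, V.pos⟩] b =
    Function.update b ⟨0, V.pos⟩ (!b ⟨0, V.pos⟩) := rfl
  have h2 : (∀ i, i ≠ (⟨0, V.pos⟩ : Fin V.qubits) → b' i = b i) ↔
      b' = b ∨ b' = Function.update b ⟨0, V.pos⟩ (!b ⟨0, V.pos⟩) := by
    constructor
    · intro h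
      by_cases h0 : b' ⟨0, V.pos⟩ = b ⟨0, V.pos⟩
      · left
        funext i
        by_cases hi : i = ⟨0, V.pos⟩
        · rw [hi, h0]
        · exact h i hi
      · right
        funext i
        by_cases hi : i = ⟨0, V.pos⟩
        · rw [hi, Function.update_self]
          exact Bool.eq_not_of_ne h0
        · rw [Function.update_of_ne hi]
          exact h i hi
    · rintro (rfl | rfl) i hi
      · rfl
      · rw [Function.update_of_ne hi]
  have h3 : b ≠ Function.update b ⟨0, V.pos⟩ (!b ⟨0, V.pos⟩) := by
    intro h
    have := congrFun h ⟨0, V.pos⟩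
    simp at this
  rw [h1]
  simp only [h2]
  by_cases hb : b' = b
  · subst hb
    simp [h3]
  · simp [hb]

/-- Gates are involutions, so U† is the reversed circuit and U†X₁U is again a circuit, whose gate
list is a palindrome. -/
theorem conj_outProjector :
    (circuitMatrix V.gates)ᴴ * V.outProjector * circuitMatrix V.gates =
      (1 / 2 : ℂ) • (1 + circuitMatrix V.conjFlip) := by
  rw [outProjector_eq, circuitMatrix_conjTranspose, conjFlip, circuitMatrix_append, circuitMatrix,
    Matrix.mul_smul, Matrix.smul_mul, Matrix.mul_add, Matrix.add_mul, Matrix.mul_one,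
    circuitMatrix_reverse_mul]
  simp [circuitMatrix, Matrix.mul_assoc]

/-- A basis label carries the input `x`, the witness `w` and zeros. -/
def Loaded (x : Fin n → Bool) (w : Fin V.nw → Bool) (b : Fin V.qubits → Bool) : Prop :=
  V.inputPart b = x ∧ V.witnessPart b = w ∧ V.zeroPart b = fun _ => false

instance (x : Fin n → Bool) (w : Fin V.nw → Bool) : DecidablePred (V.Loaded x w) :=
  fun _ => inferInstanceAs (Decidable (_ ∧ _ ∧ _))

/-- The isometry that prepares the initial state. -/
noncomputable def loadMatrix (x : Fin n → Bool) :
    Matrix (Fin V.qubits → Bool) (Fin V.nw → Bool) ℝ :=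
  of fun b w => if V.Loaded x w b then (1 / √2) ^ V.np else 0

/-- The conjugated output projector. -/
noncomputable def realProjector : Matrix (Fin V.qubits → Bool) (Fin V.qubits → Bool) ℝ :=
  of fun b' b => ((if b' = b then 1 else 0) + if b = runLabels V.conjFlip b' then 1 else 0) / 2

/-- The matrix of the quadratic form that gives the acceptance probability. -/
noncomputable def acceptMatrix (x : Fin n → Bool) : Matrix (Fin V.nw → Bool) (Fin V.nw → Bool) ℝ :=
  (V.loadMatrix x)ᵀ * V.realProjector * V.loadMatrix x

theorem realProjector_transpose : V.realProjectorᵀ = V.realProjector := by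
  ext b' b
  simp only [transpose_apply, realProjector, of_apply]
  have h : b' = runLabels V.conjFlip b ↔ b = runLabels V.conjFlip b' := by
    rw [eq_runLabels_reverse, reverse_conjFlip]
  simp only [h, eq_comm (a := b) (b := b')]

theorem realProjector_mul_self : V.realProjector * V.realProjector = V.realProjector := by
  have hT : ∀ b, runLabels V.conjFlip (runLabels V.conjFlip b) = b := by
    intro b
    have := runLabels_reverse V.conjFlip b
    rwa [reverse_conjFlip] at this
  ext b' b
  rw [mul_apply]
  simp only [realProjector, of_apply, add_div, add_mul, Finset.sum_add_distrib, ite_div, zero_div,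
    ite_mul, zero_mul, Finset.sum_ite_eq, Finset.sum_ite_eq', Finset.mem_univ, if_true, hT,
    eq_comm (a := b) (b := b')]
  have h : runLabels V.conjFlip b' = b ↔ b = runLabels V.conjFlip b' := eq_comm
  simp only [h]
  split_ifs <;> norm_num

/-- The projector K is symmetric and idempotent, so JᵀKJ = (KJ)ᵀ(KJ). -/
theorem posSemidef_acceptMatrix (x : Fin n → Bool) : (V.acceptMatrix x).PosSemidef := by
  have h : V.acceptMatrix x =
      (V.realProjector * V.loadMatrix x)ᴴ * (V.realProjector * V.loadMatrix x) := by
    rw [conjTranspose_eq_transpose_of_trivial, transpose_mul, realProjector_transpose,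
      Matrix.mul_assoc, ← Matrix.mul_assoc V.realProjector, realProjector_mul_self, acceptMatrix,
      Matrix.mul_assoc]
  rw [h]
  exact posSemidef_conjTranspose_mul_self _

theorem acceptMatrix_nonneg (x : Fin n → Bool) (w w' : Fin V.nw → Bool) :
    0 ≤ V.acceptMatrix x w w' := by
  rw [acceptMatrix, mul_apply]
  have hJ : ∀ b w, 0 ≤ V.loadMatrix x b w := by
    intro b w
    rw [loadMatrix, of_apply]
    split
    · positivity
    · rfl
  have hK : ∀ b' b, 0 ≤ V.realProjector b' b := by
    intro b' b
    rw [realProjector, of_apply]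
    split_ifs <;> norm_num
  refine Finset.sum_nonneg fun b _ => mul_nonneg ?_ (hJ _ _)
  rw [mul_apply]
  exact Finset.sum_nonneg fun b _ => mul_nonneg (hJ _ _) (hK _ _)

/-- The bridge to counting. The two preparations contribute the constant amplitude 2^(-n₊/2) each
and the projector contributes 1/2. The summands stem from the identity and from the permutation in
K; the image label is not constrained on the |+⟩ ancillas. -/
theorem acceptMatrix_apply (x : Fin n → Bool) (w w' : Fin V.nw → Bool) :
    V.acceptMatrix x w w' * 2 ^ (V.np + 1) =
      (Finset.univ.filter fun b => V.Loaded x w b ∧ V.Loaded x w' b).card +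
      (Finset.univ.filter fun b =>
        V.Loaded x w b ∧ V.Loaded x w' (runLabels V.conjFlip b)).card := by
  have hc : ((1 / √2) ^ V.np * (1 / √2) ^ V.np : ℝ) * 2 ^ V.np = 1 := by
    rw [← mul_pow, ← mul_pow]
    have : (1 / √2 * (1 / √2) * 2 : ℝ) = 1 := by
      field_simp
      norm_num
    rw [this, one_pow]
  rw [acceptMatrix, Matrix.mul_assoc, mul_apply]
  have h1 : ∀ b, (V.realProjector * V.loadMatrix x) b w' =
      (V.loadMatrix x b w' + V.loadMatrix x (runLabels V.conjFlip b) w') / 2 := by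
    intro b
    rw [mul_apply]
    simp only [realProjector, of_apply, add_div, add_mul, Finset.sum_add_distrib, ite_div, zero_div,
      ite_mul, zero_mul, Finset.sum_ite_eq, Finset.sum_ite_eq', Finset.mem_univ, if_true]
    ring
  rw [Finset.card_filter, Finset.card_filter]
  push_cast
  rw [← Finset.sum_add_distrib, Finset.sum_mul]
  refine Finset.sum_congr rfl fun b _ => ?_
  rw [h1]
  simp only [transpose_apply, loadMatrix, of_apply, pow_succ]
  by_cases h2 : V.Loaded x w b <;> by_cases h3 : V.Loaded x w' b <;>
    by_cases h4 : V.Loaded x w' (runLabels V.conjFlip b) <;> simp only [h2, h3, h4, if_true, if_false,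
    and_true, and_false, and_self] <;> linarith

theorem acceptProb_eq (x : Fin n → Bool) (ψ : (Fin V.nw → Bool) → ℂ) :
    V.acceptProb x ψ = (star ψ ⬝ᵥ ((V.acceptMatrix x).map Complex.ofReal) *ᵥ ψ).re := by
  have hi : V.initialState x ψ = ((V.loadMatrix x).map Complex.ofReal) *ᵥ ψ := by
    funext b
    rw [initialState, mulVec, dotProduct, Finset.sum_eq_single (V.witnessPart b)]
    · rw [map_apply, loadMatrix, of_apply]
      by_cases h1 : V.inputPart b = x <;> by_cases h2 : V.zeroPart b = fun _ => false <;>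
        simp [Loaded, h1, h2, mul_comm]
    · intro w _ hw
      simp [loadMatrix, Loaded, hw.symm]
    · simp
  have hp : (1 / 2 : ℂ) • (1 + circuitMatrix V.conjFlip) =
      V.realProjector.map Complex.ofReal := by
    ext b' b
    have h : b' = runLabels V.conjFlip b ↔ b = runLabels V.conjFlip b' := by
      rw [eq_runLabels_reverse, reverse_conjFlip]
    rw [Matrix.smul_apply, Matrix.add_apply, circuitMatrix_apply, one_apply, map_apply, realProjector,
      of_apply]
    simp only [h]
    split_ifs <;> norm_num
  have hm : (V.acceptMatrix x).map Complex.ofReal = ((V.loadMatrix x).map Complex.ofReal)ᴴ *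
      V.realProjector.map Complex.ofReal * (V.loadMatrix x).map Complex.ofReal := by
    have e : ((V.loadMatrix x).map Complex.ofReal)ᴴ = ((V.loadMatrix x)ᵀ).map Complex.ofReal := by
      ext; simp
    have hmul : ∀ {l m o : Type} [Fintype m] (M : Matrix l m ℝ) (M' : Matrix m o ℝ),
        (M * M').map Complex.ofReal = M.map Complex.ofReal * M'.map Complex.ofReal :=
      fun M M' => Matrix.map_mul (f := Complex.ofRealHom)
    rw [e, acceptMatrix, hmul, hmul]
  rw [acceptProb, conj_outProjector, hp, hi, hm, star_mulVec, ← dotProduct_mulVec, mulVec_mulVec,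
    mulVec_mulVec, Matrix.mul_assoc]

/-- The triangle inequality together with non-negativity of the entries: the moduli of the
amplitudes do at least as well as ψ. -/
theorem acceptProb_le (x : Fin n → Bool) (ψ : (Fin V.nw → Bool) → ℂ) :
    V.acceptProb x ψ ≤ (fun w => ‖ψ w‖) ⬝ᵥ V.acceptMatrix x *ᵥ fun w => ‖ψ w‖ := by
  rw [acceptProb_eq]
  refine (Complex.re_le_norm _).trans ((norm_sum_le _ _).trans (Finset.sum_le_sum fun w _ => ?_))
  rw [norm_mul, Pi.star_apply, norm_star]
  refine mul_le_mul_of_nonneg_left ((norm_sum_le _ _).trans (Finset.sum_le_sum fun w' _ => ?_))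
    (norm_nonneg _)
  rw [norm_mul]
  refine mul_le_mul_of_nonneg_right (le_of_eq ?_) (norm_nonneg _)
  simp only [map_apply]
  rw [Complex.norm_real, Real.norm_of_nonneg (V.acceptMatrix_nonneg x w w')]

theorem acceptProb_ofReal (x : Fin n → Bool) (u : (Fin V.nw → Bool) → ℝ) :
    V.acceptProb x (fun w => (u w : ℂ)) = u ⬝ᵥ V.acceptMatrix x *ᵥ u := by
  rw [acceptProb_eq]
  simp [dotProduct, mulVec]

/-- Scaling a nonzero vector to a state turns the soundness condition into the homogeneous bound
that `sum_pow_le` takes. -/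
theorem acceptMatrix_form_le {x : Fin n → Bool} {ε : ℝ}
    (h : ∀ ψ, IsState ψ → V.acceptProb x ψ ≤ ε) (u : (Fin V.nw → Bool) → ℝ) :
    u ⬝ᵥ V.acceptMatrix x *ᵥ u ≤ ε * (u ⬝ᵥ u) := by
  have hn : 0 ≤ u ⬝ᵥ u := Finset.sum_nonneg fun i _ => mul_self_nonneg _
  rcases hn.eq_or_lt with h0 | h0
  · rw [dotProduct_self_eq_zero.1 h0.symm]
    simp
  · have h1 := h (fun w => (((√(u ⬝ᵥ u))⁻¹ • u) w : ℝ)) (by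
      simp only [IsState, Complex.norm_real, Real.norm_eq_abs, sq_abs, Pi.smul_apply, smul_eq_mul,
        mul_pow, inv_pow, Real.sq_sqrt hn]
      rw [← Finset.mul_sum]
      have : ∑ i, u i ^ 2 = u ⬝ᵥ u := by simp [dotProduct, sq]
      rw [this, inv_mul_cancel₀ h0.ne'])
    rw [acceptProb_ofReal, mulVec_smul, smul_dotProduct, dotProduct_smul, smul_smul, smul_eq_mul,
      ← mul_inv, Real.mul_self_sqrt hn, inv_mul_le_iff₀ h0] at h1
    linarith

end StoqVerifier

end Stoq

namespace Stoq

open Matrix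

/-! ### The string simulation and the action on labels -/

section Simulation

variable {N : ℕ}

/-- The target of a gate followed by its controls. -/
def Gate.ctl : Gate N → List ℕ
  | .X t => [t]
  | .CNOT c t _ => [t, c]
  | .Toffoli c₁ c₂ t _ _ _ => [t, c₂, c₁]

theorem parse_code (gates : List (Gate N)) :
    parse (gates.flatMap Gate.code) = (gates.map Gate.ctl).reverse := by
  -- Between gates the counter is 0, but the indices of the previous gate are still in the state
  -- until the next type tag clears them; hence the arbitrary `a`.
  have h : ∀ (a : List ℕ) (G : List (List ℕ)),
      ((gates.flatMap Gate.code).foldl parseStep (0, a, G)).2.2 =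
        (gates.map Gate.ctl).reverse ++ G := by
    induction gates with
    | nil => simp
    | cons g gates ih =>
      intro a G
      have e : g.code.foldl parseStep (0, a, G) = (0, g.ctl, g.ctl :: G) := by
        cases g <;> simp [Gate.code, Gate.ctl, parseStep]
      rw [List.flatMap_cons, List.foldl_append, e, ih]
      simp
  have := h [] []
  rwa [List.append_nil] at this

theorem getD_ofFn_append (b : Fin N → Bool) (t : List Bool) (i : Fin N) :
    (List.ofFn b ++ t).getD i false = b i := by
  rw [List.getD_append _ _ _ _ (by simp), List.getD_eq_getElem _ _ (by simp)]
  simp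

theorem set_ofFn_append (b : Fin N → Bool) (t : List Bool) (i : Fin N) (y : Bool) :
    (List.ofFn b ++ t).set i y = List.ofFn (Function.update b i y) ++ t := by
  rw [List.set_append_left _ _ (by simp)]
  congr 1
  refine List.ext_getElem (by simp) fun j h1 h2 => ?_
  rw [List.getElem_set, List.getElem_ofFn, List.getElem_ofFn, Function.update_apply]
  simp only [Fin.ext_iff, eq_comm]

theorem applyCtl_ofFn_append (g : Gate N) (b : Fin N → Bool) (t : List Bool) :
    applyCtl (List.ofFn b ++ t) g.ctl = List.ofFn (g.apply b) ++ t := by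
  cases g with
  | X i =>
    simp only [applyCtl, Gate.ctl, Gate.apply, getD_ofFn_append, set_ofFn_append, List.headD_cons,
      List.tail_cons, List.foldl_nil, Bool.xor_true]
  | CNOT c i h =>
    simp only [applyCtl, Gate.ctl, Gate.apply, getD_ofFn_append, set_ofFn_append, List.headD_cons,
      List.tail_cons, List.foldl_cons, List.foldl_nil, Bool.true_and]
  | Toffoli c₁ c₂ i h h₁ h₂ =>
    simp only [applyCtl, Gate.ctl, Gate.apply, getD_ofFn_append, set_ofFn_append, List.headD_cons,
      List.tail_cons, List.foldl_cons, List.foldl_nil, Bool.true_and, Bool.and_comm (b c₁)]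

/-- The tail `t` is the padding of a block: bits behind the register, which no gate touches. -/
theorem runGates_ofFn_append (gs : List (Gate N)) (b : Fin N → Bool) (t : List Bool) :
    runGates (gs.map Gate.ctl) (List.ofFn b ++ t) = List.ofFn (runLabels gs b) ++ t := by
  induction gs generalizing b with
  | nil => rfl
  | cons g gs ih =>
    rw [runLabels_cons, ← ih, ← applyCtl_ofFn_append]
    rfl

end Simulation

/-! ### One round on strings and on basis labels -/

namespace StoqVerifier

variable {n : ℕ} (V : StoqVerifier n)

/-- The gates of a verifier, the last one first, each by its target and controls. -/
def ctls : List (List ℕ) := (V.gates.map Gate.ctl).reverse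

/-- The basis label with given input, witness and random bits. -/
def label (x : Fin n → Bool) (w : Fin V.nw → Bool) (s : Fin V.np → Bool) : Fin V.qubits → Bool :=
  Fin.append (Fin.append (Fin.append x w) fun _ => false) s

/-- The bits of a basis label that belong to the ancillas `|+⟩`. -/
def plusPart (b : Fin V.qubits → Bool) : Fin V.np → Bool := fun i => b (Fin.natAdd _ i)

theorem append_parts (b : Fin V.qubits → Bool) :
    Fin.append (Fin.append (Fin.append (V.inputPart b) (V.witnessPart b)) (V.zeroPart b))
      (V.plusPart b) = b := by
  funext i
  refine Fin.addCases (fun i => ?_) (fun i => ?_) i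
  · rw [Fin.append_left]
    refine Fin.addCases (fun i => ?_) (fun i => ?_) i
    · rw [Fin.append_left]
      refine Fin.addCases (fun i => ?_) (fun i => ?_) i
      · rw [Fin.append_left]; rfl
      · rw [Fin.append_right]; rfl
    · rw [Fin.append_right]; rfl
  · rw [Fin.append_right]; rfl

theorem ofFn_eq (b : Fin V.qubits → Bool) :
    List.ofFn b = List.ofFn (V.inputPart b) ++ (List.ofFn (V.witnessPart b) ++
      (List.ofFn (V.zeroPart b) ++ List.ofFn (V.plusPart b))) := by
  conv_lhs => rw [← V.append_parts b]
  rw [List.ofFn_fin_append, List.ofFn_fin_append, List.ofFn_fin_append, List.append_assoc,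
    List.append_assoc]

theorem loaded_label (x : Fin n → Bool) (w : Fin V.nw → Bool) (s : Fin V.np → Bool) :
    V.Loaded x w (V.label x w s) := by
  refine ⟨funext fun i => ?_, funext fun i => ?_, funext fun i => ?_⟩
  · simp [inputPart, label]
  · simp [witnessPart, label]
  · simp [zeroPart, label]

theorem plusPart_label (x : Fin n → Bool) (w : Fin V.nw → Bool) (s : Fin V.np → Bool) :
    V.plusPart (V.label x w s) = s := by
  funext i
  simp [plusPart, label]

theorem label_plusPart {x : Fin n → Bool} {w : Fin V.nw → Bool} {b : Fin V.qubits → Bool}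
    (h : V.Loaded x w b) : V.label x w (V.plusPart b) = b := by
  obtain ⟨rfl, rfl, h⟩ := h
  rw [label, ← h, append_parts]

/-- A loaded label is determined by its bits on the |+⟩ ancillas, and these are free. -/
theorem card_loaded (x : Fin n → Bool) (w : Fin V.nw → Bool) (Q : (Fin V.qubits → Bool) → Prop)
    [DecidablePred Q] :
    (Finset.univ.filter fun b => V.Loaded x w b ∧ Q b).card =
      (Finset.univ.filter fun s => Q (V.label x w s)).card := by
  refine Finset.card_nbij' V.plusPart (V.label x w) ?_ ?_ ?_ ?_
  · intro b hb
    simp only [Finset.coe_filter, Finset.mem_univ, true_and, Set.mem_ofPred_eq] at hb ⊢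
    rw [V.label_plusPart hb.1]
    exact hb.2
  · intro s hs
    simp only [Finset.coe_filter, Finset.mem_univ, true_and, Set.mem_ofPred_eq] at hs ⊢
    exact ⟨V.loaded_label x w s, hs⟩
  · intro b hb
    simp only [Finset.coe_filter, Finset.mem_univ, true_and, Set.mem_ofPred_eq] at hb
    exact V.label_plusPart hb.1
  · intro s _
    exact V.plusPart_label x w s

/-- The label after one round. -/
def roundLabel (c : Bool) (b : Fin V.qubits → Bool) : Fin V.qubits → Bool :=
  bif c then runLabels V.conjFlip b else b

/-- If the coin `c` is false, the circuit and its inverse cancel; if it is true, the flip between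
them makes up `conjFlip`. -/
theorem roundReg_eq (x : Fin n → Bool) (w : Fin V.nw → Bool) (c : Bool) (s : Fin V.np → Bool)
    (t : List Bool) :
    roundReg V.ctls V.n0 (List.ofFn x) (List.ofFn w) (c :: (List.ofFn s ++ t)) =
      List.ofFn (V.roundLabel c (V.label x w s)) ++ t := by
  have h0 : List.ofFn x ++ (List.ofFn w ++ (List.replicate V.n0 false ++ (List.ofFn s ++ t))) =
      List.ofFn (V.label x w s) ++ t := by
    rw [label, List.ofFn_fin_append, List.ofFn_fin_append, List.ofFn_fin_append, List.ofFn_const]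
    simp only [List.append_assoc]
  have e : (0 : ℕ) = ((⟨0, V.pos⟩ : Fin V.qubits) : ℕ) := rfl
  have h1 : V.ctls.reverse = V.gates.map Gate.ctl := by rw [ctls, List.reverse_reverse]
  have h2 : V.ctls = V.gates.reverse.map Gate.ctl := by rw [ctls, List.map_reverse]
  rw [roundReg, List.tail_cons, List.headD_cons, h0, h1, runGates_ofFn_append, e,
    getD_ofFn_append, set_ofFn_append, h2, runGates_ofFn_append]
  congr 2
  cases c with
  | false =>
    rw [Bool.xor_false, Function.update_eq_self, runLabels_reverse]
    rfl
  | true =>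
    rw [Bool.xor_true, roundLabel, cond_true, conjFlip, runLabels_append, runLabels_cons]
    rfl

theorem length_roundWit (x : Fin n → Bool) (w : Fin V.nw → Bool) (v : List Bool) :
    (roundWit V.ctls V.nw V.n0 (List.ofFn x) (List.ofFn w) v).length = V.nw := by
  rw [roundWit, List.length_take, List.length_drop, roundReg, length_runGates, List.length_set,
    length_runGates]
  simp

/-- `roundOk` compares the new witness bits with themselves, so it tests only the input bits and the
zeros; the bits behind them are not looked at. -/
theorem round_iff (x : Fin n → Bool) (w w' : Fin V.nw → Bool) (c : Bool) (s : Fin V.np → Bool)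
    (t : List Bool) :
    (roundOk V.ctls V.nw V.n0 (List.ofFn x) (List.ofFn w) (c :: (List.ofFn s ++ t)) = true ∧
      roundWit V.ctls V.nw V.n0 (List.ofFn x) (List.ofFn w) (c :: (List.ofFn s ++ t)) =
        List.ofFn w') ↔ V.Loaded x w' (V.roundLabel c (V.label x w s)) := by
  generalize hb : V.roundLabel c (V.label x w s) = b
  have hr := V.roundReg_eq x w c s t
  rw [hb, V.ofFn_eq b] at hr
  have hw : roundWit V.ctls V.nw V.n0 (List.ofFn x) (List.ofFn w) (c :: (List.ofFn s ++ t)) =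
      List.ofFn (V.witnessPart b) := by
    rw [roundWit, hr, List.append_assoc, List.drop_left' (by simp), List.append_assoc,
      List.take_left' (by simp)]
  have ht : (roundReg V.ctls V.n0 (List.ofFn x) (List.ofFn w) (c :: (List.ofFn s ++ t))).take
      ((List.ofFn x).length + (V.nw + V.n0)) =
      List.ofFn (V.inputPart b) ++ (List.ofFn (V.witnessPart b) ++ List.ofFn (V.zeroPart b)) := by
    rw [hr, ← List.append_assoc (List.ofFn (V.witnessPart b)),
      ← List.append_assoc (List.ofFn (V.inputPart b)), List.append_assoc,
      List.take_left' (by simp)]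
  rw [roundOk, hw, ht, beq_iff_eq, List.ofFn_inj, Loaded]
  constructor
  · rintro ⟨h1, h2⟩
    obtain ⟨h3, h4⟩ := List.append_inj h1 (by simp)
    have h5 := List.append_cancel_left h4
    rw [← List.ofFn_const, List.ofFn_inj] at h5
    exact ⟨List.ofFn_inj.1 h3, h2, h5⟩
  · rintro ⟨h1, h2, h3⟩
    rw [h1, h3, List.ofFn_const]
    exact ⟨rfl, h2⟩

end StoqVerifier

end Stoq

namespace Stoq

open Matrix

/-! ### Counting strings -/

/-- The number of strings of length `m` with the property `P`. -/
def countBits (m : ℕ) (P : List Bool → Bool) : ℕ :=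
  (Finset.univ.filter fun v : Fin m → Bool => P (List.ofFn v) = true).card

theorem countBits_eq_sum (m : ℕ) (P : List Bool → Bool) :
    countBits m P = ∑ v : Fin m → Bool, if P (List.ofFn v) = true then 1 else 0 :=
  Finset.card_filter _ _

theorem countBits_add (a b : ℕ) (P : List Bool → Bool) :
    countBits (a + b) P = ∑ u : Fin a → Bool, countBits b fun l => P (List.ofFn u ++ l) := by
  simp only [countBits_eq_sum]
  rw [← Fintype.sum_prod_type', ← Fintype.sum_equiv (Fin.appendEquiv a b)]
  intro u
  simp only [Fin.appendEquiv, Equiv.coe_fn_mk, List.ofFn_fin_append]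

theorem countBits_one_add (m : ℕ) (P : List Bool → Bool) :
    countBits (1 + m) P =
      (countBits m fun l => P (false :: l)) + countBits m fun l => P (true :: l) := by
  rw [countBits_add, Fintype.sum_equiv (Equiv.funUnique (Fin 1) Bool) _
    (fun c => countBits m fun l => P (c :: l)), Fintype.sum_bool, add_comm]
  intro u
  rfl

theorem countBits_const (m : ℕ) (c : Bool) :
    (countBits m fun _ => c) = if c = true then 2 ^ m else 0 := by
  cases c <;> simp [countBits]

/-- The flag only ever enters a conjunction, so a failed round cannot be made good later. -/
theorem iterate_round_false (gs : List (List ℕ)) (nw n0 D k : ℕ) (x w y : List Bool) :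
    ((round gs nw n0 D x)^[k] (false, w, y)).1 = false := by
  induction k generalizing w y with
  | zero => rfl
  | succ k ih =>
    rw [Function.iterate_succ_apply]
    exact ih _ _

/-! ### Accepted strings and powers of the acceptance matrix -/

namespace StoqVerifier

variable {n : ℕ} (V : StoqVerifier n)

/-- The number of blocks of `D` bits that lead from the witness bits `w` to `w'` in one round. -/
def roundMatrix (D : ℕ) (x : Fin n → Bool) : Matrix (Fin V.nw → Bool) (Fin V.nw → Bool) ℕ :=
  of fun w w' => countBits D fun v =>
    roundOk V.ctls V.nw V.n0 (List.ofFn x) (List.ofFn w) v &&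
      (roundWit V.ctls V.nw V.n0 (List.ofFn x) (List.ofFn w) v == List.ofFn w')

/-- A block consists of the coin, the `np` random bits and padding; the padding is free and supplies
the remaining power of two. -/
theorem roundMatrix_apply {D : ℕ} (hD : V.np + 1 ≤ D) (x : Fin n → Bool)
    (w w' : Fin V.nw → Bool) :
    (V.roundMatrix D x w w' : ℝ) = V.acceptMatrix x w w' * 2 ^ D := by
  obtain ⟨e, rfl⟩ := Nat.exists_eq_add_of_le hD
  have h : ∀ c : Bool, (countBits (V.np + e) fun l =>
      roundOk V.ctls V.nw V.n0 (List.ofFn x) (List.ofFn w) (c :: l) &&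
      (roundWit V.ctls V.nw V.n0 (List.ofFn x) (List.ofFn w) (c :: l) == List.ofFn w')) =
      (Finset.univ.filter fun b =>
        V.Loaded x w b ∧ V.Loaded x w' (V.roundLabel c b)).card * 2 ^ e := by
    intro c
    rw [countBits_add, V.card_loaded x w (fun b => V.Loaded x w' (V.roundLabel c b)),
      Finset.card_filter, Finset.sum_mul]
    refine Finset.sum_congr rfl fun s _ => ?_
    have : ∀ l, (roundOk V.ctls V.nw V.n0 (List.ofFn x) (List.ofFn w) (c :: (List.ofFn s ++ l)) &&
      (roundWit V.ctls V.nw V.n0 (List.ofFn x) (List.ofFn w) (c :: (List.ofFn s ++ l)) ==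
        List.ofFn w')) = decide (V.Loaded x w' (V.roundLabel c (V.label x w s))) := by
      intro l
      rw [Bool.eq_iff_iff, Bool.and_eq_true, beq_iff_eq, round_iff, decide_eq_true_iff]
    simp only [this, countBits_const, decide_eq_true_iff]
    split <;> simp
  have e1 : V.np + 1 + e = 1 + (V.np + e) := by ring
  have e2 : (2 : ℝ) ^ (V.np + 1 + e) = 2 ^ (V.np + 1) * 2 ^ e := pow_add _ _ _
  rw [e2, ← mul_assoc, acceptMatrix_apply, roundMatrix, of_apply, e1, countBits_one_add, h, h]
  push_cast
  rw [add_mul]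
  rfl

/-- The first block either fails or leads to exactly one next witness, so the count obeys the
recursion of a matrix power applied to the all-ones vector. -/
theorem countBits_iterate_round (D k : ℕ) (x : Fin n → Bool) (w : Fin V.nw → Bool) :
    (countBits (k * D) fun y =>
      ((round V.ctls V.nw V.n0 D (List.ofFn x))^[k] (true, List.ofFn w, y)).1) =
      ((V.roundMatrix D x) ^ k *ᵥ 1) w := by
  induction k generalizing w with
  | zero =>
    simp [countBits]
  | succ k ih =>
    rw [Nat.succ_mul, add_comm, countBits_add, pow_succ', ← mulVec_mulVec, mulVec, dotProduct]
    simp only [← ih]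
    simp only [roundMatrix, of_apply]
    rw [Finset.sum_congr rfl fun w' _ => congrArg (· * _) (countBits_eq_sum _ _)]
    simp only [Finset.sum_mul]
    rw [Finset.sum_comm]
    refine Finset.sum_congr rfl fun v _ => ?_
    generalize hok : roundOk V.ctls V.nw V.n0 (List.ofFn x) (List.ofFn w) (List.ofFn v) = ok
    -- The new witness has the right length, so it is an index of the matrix and selects one term of
    -- the sum over `w'`.
    obtain ⟨u, hu⟩ : ∃ u : Fin V.nw → Bool,
        roundWit V.ctls V.nw V.n0 (List.ofFn x) (List.ofFn w) (List.ofFn v) = List.ofFn u := by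
      have hl := V.length_roundWit x w (List.ofFn v)
      generalize roundWit V.ctls V.nw V.n0 (List.ofFn x) (List.ofFn w) (List.ofFn v) = r at hl
      exact ⟨fun i => r.get (i.cast hl.symm), by
        refine List.ext_getElem (by simp [hl]) fun j h1 h2 => by simp⟩
    have hr : ∀ l, round V.ctls V.nw V.n0 D (List.ofFn x) (true, List.ofFn w, List.ofFn v ++ l) =
        (ok, List.ofFn u, l) := by
      intro l
      simp only [round, Bool.true_and]
      rw [List.take_left' (by simp), List.drop_left' (by simp), hok, hu]
    simp only [Function.iterate_succ_apply, hr, hu]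
    cases ok with
    | false => simp [iterate_round_false, countBits_const]
    | true => simp [List.ofFn_inj]

/-- Only the first `nw` bits of the initial block matter, as the starting witness; the others give
the power of two in front. -/
theorem countBits_accepts {D : ℕ} (hD : V.nw ≤ D) (k : ℕ) (x : Fin n → Bool) :
    (countBits (D + k * D) fun y => accepts V.ctls V.nw V.n0 D k (List.ofFn x) y) =
      2 ^ (D - V.nw) * ((1 : (Fin V.nw → Bool) → ℕ) ⬝ᵥ (V.roundMatrix D x) ^ k *ᵥ 1) := by
  have h : ∀ u : Fin D → Bool, ((countBits (k * D)) fun l =>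
      accepts V.ctls V.nw V.n0 D k (List.ofFn x) (List.ofFn u ++ l)) =
      countBits (k * D) fun l => ((round V.ctls V.nw V.n0 D (List.ofFn x))^[k]
        (true, (List.ofFn u).take V.nw, l)).1 := by
    intro u
    congr 1
    funext l
    rw [accepts, List.take_left' (by simp), List.drop_left' (by simp)]
  rw [countBits_add, Finset.sum_congr rfl fun u _ => h u]
  have h' : ∀ (E : ℕ) (G : List Bool → ℕ), E = V.nw + (E - V.nw) →
      ∑ u : Fin E → Bool, G ((List.ofFn u).take V.nw) =
        2 ^ (E - V.nw) * ∑ w : Fin V.nw → Bool, G (List.ofFn w) := by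
    intro E G hE
    generalize E - V.nw = e at hE ⊢
    subst hE
    rw [← Fintype.sum_equiv (Fin.appendEquiv V.nw e)
      (fun p => G (List.ofFn p.1)), Fintype.sum_prod_type, Finset.mul_sum]
    · simp
    · intro p
      simp only [Fin.appendEquiv, Equiv.coe_fn_mk, List.ofFn_fin_append]
      rw [List.take_left' (by simp)]
  rw [h' D (fun w => countBits (k * D) fun l => ((round V.ctls V.nw V.n0 D (List.ofFn x))^[k]
        (true, w, l)).1) (by omega)]
  simp only [countBits_iterate_round, dotProduct, Pi.one_apply, one_mul]

theorem countBits_accepts_eq {D : ℕ} (hD : V.qubits + 1 ≤ D) (k : ℕ) (x : Fin n → Bool) :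
    ((countBits (D + k * D) fun y => accepts V.ctls V.nw V.n0 D k (List.ofFn x) y : ℕ) : ℝ) =
      2 ^ (D - V.nw) * (2 ^ D) ^ k *
        ((1 : (Fin V.nw → Bool) → ℝ) ⬝ᵥ (V.acceptMatrix x) ^ k *ᵥ 1) := by
  have hq : V.qubits = n + V.nw + V.n0 + V.np := rfl
  have hM : (V.roundMatrix D x).map (Nat.castRingHom ℝ) = (2 ^ D : ℝ) • V.acceptMatrix x := by
    ext w w'
    rw [map_apply, Matrix.smul_apply, smul_eq_mul, mul_comm]
    exact V.roundMatrix_apply (by omega) x w w'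
  have hk : ((V.roundMatrix D x) ^ k).map (Nat.castRingHom ℝ) =
      ((2 ^ D : ℝ) ^ k) • (V.acceptMatrix x) ^ k := by
    rw [← smul_pow, ← hM]
    exact map_pow (Nat.castRingHom ℝ).mapMatrix _ _
  rw [V.countBits_accepts (by omega)]
  push_cast
  rw [mul_assoc]
  congr 1
  rw [← smul_eq_mul, ← dotProduct_smul, ← smul_mulVec, ← hk]
  simp [dotProduct, mulVec]

end StoqVerifier

end Stoq

namespace Stoq

open Computability Matrix

/-! ### Uniformity -/

theorem encodeStrings_eq : encodeStrings = prodEnc (fun l : List Bool => l) fun l => l := rfl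

theorem encodeNats_eq : encodeNats = prodEnc encodeNat encodeNat := rfl

/-- Both codes write numbers in unary with end markers, so a symbolwise translation makes the
description of a verifier available to the list functions. -/
theorem indexEnc_eq_flatMap (l : List ℕ) :
    indexEnc l = (encodeTallies l).flatMap fun b => [if b then some true else none] := by
  induction l with
  | nil => rfl
  | cons k l ih =>
    have e : encodeTallies (k :: l) = List.replicate k true ++ false :: encodeTallies l := by
      simp [encodeTallies]
    rw [e, indexEnc, listEnc_cons, unaryEncodeNat_eq_replicate, List.flatMap_append,
      List.flatMap_cons, ← ih]
    simp [List.flatMap_replicate, List.map_replicate]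

section Context

variable {γ Γ : Type} [Fintype Γ] {eg : γ → List Γ}

theorem Uniform.description {V : ∀ n, StoqVerifier n} (hV : Uniform V) {m : γ → ℕ}
    (hm : PolyTime eg unaryEncodeNat m) : PolyTime eg indexEnc fun c =>
      [(V (m c)).nw, (V (m c)).n0, (V (m c)).np] ++ (V (m c)).gates.flatMap Gate.code := by
  have h1 : PolyTime unaryEncodeNat encodeTallies fun n =>
      [(V n).nw, (V n).n0, (V n).np] ++ (V n).gates.flatMap Gate.code :=
    PolyTime.recode hV fun _ => rfl
  have h2 : PolyTime encodeTallies indexEnc fun l => l := PolyTime.flatMap _ indexEnc_eq_flatMap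
  exact h2.comp (h1.comp hm)

theorem Uniform.polyTime_nw {V : ∀ n, StoqVerifier n} (hV : Uniform V) {m : γ → ℕ}
    (hm : PolyTime eg unaryEncodeNat m) : PolyTime eg unaryEncodeNat fun c => (V (m c)).nw :=
  (PolyTime.getD 0 (PolyTime.const 0) (hV.description hm)).recode fun _ => rfl

theorem Uniform.polyTime_n0 {V : ∀ n, StoqVerifier n} (hV : Uniform V) {m : γ → ℕ}
    (hm : PolyTime eg unaryEncodeNat m) : PolyTime eg unaryEncodeNat fun c => (V (m c)).n0 :=
  (PolyTime.getD 0 (PolyTime.const 1) (hV.description hm)).recode fun _ => rfl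

/-- The description begins with three register sizes, so the gates start behind the third number. -/
theorem Uniform.polyTime_ctls {V : ∀ n, StoqVerifier n} (hV : Uniform V) {m : γ → ℕ}
    (hm : PolyTime eg unaryEncodeNat m) :
    PolyTime eg (listEnc indexEnc) fun c => (V (m c)).ctls :=
  (PolyTime.drop (PolyTime.const 3) (hV.description hm)).parse.recode fun c =>
    congrArg _ (parse_code (V (m c)).gates)

end Context

theorem Uniform.polyTime_accepts {V : ∀ n, StoqVerifier n} (hV : Uniform V) (D k : Polynomial ℕ) :
    PolyTime encodeStrings encodeBool fun p : List Bool × List Bool =>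
      accepts (V p.1.length).ctls (V p.1.length).nw (V p.1.length).n0 (D.eval p.1.length)
        (k.eval p.1.length) p.1 p.2 := by
  rw [encodeStrings_eq]
  have h1 := PolyTime.fst (ea := fun l : List Bool => l) (eb := fun l : List Bool => l)
  have h2 := PolyTime.snd (ea := fun l : List Bool => l) (eb := fun l : List Bool => l)
  have hm := (PolyTime.code_length (eg := fun l : List Bool => l)).comp h1
  exact PolyTime.accepts (hV.polyTime_ctls hm) (hV.polyTime_nw hm) (hV.polyTime_n0 hm)
    (PolyTime.unary_eval D hm) (PolyTime.unary_eval k hm) h1.toList h2.toList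

theorem PolyTimeFraction.pow_mul {ε : ℕ → ℝ} (hε : PolyTimeFraction unaryEncodeNat ε)
    (D k : Polynomial ℕ) : PolyTimeFraction (id : List Bool → List Bool) fun x =>
      (ε x.length * 2 ^ D.eval x.length) ^ k.eval x.length := by
  obtain ⟨g, hg, hgε⟩ := hε
  have hm : PolyTime (id : List Bool → List Bool) unaryEncodeNat List.length :=
    PolyTime.code_length (eg := fun l : List Bool => l)
  rw [encodeNats_eq] at hg
  have hgm := hg.comp hm
  refine ⟨fun x => (((g x.length).1 * 2 ^ D.eval x.length) ^ k.eval x.length,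
    (g x.length).2 ^ k.eval x.length), ?_, fun x => ⟨pow_pos (hgε _).1 _, ?_⟩⟩
  · rw [encodeNats_eq]
    exact ((hgm.left.mul ((PolyTime.const 2).pow (PolyTime.unary_eval D hm))).pow
      (PolyTime.unary_eval k hm)).pair (hgm.right.pow (PolyTime.unary_eval k hm))
  · push_cast
    rw [(hgε _).2, ← div_pow, div_mul_eq_mul_div]

/-! ### The gap -/

/-- From 1 - t ≤ e^(-t) one gets (1 - 1/q)^q ≤ 1/e ≤ 1/2. -/
theorem one_sub_inv_pow_le {q : ℕ} (hq : 0 < q) (m : ℕ) :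
    (1 - 1 / (q : ℝ)) ^ (q * m) ≤ (1 / 2) ^ m := by
  have hq' : (1 : ℝ) ≤ q := by exact_mod_cast hq
  have h0 : 0 ≤ 1 - 1 / (q : ℝ) := by
    rw [sub_nonneg, div_le_one (by linarith)]
    exact hq'
  have h1 : (1 - 1 / (q : ℝ)) ^ q ≤ 1 / 2 := by
    calc (1 - 1 / (q : ℝ)) ^ q ≤ (Real.exp (-(1 / (q : ℝ)))) ^ q :=
          pow_le_pow_left₀ h0 (Real.one_sub_le_exp_neg _) _
      _ = Real.exp (-1) := by
          rw [← Real.exp_nat_mul]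
          congr 1
          field_simp
      _ ≤ 1 / 2 := by
          rw [Real.exp_neg, one_div]
          refine inv_anti₀ (by norm_num) ?_
          have := Real.add_one_le_exp 1
          linarith
  rw [pow_mul]
  exact pow_le_pow_left₀ (pow_nonneg h0 _) h1 _

/-- Because b ≤ 1, the additive gap is a multiplicative one: a ≤ b - 1/q ≤ (1 - 1/q) b. -/
theorem pow_le_of_gap {a b : ℝ} {q : ℕ} (ha : 0 ≤ a) (hb : b ≤ 1) (hq : 0 < q)
    (h : 1 / (q : ℝ) ≤ b - a) (m : ℕ) : a ^ (q * m) ≤ (1 / 2) ^ m * b ^ (q * m) := by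
  have hq' : (0 : ℝ) < 1 / q := by positivity
  have hb0 : 0 ≤ b := by linarith
  have h1 : a ≤ (1 - 1 / (q : ℝ)) * b := by nlinarith
  calc a ^ (q * m) ≤ ((1 - 1 / (q : ℝ)) * b) ^ (q * m) := pow_le_pow_left₀ ha h1 _
    _ = (1 - 1 / (q : ℝ)) ^ (q * m) * b ^ (q * m) := mul_pow _ _ _
    _ ≤ _ := mul_le_mul_of_nonneg_right (one_sub_inv_pow_le hq m) (pow_nonneg hb0 _)

/-! ### Bounds on the number of accepted strings -/

namespace StoqVerifier

variable {n : ℕ} (V : StoqVerifier n)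

/-- `pow_le_sum_pow` is applied to the moduli of ψ; the factor 2^(D - n_w) ≥ 1 from the unused bits
is dropped. -/
theorem le_countBits_accepts {D : ℕ} (hD : V.qubits + 1 ≤ D) (k : ℕ) {x : Fin n → Bool}
    {ψ : (Fin V.nw → Bool) → ℂ} (hψ : IsState ψ) {ε : ℝ} (hε : 0 < ε)
    (h : ε ≤ V.acceptProb x ψ) :
    (ε * 2 ^ D) ^ k ≤
      ((countBits (D + k * D) fun y => accepts V.ctls V.nw V.n0 D k (List.ofFn x) y : ℕ) : ℝ) := by
  have h1 := pow_le_sum_pow (V.posSemidef_acceptMatrix x) (V.acceptMatrix_nonneg x)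
    (φ := fun w => ‖ψ w‖) (fun w => norm_nonneg _)
    (by rw [← hψ]; simp only [dotProduct, sq]) hε (h.trans (V.acceptProb_le x ψ)) k
  rw [V.countBits_accepts_eq hD, mul_pow, mul_comm, mul_assoc]
  have h2 : (2 ^ D) ^ k * ε ^ k ≤
      (2 ^ D) ^ k * ((1 : (Fin V.nw → Bool) → ℝ) ⬝ᵥ (V.acceptMatrix x) ^ k *ᵥ 1) :=
    mul_le_mul_of_nonneg_left h1 (by positivity)
  refine h2.trans (le_mul_of_one_le_left ?_ (one_le_pow₀ (by norm_num)))
  exact le_trans (by positivity) h2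

/-- The number 2^(n_w) of witness strings in `sum_pow_le` and the factor 2^(D - n_w) of the unused
bits combine to 2^D. -/
theorem countBits_accepts_le {D : ℕ} (hD : V.qubits + 1 ≤ D) (k : ℕ) {x : Fin n → Bool}
    {ε : ℝ} (hε : 0 ≤ ε) (h : ∀ ψ, IsState ψ → V.acceptProb x ψ ≤ ε) :
    ((countBits (D + k * D) fun y => accepts V.ctls V.nw V.n0 D k (List.ofFn x) y : ℕ) : ℝ) ≤
      2 ^ D * ((2 ^ D) ^ k * ε ^ k) := by
  have h1 := sum_pow_le (V.posSemidef_acceptMatrix x) hε (V.acceptMatrix_form_le h) k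
  have hq : V.qubits = n + V.nw + V.n0 + V.np := rfl
  have h2 : (2 : ℝ) ^ D = 2 ^ (D - V.nw) * 2 ^ V.nw := by
    rw [← pow_add]
    congr 1
    omega
  rw [V.countBits_accepts_eq hD]
  refine (mul_le_mul_of_nonneg_left h1 (by positivity)).trans (le_of_eq ?_)
  rw [Fintype.card_fun, Fintype.card_bool, Fintype.card_fin]
  push_cast
  linear_combination (-((2 : ℝ) ^ D) ^ k * ε ^ k) * h2

end StoqVerifier

end Stoq

/-! ### The inclusion -/

theorem theorem4 : Stoq.StoqMA ⊆ Stoq.SBP := by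
  rintro L ⟨V, εyes, εno, hV, ⟨q, hq⟩, hyes, -, hε, ⟨r, hr⟩, hLyes, hLno⟩
  -- The block length: room for the coin and all random bits of a round, and for an initial witness.
  let D : Polynomial ℕ := q + 1
  -- Every `r` rounds at least halve the ratio of the two cases; `D + 1` halvings cancel the factor
  -- 2^D of the no-case and leave the 1/2 in the definition of SBP.
  let k : Polynomial ℕ := r * (D + 1)
  have hD : ∀ m, (V m).qubits + 1 ≤ D.eval m := fun m => by
    have := (hq m).1
    simp only [D, Polynomial.eval_add, Polynomial.eval_one]
    omega
  have hk : ∀ m, k.eval m = r.eval m * (D.eval m + 1) := fun m => by simp [k]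
  have hp : ∀ m, (D + k * D).eval m = D.eval m + k.eval m * D.eval m := fun m => by simp
  have hpos : ∀ m, 0 < εyes m := fun m => (hε m).1.trans_lt (hε m).2.1
  refine ⟨fun x => Stoq.countBits (D.eval x.length + k.eval x.length * D.eval x.length) fun y =>
    Stoq.accepts (V x.length).ctls (V x.length).nw (V x.length).n0 (D.eval x.length)
      (k.eval x.length) x y, ⟨D + k * D, _, hV.polyTime_accepts D k, fun x => ?_⟩,
    fun x => (εyes x.length * 2 ^ D.eval x.length) ^ k.eval x.length,
    fun x => pow_pos (mul_pos (hpos _) (by positivity)) _, hyes.pow_mul D k, fun x hx => ?_,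
    fun x hx => ?_⟩
  · beta_reduce
    rw [← hp]
    rfl
  · obtain ⟨ψ, hψ, h⟩ := hLyes x hx
    have := (V x.length).le_countBits_accepts (hD _) (k.eval x.length) hψ (hpos _) h
    rwa [List.ofFn_get] at this
  · have h1 := (V x.length).countBits_accepts_le (hD _) (k.eval x.length) (hε _).1 (hLno x hx)
    rw [List.ofFn_get] at h1
    have h2 := Stoq.pow_le_of_gap (hε x.length).1 (hε x.length).2.2 (hr _).1 (hr _).2
      (D.eval x.length + 1)
    rw [← hk] at h2
    refine h1.trans ?_
    have e : (2 : ℝ) ^ D.eval x.length * (1 / 2) ^ (D.eval x.length + 1) = 1 / 2 := by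
      rw [pow_succ, ← mul_assoc, ← mul_pow]
      norm_num
    calc _ ≤ (2 : ℝ) ^ D.eval x.length * ((2 ^ D.eval x.length) ^ k.eval x.length *
          ((1 / 2) ^ (D.eval x.length + 1) * εyes x.length ^ k.eval x.length)) := by gcongr
      _ = (2 ^ D.eval x.length * (1 / 2) ^ (D.eval x.length + 1)) *
          (εyes x.length ^ k.eval x.length * (2 ^ D.eval x.length) ^ k.eval x.length) := by ring
      _ = _ := by rw [e, ← mul_pow]
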